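/- Let $S$ be a set of primes and let $P(S)$ be the set of positive integers all of whose prime divisors lie in $S$ (so $1\in P(S)$). For $n\ge 1$ let $Q_n=\prod_{q\in S}q^{a_q(n)}$, where $q^{a_q(n)}$ is the exact power of $q$ dividing $n$, let $C_n\le S_n$ be the cyclic group generated by an $n$-cycle, and let $L_n^S$ be the Frobenius characteristic of the $S_n$-representation induced from the one-dimensional representation of $C_n$ in which the generator acts as $\exp\left(\frac{2\pi i}{n}Q_n\right)$. Put $L^S(t)=\sum_{n\ge1}t^nL_n^S$. For a series $F(t)=\sum_{n\ge 1}t^nf_n$ with $f_n$ a symmetric function homogeneous of degree $n$, put $H[F](t)=\sum_{r\ge0}h_r[F(t)]$ and $E[F](t)=\sum_{r\ge0}e_r[F(t)]$ (plethysm, where $p_k[F(t)]=\sum_n t^{kn}p_k[f_n]$), so that the coefficient of $t^n$ is the homogeneous component of degree $n$. For a partition $\lambda$ let $p_\lambda=\prod_i p_{\lambda_i}$. A symmetric function is called Schur-positive if it is a linear combination of Schur functions with nonnegative integer coefficients. (1) If $2\in S$, then for every $n\ge0$ the symmetric function $\sum_{\lambda}p_\lambda$, summed over all partitions $\lambda$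 of $n$ whose parts are all odd and lie in $P(S)$, is Schur-positive; moreover $$H[L^{S\setminus\{2\}}](t)=E[L^S](t)=\sum_{n\ge0}t^n\sum_{\substack{\lambda\vdash n\\ \lambda_i\text{ odd},\ \lambda_i\in P(S)}}p_\lambda=\sum_{n\ge0}t^n\sum_{\substack{\lambda\vdash n\\ \lambda_i\in P(S\setminus\{2\})}}p_\lambda .$$ (2) If $2\notin S$, then all elements of $P(S)$ are odd, and for every $n\ge0$ the symmetric function $\sum_\lambda p_\lambda$ is Schur-positive, where $\lambda$ runs over all partitions of $n$ each of whose parts lies in $P(S)$ or is twice an odd element of $P(S)$, and in which each even part occurs at most once. -/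

import Mathlib

noncomputable section

open scoped Classical

namespace PrimeLie

/-! ### Symmetric functions -/

/-- A symmetric function `f` (over `ℂ`) is recorded by all its specialisations
`f(x_1, …, x_N)`, `N = 0, 1, 2, …`; this is the ring of families of polynomials, in which the
ring of symmetric functions embeds, with componentwise operations. -/
abbrev SymFn : Type := (N : ℕ) → MvPolynomial (Fin N) ℂ

/-- The complete homogeneous symmetric function `h_k`. -/
def h (k : ℕ) : SymFn := fun N => MvPolynomial.hsymm (Fin N) ℂ k

/-- The power sum `p_λ = ∏ p_{λ_i}`, where `p_k = ∑ x_i ^ k`. -/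
def p {n : ℕ} (lam : n.Partition) : SymFn := fun N => MvPolynomial.psumPart (Fin N) ℂ lam

/-- The `i`-th largest part of `λ` (indexed from `0`), and `0` if `i` is at least the length. -/
def rowLength {n : ℕ} (lam : n.Partition) (i : ℕ) : ℕ :=
  (lam.parts.sort (fun a b => b ≤ a)).getD i 0

/-- The Schur function `s_λ = det (h_{λ_i - i + j})` (Jacobi--Trudi), with `h_k = 0` for `k < 0`.
The partition is padded by zeros to `n = |λ|` rows. -/
def schur {n : ℕ} (lam : n.Partition) : SymFn :=
  Matrix.det (Matrix.of fun i j : Fin n =>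
    if (i : ℕ) ≤ rowLength lam i + j then h (rowLength lam i + j - i) else 0)

/-- `f` is a symmetric function of degree `n` all of whose coefficients in the Schur basis are
nonnegative integers. -/
def SchurPositive (n : ℕ) (f : SymFn) : Prop :=
  ∃ c : n.Partition → ℕ, f = ∑ lam : n.Partition, c lam • schur lam

/-! ### Plethysm -/

/-- `p_k[f]`: every variable `x_i` is replaced by `x_i ^ k`. -/
def adams (k : ℕ) (f : SymFn) : SymFn := fun N => MvPolynomial.expand k (f N)

/-- `p_k[F(t)]` for a formal power series `F(t) = ∑ t ^ n f_n` (used for `k ≥ 1`):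
the series `∑ t ^ (k n) p_k[f_n]`. -/
def adamsSeries (k : ℕ) (F : PowerSeries SymFn) : PowerSeries SymFn :=
  PowerSeries.mk fun n => if k ∣ n then adams k (PowerSeries.coeff (n / k) F) else 0

/-- `z_λ = ∏ i ^ {m_i} m_i !`, where `m_i` is the multiplicity of `i` as a part of `λ`. -/
def zee {n : ℕ} (lam : n.Partition) : ℕ :=
  ∏ i ∈ lam.parts.toFinset, i ^ lam.parts.count i * (lam.parts.count i).factorial

/-- The plethysm `h_r[F(t)]`, from `h_r = ∑_{λ ⊢ r} z_λ⁻¹ p_λ`. -/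
def hPleth (r : ℕ) (F : PowerSeries SymFn) : PowerSeries SymFn :=
  ∑ lam : r.Partition, ((zee lam : ℂ)⁻¹) • (lam.parts.map fun k => adamsSeries k F).prod

/-- The plethysm `e_r[F(t)]`, from `e_r = ∑_{λ ⊢ r} (-1) ^ (r - ℓ(λ)) z_λ⁻¹ p_λ`. -/
def ePleth (r : ℕ) (F : PowerSeries SymFn) : PowerSeries SymFn :=
  ∑ lam : r.Partition, ((-1 : ℂ) ^ (r - lam.parts.card) * (zee lam : ℂ)⁻¹) •
    (lam.parts.map fun k => adamsSeries k F).prod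

/-- `H[F](t) = ∑_{r ≥ 0} h_r[F(t)]` for a series `F(t)` without constant term: the terms with
`r > n` do not contribute to the coefficient of `t ^ n`. -/
def HPleth (F : PowerSeries SymFn) : PowerSeries SymFn :=
  PowerSeries.mk fun n => ∑ r ∈ Finset.range (n + 1), PowerSeries.coeff n (hPleth r F)

/-- `E[F](t) = ∑_{r ≥ 0} e_r[F(t)]` for a series `F(t)` without constant term. -/
def EPleth (F : PowerSeries SymFn) : PowerSeries SymFn :=
  PowerSeries.mk fun n => ∑ r ∈ Finset.range (n + 1), PowerSeries.coeff n (ePleth r F)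

/-! ### Frobenius characteristic and the representations `L_n^S` -/

/-- The Frobenius characteristic `(1 / n!) ∑_σ χ(σ) p_{type σ}` of a representation of the
symmetric group on the `n`-element set `X`, with character `χ`. -/
def frobeniusChar {X V : Type} [Fintype X] [DecidableEq X] [AddCommGroup V] [Module ℂ V]
    (ρ : Representation ℂ (Equiv.Perm X) V) : SymFn :=
  (((Fintype.card X).factorial : ℂ)⁻¹) • ∑ σ : Equiv.Perm X, ρ.character σ • p σ.partition

/-- The cyclic group `C_n = ℤ/n` as a group of permutations of the `n`-element set `ℤ/n`: its
generator `1` acts as the `n`-cycle `x ↦ 1 + x`. -/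
def cyclicHom (n : ℕ) : Multiplicative (ZMod n) →* Equiv.Perm (ZMod n) :=
  MulAction.toPermHom (Multiplicative (ZMod n)) (ZMod n)

/-- The one-dimensional representation of `C_n` in which the generator acts as multiplication by
`exp (2 π i r / n)`. -/
def cyclicRep (n : ℕ) [NeZero n] (r : ℕ) : Representation ℂ (Multiplicative (ZMod n)) ℂ :=
  (Algebra.lmul ℂ ℂ : ℂ →* Module.End ℂ ℂ).comp
    ((ZMod.stdAddChar (N := n)).mulShift (r : ZMod n)).toMonoidHom

/-- The part `Q_n = ∏_{q ∈ S} q ^ {a_q(n)}` of `n` supported on the primes in `S`. -/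
def Qpart (S : Set ℕ) (n : ℕ) : ℕ :=
  ∏ q ∈ n.primeFactors with q ∈ S, q ^ n.factorization q

/-- `P(S)`: the positive integers all of whose prime divisors lie in `S`. -/
def P (S : Set ℕ) : Set ℕ := {n | 1 ≤ n ∧ ∀ q : ℕ, q.Prime → q ∣ n → q ∈ S}

/-- `L_n^S`, the Frobenius characteristic of the representation `exp (2 π i Q_n / n)` of `C_n`
induced to the symmetric group, for `n ≥ 1`. -/
def L (S : Set ℕ) (n : ℕ) [NeZero n] : SymFn :=
  frobeniusChar (Representation.ind (cyclicHom n) (cyclicRep n (Qpart S n)))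

/-- The series `L^S(t) = ∑_{n ≥ 1} t ^ n L_n^S`. -/
def LSeries (S : Set ℕ) : PowerSeries SymFn :=
  PowerSeries.mk fun n => if hn : n = 0 then 0 else haveI : NeZero n := ⟨hn⟩; L S n

/-! ### Sums of power sums -/

/-- `P_T = ∑_{λ ∈ T} p_λ` for a set `T` of partitions of `n`. -/
def powerSumOver {n : ℕ} (T : Set n.Partition) : SymFn := ∑ lam : n.Partition with lam ∈ T, p lam

/-- The partitions of `n` all of whose parts are odd and lie in `P(S)`. -/
def oddParts (S : Set ℕ) (n : ℕ) : Set n.Partition :=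
  {lam | ∀ i ∈ lam.parts, Odd i ∧ i ∈ P S}

/-- The partitions of `n` all of whose parts lie in `P(S)`. -/
def partsIn (S : Set ℕ) (n : ℕ) : Set n.Partition :=
  {lam | ∀ i ∈ lam.parts, i ∈ P S}

/-- The partitions of `n` each of whose parts lies in `P(S)` or is twice an odd element of `P(S)`,
and in which every even part occurs at most once. -/
def partsInOrTwice (S : Set ℕ) (n : ℕ) : Set n.Partition :=
  {lam | (∀ i ∈ lam.parts, i ∈ P S ∨ ∃ m, Odd m ∧ m ∈ P S ∧ i = 2 * m) ∧
    ∀ i, Even i → lam.parts.count i ≤ 1}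

end PrimeLie

end

/-!
Let `w(e)` be `e` for `e ∈ P(S)` and `0` otherwise. Then `n L_n^S` is the sum over `d ∣ n` of
Ramanujan sums times `p_d ^ (n / d)`, and the choice of the character `exp (2 π i Q_n / n)` makes
these sums equal to `∑_{f ∣ d} μ(d / f) w(f)`, independently of `n`. The logarithmic derivatives of
`H[L^S]` and `E[L^S]` are therefore divisor sums that Möbius inversion evaluates:
`H[L^S] = ∏_{e ∈ P(S)} (1 - p_e t ^ e)⁻¹`, and the factor of `E[L^S]` at `e` is governed by
`w(e) - 2 w(e / 2)`, the second term being present for even `e` only. If `2 ∈ S`, even parts cancel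
and `E[L^S] = H[L^(S ∖ {2})]`. If `2 ∉ S`, every `e ∈ P(S)` also contributes the factor
`1 - p_{2e} t ^ {2e}`, so that the coefficients of `E[L^S]` are the sign twists of the sums in (2).

On the other hand these coefficients are sums of products of plethysms `e_r[L_m^S]`, which are
Frobenius characteristics of characters induced from one-dimensional characters, because the trace
of a wreath product on words in the alphabet factors over the cycles of the permutation. Such class
functions pair to natural numbers with all irreducible characters. By Jacobi's bialternants and the
Jacobi–Trudi determinant, the class functions belonging to the Schur functions are orthonormal
virtual characters, hence irreducible characters up to sign; the sign is `+` because a bialternant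
quotient is positive at `(1, 2, 4, …)`. Hence characters of `S_n`, also after twisting by the sign,
are Schur-positive.
-/

noncomputable section

open scoped Classical

namespace PrimeLie

/-! ### Logarithmic derivatives of power series -/

section LogarithmicDerivative

open PowerSeries
open scoped PowerSeries.WithPiTopology

variable {R : Type*} [CommRing R]

theorem derivation_prod_eq_mul {S A ι : Type*} [CommRing S] [CommRing A] [Algebra S A]
    (D : Derivation S A A) (s : Finset ι) {g b : ι → A} (h : ∀ i ∈ s, D (g i) = b i * g i) :
    D (∏ i ∈ s, g i) = (∑ i ∈ s, b i) * ∏ i ∈ s, g i := by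
  induction s using Finset.induction_on with
  | empty => simp
  | insert i s hi ih =>
    rw [Finset.prod_insert hi, Finset.sum_insert hi, D.leibniz, smul_eq_mul, smul_eq_mul,
      ih fun j hj => h j (Finset.mem_insert_of_mem hj), h i (Finset.mem_insert_self i s)]
    ring

theorem one_add_tsum_eq_expand [TopologicalSpace R] [T2Space R] {f : ℕ → ℕ → R}
    (hf : ∀ i, f i 0 = 1) (i : ℕ) :
    1 + ∑' j, f (i + 1) (j + 1) • (X : R⟦X⟧) ^ ((i + 1) * (j + 1)) =
      expand (i + 1) i.succ_ne_zero (mk (f (i + 1))) := by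
  ext n
  rw [map_add, (Nat.Partition.summable_genFun_term f i).map_tsum _
    (WithPiTopology.continuous_coeff _ _), coeff_expand, coeff_one]
  simp only [map_smul, coeff_X_pow, smul_eq_mul, mul_ite, mul_one, mul_zero, coeff_mk]
  by_cases hdvd : (i + 1) ∣ n
  · obtain ⟨m, rfl⟩ := hdvd
    rw [if_pos (dvd_mul_right _ _), Nat.mul_div_cancel_left _ i.succ_pos]
    cases m with
    | zero => simp [hf]
    | succ m =>
      rw [tsum_eq_single m, if_pos rfl, if_neg (by positivity), zero_add]
      intro j hj
      exact if_neg fun h => hj (by simpa using (Nat.eq_of_mul_eq_mul_left i.succ_pos h).symm)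
  · rw [if_neg hdvd, if_neg (fun hn : n = 0 => hdvd (hn ▸ dvd_zero _)), zero_add]
    convert tsum_zero with j
    exact if_neg fun hn : n = (i + 1) * (j + 1) => hdvd (hn ▸ dvd_mul_right _ _)

theorem exists_coeff_prod_expand_eq_coeff_genFun {f : ℕ → ℕ → R} (hf : ∀ i, f i 0 = 1) (n : ℕ) :
    ∃ s₀ : Finset ℕ, ∀ s, s₀ ⊆ s → ∀ k ≤ n,
      coeff k (∏ i ∈ s, expand (i + 1) i.succ_ne_zero (mk (f (i + 1)))) =
        coeff k (Nat.Partition.genFun f) := by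
  let _ : TopologicalSpace R := ⊥
  have _ : DiscreteTopology R := ⟨rfl⟩
  have hprod := Nat.Partition.hasProd_genFun f
  rw [HasProd, WithPiTopology.tendsto_iff_coeff_tendsto] at hprod
  have hcoeff : ∀ k ∈ Finset.range (n + 1), ∀ᶠ s : Finset ℕ in Filter.atTop,
      coeff k (∏ i ∈ s, expand (i + 1) i.succ_ne_zero (mk (f (i + 1)))) =
        coeff k (Nat.Partition.genFun f) := by
    intro k _
    have hk := hprod k
    rw [SummationFilter.unconditional_filter, nhds_discrete, Filter.tendsto_pure] at hk
    simpa only [one_add_tsum_eq_expand hf] using hk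
  obtain ⟨s₀, hs₀⟩ := Filter.eventually_atTop.mp ((Filter.eventually_all_finset _).mpr hcoeff)
  exact ⟨s₀, fun s hs k hk => hs₀ s hs k (Finset.mem_range.mpr (Nat.lt_succ_of_le hk))⟩

theorem derivation_genFun {S : Type*} [CommRing S] [Algebra S R] (D : Derivation S R⟦X⟧ R⟦X⟧)
    (hD : ∀ n f g, (∀ k ≤ n, coeff k f = coeff k g) → coeff n (D f) = coeff n (D g))
    {f : ℕ → ℕ → R} (hf : ∀ i, f i 0 = 1) {b : ℕ → R⟦X⟧}
    (hb : ∀ i : ℕ, D (expand (i + 1) i.succ_ne_zero (mk (f (i + 1)))) =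
      b (i + 1) * expand (i + 1) i.succ_ne_zero (mk (f (i + 1))))
    (hb0 : ∀ i a, a < i → coeff a (b i) = 0) :
    D (Nat.Partition.genFun f) =
      (mk fun a => ∑ i ∈ Finset.Icc 1 a, coeff a (b i)) * Nat.Partition.genFun f := by
  ext n
  obtain ⟨s₀, hs₀⟩ := exists_coeff_prod_expand_eq_coeff_genFun hf n
  have happrox := hs₀ (s₀ ∪ Finset.range n) Finset.subset_union_left
  rw [← hD n _ _ happrox, derivation_prod_eq_mul D _ fun i _ => hb i, coeff_mul, coeff_mul]
  refine Finset.sum_congr rfl fun x hx => ?_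
  have hx' := Finset.HasAntidiagonal.mem_antidiagonal.mp hx
  rw [happrox x.2 (by omega), coeff_mk, map_sum]
  congr 1
  have hIcc : Finset.Icc 1 x.1 = (Finset.range x.1).map (addRightEmbedding 1) := by
    rw [Finset.range_eq_Ico, Finset.map_add_right_Ico]
    rfl
  rw [hIcc, Finset.sum_map]
  refine (Finset.sum_subset (fun i hi => Finset.mem_union_right _ ?_) fun i _ hi => hb0 _ _ ?_).symm
  · rw [Finset.mem_range] at hi ⊢
    omega
  · rw [Finset.mem_range] at hi
    exact Nat.lt_succ_of_le (not_lt.mp hi)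

variable (R) in
/-- The Euler derivation `X d/dX`, which multiplies the coefficient of `X ^ n` by `n`. -/
def eulerDerivation : Derivation R R⟦X⟧ R⟦X⟧ := (X : R⟦X⟧) • d⁄dX R

theorem coeff_eulerDerivation (n : ℕ) (f : R⟦X⟧) :
    coeff n (eulerDerivation R f) = n * coeff n f := by
  change coeff n (X * d⁄dX R f) = _
  cases n with
  | zero => simp
  | succ n => rw [coeff_succ_X_mul, coeff_derivative, mul_comm, Nat.cast_succ]

theorem eulerDerivation_expand (i : ℕ) (hi : i ≠ 0) (f : R⟦X⟧) :
    eulerDerivation R (expand i hi f) = i * expand i hi (eulerDerivation R f) := by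
  ext n
  rw [coeff_eulerDerivation, ← map_natCast (C (R := R)), coeff_C_mul, coeff_expand, coeff_expand]
  split_ifs with hdvd
  · rw [coeff_eulerDerivation, ← mul_assoc, ← Nat.cast_mul, Nat.mul_div_cancel' hdvd]
  · simp

theorem coeff_eq_of_eulerDerivation_eq_mul [IsAddTorsionFree R] {y y' b b' : R⟦X⟧}
    (h : eulerDerivation R y = b * y) (h' : eulerDerivation R y' = b' * y')
    (hconst : coeff 0 y = coeff 0 y') {n : ℕ} (hb : ∀ i ≤ n, coeff i b = coeff i b')
    (hb0 : coeff 0 b = 0) : ∀ j ≤ n, coeff j y = coeff j y' := by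
  intro j
  induction j using Nat.strong_induction_on with
  | _ j ih =>
    intro hj
    rcases Nat.eq_zero_or_pos j with rfl | hj0
    · exact hconst
    refine nsmul_right_injective hj0.ne' ?_
    simp only [nsmul_eq_mul]
    rw [← coeff_eulerDerivation, ← coeff_eulerDerivation, h, h', coeff_mul, coeff_mul]
    refine Finset.sum_congr rfl fun x hx => ?_
    have hx' := Finset.HasAntidiagonal.mem_antidiagonal.mp hx
    rw [← hb x.1 (by omega)]
    rcases Nat.eq_zero_or_pos x.1 with hx0 | hx0
    · rw [hx0, hb0, zero_mul, zero_mul]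
    · rw [ih x.2 (by omega) (by omega)]

theorem eq_of_eulerDerivation_eq_mul [IsAddTorsionFree R] {y y' b : R⟦X⟧}
    (h : eulerDerivation R y = b * y) (h' : eulerDerivation R y' = b * y')
    (hconst : coeff 0 y = coeff 0 y') (hb0 : coeff 0 b = 0) : y = y' := by
  ext n
  exact coeff_eq_of_eulerDerivation_eq_mul h h' hconst (fun _ _ => rfl) hb0 n le_rfl

/-- A derivation of the coefficient ring, acting on a power series coefficientwise. -/
def mapCoeff {S : Type*} [CommRing S] [Algebra S R] (D : Derivation S R R) :
    Derivation S R⟦X⟧ R⟦X⟧ :=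
  Derivation.mk'
    { toFun f := mk fun n => D (coeff n f)
      map_add' f g := by ext; simp
      map_smul' c f := by ext; simp }
    fun f g => by
      ext n
      simp only [LinearMap.coe_mk, AddHom.coe_mk, coeff_mk, smul_eq_mul, map_add, coeff_mul,
        map_sum, D.leibniz, Finset.sum_add_distrib]
      congr 1
      exact (Finset.sum_equiv (Equiv.prodComm _ _) (by simp [add_comm]) (by simp))

theorem coeff_mapCoeff {S : Type*} [CommRing S] [Algebra S R] (D : Derivation S R R) (n : ℕ)
    (f : R⟦X⟧) : coeff n (mapCoeff D f) = D (coeff n f) :=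
  coeff_mk n fun n => D (coeff n f)

theorem mapCoeff_expand {S : Type*} [CommRing S] [Algebra S R] (D : Derivation S R R) (i : ℕ)
    (hi : i ≠ 0) (f : R⟦X⟧) : mapCoeff D (expand i hi f) = expand i hi (mapCoeff D f) := by
  ext n
  rw [coeff_mapCoeff, coeff_expand, coeff_expand, apply_ite D, map_zero, coeff_mapCoeff]

end LogarithmicDerivative

/-! ### Complete homogeneous symmetric functions in terms of power sums -/

section CompleteOfPowerSums

open PowerSeries

theorem zee_pos {n : ℕ} (lam : n.Partition) : 0 < zee lam := by
  refine Finset.prod_pos fun i hi => ?_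
  have := lam.parts_pos (Multiset.mem_toFinset.mp hi)
  positivity

theorem zee_ne_zero {n : ℕ} (lam : n.Partition) : (zee lam : ℂ) ≠ 0 :=
  Nat.cast_ne_zero.mpr (zee_pos lam).ne'

variable {A : Type*} [CommRing A] [Algebra ℂ A]

/-- The complete homogeneous symmetric function `h_r`, expressed in power sums and evaluated at
arbitrary values `a 1, a 2, …` of these. -/
def completeOfPowerSums (a : ℕ → A) (r : ℕ) : A :=
  ∑ lam : r.Partition, ((zee lam : ℂ)⁻¹) • (lam.parts.map a).prod

/-- The factor `a_k ^ m / (k ^ m m!)` contributed to `completeOfPowerSums` by a part `k` of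
multiplicity `m`. -/
def powerSumWeight (a : ℕ → A) (k m : ℕ) : A := ((k ^ m * m.factorial : ℕ) : ℂ)⁻¹ • a k ^ m

theorem genFun_powerSumWeight (a : ℕ → A) :
    Nat.Partition.genFun (powerSumWeight a) = mk (completeOfPowerSums a) := by
  ext r
  rw [Nat.Partition.coeff_genFun, coeff_mk, completeOfPowerSums]
  refine Finset.sum_congr rfl fun lam _ => ?_
  rw [Finset.prod_multiset_map_count, Finsupp.prod, Multiset.toFinsupp_support]
  simp only [Multiset.toFinsupp_apply, powerSumWeight, zee]
  rw [Nat.cast_prod, ← Finset.prod_inv_distrib, Finset.prod_smul]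

theorem mapCoeff_powerSumWeight (D : Derivation ℂ A A) (a : ℕ → A) (k : ℕ) :
    mapCoeff D (mk (powerSumWeight a k)) =
      C ((k : ℂ)⁻¹ • D (a k)) * X * mk (powerSumWeight a k) := by
  ext m
  rw [coeff_mapCoeff, coeff_mk, mul_assoc, coeff_C_mul]
  cases m with
  | zero => simp [powerSumWeight]
  | succ m =>
    have hscalar : (((k ^ (m + 1) * (m + 1).factorial : ℕ) : ℂ)⁻¹ * (m + 1 : ℕ)) =
        (k : ℂ)⁻¹ * ((k ^ m * m.factorial : ℕ) : ℂ)⁻¹ := by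
      push_cast [Nat.factorial_succ, pow_succ]
      field [Nat.cast_add_one_ne_zero (R := ℂ) m]
    rw [coeff_succ_X_mul, coeff_mk, powerSumWeight, powerSumWeight, D.map_smul, D.leibniz_pow,
      Nat.add_sub_cancel, smul_mul_smul_comm, ← Nat.cast_smul_eq_nsmul ℂ, smul_smul, hscalar,
      smul_eq_mul, mul_comm (D _)]

theorem derivation_completeOfPowerSums (D : Derivation ℂ A A) (a : ℕ → A) (r : ℕ) :
    D (completeOfPowerSums a r) = ∑ x ∈ Finset.HasAntidiagonal.antidiagonal r,
      (if x.1 = 0 then 0 else (x.1 : ℂ)⁻¹ • D (a x.1)) * completeOfPowerSums a x.2 := by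
  have hlog := derivation_genFun (mapCoeff D)
    (fun n f g h => by rw [coeff_mapCoeff, coeff_mapCoeff, h n le_rfl])
    (f := powerSumWeight a) (fun i => by simp [powerSumWeight])
    (b := fun i => C ((i : ℂ)⁻¹ • D (a i)) * X ^ i)
    (fun i => by
      rw [mapCoeff_expand, mapCoeff_powerSumWeight, map_mul, map_mul, expand_C, expand_X])
    fun i b hb => by rw [coeff_C_mul, coeff_X_pow, if_neg hb.ne, mul_zero]
  rw [genFun_powerSumWeight] at hlog
  have hcoeff := congrArg (coeff r) hlog
  rw [coeff_mapCoeff, coeff_mk, coeff_mul] at hcoeff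
  refine hcoeff.trans (Finset.sum_congr rfl fun x _ => ?_)
  rw [coeff_mk, coeff_mk]
  congr 1
  simp only [coeff_C_mul, coeff_X_pow, mul_ite, mul_one, mul_zero]
  rw [Finset.sum_ite_eq]
  by_cases hx : x.1 = 0
  · simp [hx]
  · rw [if_pos (Finset.mem_Icc.mpr ⟨Nat.one_le_iff_ne_zero.mpr hx, le_rfl⟩), if_neg hx]

end CompleteOfPowerSums

section CompleteSeries

open PowerSeries

theorem sum_range_sum_antidiagonal {A : Type*} [NonUnitalNonAssocSemiring A] (f g : ℕ → A)
    (u v : ℕ) (hf : ∀ k, u < k → f k = 0) (hg : ∀ k, v < k → g k = 0) :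
    ∑ r ∈ Finset.range (u + v + 1),
        ∑ y ∈ Finset.HasAntidiagonal.antidiagonal r, f y.1 * g y.2 =
      (∑ k ∈ Finset.range (u + 1), f k) * ∑ s ∈ Finset.range (v + 1), g s := by
  rw [Finset.sum_mul_sum, ← Finset.sum_product', Finset.sum_sigma']
  symm
  refine Finset.sum_of_injOn (fun y => ⟨y.1 + y.2, y⟩)
    (fun y _ y' _ hy => eq_of_heq (Sigma.mk.inj_iff.mp hy).2) (fun y hy => ?_) ?_ fun _ _ => rfl
  · simp only [Finset.coe_product, Set.mem_prod, Finset.mem_coe, Finset.mem_range] at hy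
    simp only [Finset.coe_sigma, Set.mem_sigma_iff, Finset.mem_coe, Finset.mem_range,
      Finset.HasAntidiagonal.mem_antidiagonal, and_true]
    omega
  · rintro ⟨r, y⟩ hy hy'
    simp only [Finset.mem_sigma, Finset.mem_range, Finset.HasAntidiagonal.mem_antidiagonal] at hy
    by_cases hu : u < y.1
    · rw [hf _ hu, zero_mul]
    by_cases hv : v < y.2
    · rw [hg _ hv, mul_zero]
    obtain ⟨_, rfl⟩ := hy
    refine absurd ⟨y, ?_, rfl⟩ hy'
    simp only [Finset.coe_product, Set.mem_prod, Finset.mem_coe, Finset.mem_range]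
    omega

variable {R : Type*} [CommRing R] [Algebra ℂ R]

theorem coeff_completeOfPowerSums_eq_zero {a : ℕ → R⟦X⟧} (ha : ∀ k j, j < k → coeff j (a k) = 0)
    {r j : ℕ} (hj : j < r) : coeff j (completeOfPowerSums a r) = 0 := by
  have X_pow_sum_dvd : ∀ s : Multiset ℕ, (X : R⟦X⟧) ^ s.sum ∣ (s.map a).prod := by
    intro s
    induction s using Multiset.induction_on with
    | empty => simp
    | cons k s ih =>
      rw [Multiset.sum_cons, Multiset.map_cons, Multiset.prod_cons, pow_add]
      exact mul_dvd_mul (X_pow_dvd_iff.mpr (ha k)) ih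
  rw [completeOfPowerSums, map_sum]
  refine Finset.sum_eq_zero fun lam _ => ?_
  have hdvd := X_pow_sum_dvd lam.parts
  rw [lam.parts_sum, X_pow_dvd_iff] at hdvd
  rw [coeff_smul, hdvd j hj, smul_zero]

/-- The sum over `r` of `completeOfPowerSums a r`, for series `a k` of order at least `k`. -/
def completeSeries (a : ℕ → R⟦X⟧) : R⟦X⟧ :=
  mk fun n => ∑ r ∈ Finset.range (n + 1), coeff n (completeOfPowerSums a r)

theorem coeff_zero_completeSeries (a : ℕ → R⟦X⟧) : coeff 0 (completeSeries a) = 1 := by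
  simp [completeSeries, completeOfPowerSums, zee]

theorem eulerDerivation_completeSeries {a : ℕ → R⟦X⟧} (ha : ∀ k j, j < k → coeff j (a k) = 0) :
    eulerDerivation R (completeSeries a) =
      (mk fun n => ∑ k ∈ Finset.Icc 1 n, ((n : ℂ) / k) • coeff n (a k)) * completeSeries a := by
  ext n
  let B : ℕ → R⟦X⟧ := fun k => if k = 0 then 0 else (k : ℂ)⁻¹ • eulerDerivation R (a k)
  have hB : ∀ k j, j < k → coeff j (B k) = 0 := by
    intro k j hj
    simp only [B]
    split_ifs
    · simp
    · rw [coeff_smul, coeff_eulerDerivation, ha k j hj, mul_zero, smul_zero]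
  have coeff_euler : ∀ r, coeff n (eulerDerivation R (completeOfPowerSums a r)) =
      ∑ x ∈ Finset.HasAntidiagonal.antidiagonal n, ∑ y ∈ Finset.HasAntidiagonal.antidiagonal r,
        coeff x.1 (B y.1) * coeff x.2 (completeOfPowerSums a y.2) := by
    intro r
    have hr := derivation_completeOfPowerSums ((eulerDerivation R).restrictScalars ℂ) a r
    rw [Derivation.restrictScalars_apply] at hr
    rw [hr, map_sum, Finset.sum_comm]
    exact Finset.sum_congr rfl fun y _ => coeff_mul _ _ _
  rw [coeff_eulerDerivation, completeSeries, coeff_mk, Finset.mul_sum, coeff_mul]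
  simp only [← coeff_eulerDerivation]
  rw [Finset.sum_congr rfl fun r _ => coeff_euler r, Finset.sum_comm]
  refine Finset.sum_congr rfl fun x hx => ?_
  obtain rfl := Finset.HasAntidiagonal.mem_antidiagonal.mp hx
  rw [sum_range_sum_antidiagonal (fun k => coeff x.1 (B k))
    (fun s => coeff x.2 (completeOfPowerSums a s)) x.1 x.2 (fun k hk => hB k _ hk)
    fun s hs => coeff_completeOfPowerSums_eq_zero ha hs, coeff_mk, coeff_mk]
  congr 1
  rw [Finset.range_eq_Ico, Finset.sum_eq_sum_Ico_succ_bot x.1.succ_pos]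
  simp only [B, if_pos, map_zero, zero_add]
  refine Finset.sum_congr rfl fun k hk => ?_
  rw [if_neg (Nat.one_le_iff_ne_zero.mp (Finset.mem_Icc.mp hk).1), coeff_smul,
    coeff_eulerDerivation, div_eq_inv_mul, mul_smul, Algebra.smul_def (x.1 : ℂ), map_natCast]

theorem completeOfPowerSums_C_mul_X_pow (a : ℕ → R) (r : ℕ) :
    completeOfPowerSums (fun k => C (a k) * X ^ k) r = C (completeOfPowerSums a r) * X ^ r := by
  have hprod : ∀ s : Multiset ℕ,
      (s.map fun k => C (a k) * (X : R⟦X⟧) ^ k).prod = C (s.map a).prod * X ^ s.sum := by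
    intro s
    induction s using Multiset.induction_on with
    | empty => simp
    | cons k s ih =>
      rw [Multiset.map_cons, Multiset.prod_cons, ih, Multiset.map_cons, Multiset.prod_cons,
        Multiset.sum_cons, map_mul, pow_add]
      ring
  simp only [completeOfPowerSums, hprod, Nat.Partition.parts_sum, map_sum, Finset.sum_mul]
  refine Finset.sum_congr rfl fun lam _ => ?_
  ext n
  simp only [coeff_smul, coeff_C_mul, smul_mul_assoc]

theorem coeff_completeSeries_C_mul_X_pow (a : ℕ → R) (n : ℕ) :
    coeff n (completeSeries fun k => C (a k) * X ^ k) = completeOfPowerSums a n := by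
  simp [completeSeries, completeOfPowerSums_C_mul_X_pow, coeff_C_mul, coeff_X_pow]

end CompleteSeries

section Complete

open PowerSeries

variable {A Y : Type*} [CommRing A] [Fintype Y]

/-- The complete homogeneous symmetric function `h_n` of a finite alphabet `a`. -/
def complete (a : Y → A) (n : ℕ) : A := ∑ f ∈ Finset.piAntidiag Finset.univ n, ∏ y, a y ^ f y

theorem hsymm_eq_complete [inst : DecidableEq Y] (k : ℕ) :
    MvPolynomial.hsymm Y A k = complete (fun y => MvPolynomial.X y) k := by
  obtain rfl : inst = fun a b => Classical.propDecidable (a = b) := Subsingleton.elim _ _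
  rw [complete, ← Finset.map_sym_eq_piAntidiag, Finset.sum_map, MvPolynomial.hsymm, Finset.sym_univ]
  refine Finset.sum_congr rfl fun s _ => ?_
  rw [Finset.prod_multiset_map_count]
  refine Finset.prod_subset (Finset.subset_univ _) fun y _ hy => ?_
  rw [Multiset.mem_toFinset] at hy
  rw [Multiset.count_eq_zero_of_notMem hy, pow_zero]

theorem mk_complete (a : Y → A) : mk (complete a) = ∏ y, mk fun m => a y ^ m := by
  ext m
  rw [coeff_mk, coeff_prod, complete]
  refine Finset.sum_bij' (fun f _ => Finsupp.equivFunOnFinite.symm f) (fun f _ => f)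
    (fun f hf => ?_) (fun f hf => ?_) (fun _ _ => rfl) (fun f _ => by ext; rfl) fun f _ => ?_
  · exact Finset.mem_finsuppAntidiag.mpr
      ⟨(Finset.mem_piAntidiag.mp hf).1, Finset.subset_univ _⟩
  · exact Finset.mem_piAntidiag.mpr
      ⟨(Finset.mem_finsuppAntidiag.mp hf).1, fun y _ => Finset.mem_univ y⟩
  · exact Finset.prod_congr rfl fun y _ => by rw [coeff_mk]; rfl

theorem eulerDerivation_mk_pow (c : A) :
    eulerDerivation A (mk fun m => c ^ m) =
      (mk fun m => if m = 0 then 0 else c ^ m) * mk fun m => c ^ m := by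
  ext m
  rw [coeff_eulerDerivation, coeff_mk, coeff_mul,
    Finset.Nat.sum_antidiagonal_eq_sum_range_succ_mk, Finset.sum_range_succ']
  simp only [coeff_mk, if_pos, zero_mul, add_zero, Nat.succ_ne_zero, if_false, ← pow_add]
  rw [Finset.sum_congr rfl fun k hk => by
    rw [Nat.add_sub_of_le (Finset.mem_range.mp hk)], Finset.sum_const, Finset.card_range,
    nsmul_eq_mul]

theorem eulerDerivation_mk_complete (a : Y → A) :
    eulerDerivation A (mk (complete a)) =
      (mk fun m => if m = 0 then 0 else ∑ y, a y ^ m) * mk (complete a) := by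
  rw [mk_complete, derivation_prod_eq_mul _ _ fun y _ => eulerDerivation_mk_pow (a y)]
  congr 1
  ext m
  simp only [map_sum, coeff_mk]
  split_ifs <;> simp

theorem complete_eq_completeOfPowerSums [Algebra ℂ A] (a : Y → A) (n : ℕ) :
    complete a n = completeOfPowerSums (fun k => ∑ y, a y ^ k) n := by
  have _ : Module ℚ A := Module.compHom A (algebraMap ℚ ℂ)
  have _ : IsAddTorsionFree A := IsAddTorsionFree.of_module_rat A
  have euler_completeSeries := eulerDerivation_completeSeries
    (a := fun k => C (∑ y, a y ^ k) * X ^ k)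
    fun k j hj => by rw [coeff_C_mul, coeff_X_pow, if_neg hj.ne, mul_zero]
  have hlog : (mk fun n => ∑ k ∈ Finset.Icc 1 n,
      ((n : ℂ) / k) • coeff n (C (∑ y, a y ^ k) * X ^ k)) =
        mk fun m => if m = 0 then 0 else ∑ y, a y ^ m := by
    ext m
    simp only [coeff_mk, coeff_C_mul, coeff_X_pow, mul_ite, mul_one, mul_zero, smul_ite, smul_zero]
    rw [Finset.sum_ite_eq]
    rcases Nat.eq_zero_or_pos m with rfl | hm
    · simp
    · rw [if_pos (Finset.mem_Icc.mpr ⟨hm, le_rfl⟩), if_neg hm.ne',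
        div_self (Nat.cast_ne_zero.mpr hm.ne'), one_smul]
  rw [hlog] at euler_completeSeries
  have hseries := eq_of_eulerDerivation_eq_mul (eulerDerivation_mk_complete a) euler_completeSeries
    (by simp [coeff_zero_completeSeries, complete]) (by simp)
  rw [← coeff_completeSeries_C_mul_X_pow, ← hseries, coeff_mk]

theorem prod_pow_prod_eq_monomial {I : Type*} [Fintype I] (x : Y → A) (F : I × Y → ℕ) :
    ∏ ij : I × Y, (MvPolynomial.C (x ij.2) * MvPolynomial.X ij.1) ^ F ij =
      MvPolynomial.monomial (Finsupp.equivFunOnFinite.symm fun i => ∑ j, F (i, j))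
        (∏ i, ∏ j, x j ^ F (i, j)) := by
  rw [MvPolynomial.monomial_eq, Finsupp.prod_fintype _ _ fun i => pow_zero _,
    Fintype.prod_prod_type, map_prod, ← Finset.prod_mul_distrib]
  refine Finset.prod_congr rfl fun i _ => ?_
  rw [map_prod, Finsupp.equivFunOnFinite_symm_apply_apply, ← Finset.prod_pow_eq_pow_sum,
    ← Finset.prod_mul_distrib]
  exact Finset.prod_congr rfl fun j _ => by rw [mul_pow, map_pow]

theorem coeff_complete_mul {I : Type*} [Fintype I] (x : Y → A) (α : I →₀ ℕ) :
    (complete (fun ij : I × Y => MvPolynomial.C (x ij.2) * MvPolynomial.X ij.1)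
      (∑ i, α i)).coeff α = ∏ i, complete x (α i) := by
  have hcoeff : ∀ F : I × Y → ℕ,
      (∏ ij : I × Y, (MvPolynomial.C (x ij.2) * MvPolynomial.X ij.1) ^ F ij).coeff α =
        if ∀ i, ∑ j, F (i, j) = α i then ∏ i, ∏ j, x j ^ F (i, j) else 0 := fun F => by
    simp only [prod_pow_prod_eq_monomial, MvPolynomial.coeff_monomial, DFunLike.ext_iff]
    rfl
  rw [complete, MvPolynomial.coeff_sum, Finset.sum_congr rfl fun F _ => hcoeff F,
    ← Finset.sum_filter]
  simp only [complete]
  rw [Finset.prod_univ_sum]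
  refine Finset.sum_bij' (fun F _ i j => F (i, j)) (fun F _ ij => F ij.1 ij.2)
    (fun F hF => ?_) (fun F hF => ?_) (fun _ _ => rfl) (fun _ _ => rfl) fun _ _ => rfl
  · exact Fintype.mem_piFinset.mpr fun i => Finset.mem_piAntidiag.mpr
      ⟨(Finset.mem_filter.mp hF).2 i, fun j _ => Finset.mem_univ j⟩
  · have hrow : ∀ i, ∑ j, F i j = α i := fun i =>
      (Finset.mem_piAntidiag.mp (Fintype.mem_piFinset.mp hF i)).1
    refine Finset.mem_filter.mpr ⟨?_, hrow⟩
    simp only [Finset.mem_piAntidiag, Finset.mem_univ, implies_true, and_true,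
      Fintype.sum_prod_type]
    exact Finset.sum_congr rfl fun i _ => hrow i

end Complete

/-! ### Traces along the cycles of a permutation -/

section Trace

open Equiv

variable {X X' : Type*} [Fintype X] [DecidableEq X] [Fintype X'] [DecidableEq X']

theorem parts_eq_add_subtypePerm (σ : Perm X) (q : X → Prop) [DecidablePred q]
    (hq : ∀ x, q (σ x) ↔ q x) :
    σ.partition.parts = (σ.subtypePerm hq).partition.parts +
      (σ.subtypePerm (p := fun x => ¬ q x) fun x => not_congr (hq x)).partition.parts := by
  set a := σ.subtypePerm hq
  set b := σ.subtypePerm (p := fun x => ¬ q x) fun x => not_congr (hq x)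
  have hdisjoint : Perm.Disjoint (Perm.ofSubtype a) (Perm.ofSubtype b) := by
    intro x
    by_cases hx : q x
    · exact Or.inr (Perm.ofSubtype_apply_of_not_mem b (not_not_intro hx))
    · exact Or.inl (Perm.ofSubtype_apply_of_not_mem a hx)
  have hmul : σ = Perm.ofSubtype a * Perm.ofSubtype b := by
    ext x
    by_cases hx : q x
    · rw [Perm.mul_apply, Perm.ofSubtype_apply_of_not_mem b (not_not_intro hx),
        Perm.ofSubtype_apply_of_mem a hx]
      rfl
    · rw [hdisjoint.commute.eq, Perm.mul_apply, Perm.ofSubtype_apply_of_not_mem a hx,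
        Perm.ofSubtype_apply_of_mem b hx]
      rfl
  have hcycleType : σ.cycleType = a.cycleType + b.cycleType := by
    conv_lhs => rw [hmul]
    rw [hdisjoint.cycleType_mul, Perm.cycleType_ofSubtype, Perm.cycleType_ofSubtype]
  have ha : a.cycleType.sum ≤ Fintype.card {x // q x} :=
    a.sum_cycleType ▸ Finset.card_le_univ _
  have hb : b.cycleType.sum ≤ Fintype.card {x // ¬ q x} :=
    b.sum_cycleType ▸ Finset.card_le_univ _
  have hfixed : Fintype.card X - (a.cycleType.sum + b.cycleType.sum) =
      (Fintype.card {x // q x} - a.cycleType.sum) +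
        (Fintype.card {x // ¬ q x} - b.cycleType.sum) := by
    have := Fintype.card_subtype_compl q
    have := Fintype.card_subtype_le q
    omega
  rw [Perm.parts_partition, Perm.parts_partition, Perm.parts_partition, ← Perm.sum_cycleType,
    ← Perm.sum_cycleType, ← Perm.sum_cycleType, hcycleType, Multiset.sum_add, hfixed,
    Multiset.replicate_add]
  abel

theorem parts_permCongr (e : X ≃ X') (σ : Perm X) :
    (e.permCongr σ).partition.parts = σ.partition.parts := by
  have hextend : e.permCongr σ = σ.extendDomain (p := fun _ : X' => True)
      (e.trans (Equiv.subtypeUnivEquiv fun _ => trivial).symm) := by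
    ext y
    rw [Perm.extendDomain_apply_subtype _ _ trivial]
    simp [Equiv.permCongr_apply]
  rw [Perm.parts_partition, Perm.parts_partition, ← Perm.sum_cycleType, ← Perm.sum_cycleType,
    hextend, Perm.cycleType_extendDomain, Fintype.card_congr e]

theorem parts_of_sameCycle (σ : Perm X) (x₀ : X) (h : ∀ x, σ.SameCycle x₀ x) :
    σ.partition.parts = {Fintype.card X} := by
  by_cases hfix : σ x₀ = x₀
  · have heq : ∀ x, x = x₀ := fun x => by
      obtain ⟨k, hk⟩ := h x
      rw [← hk, Perm.zpow_apply_eq_self_of_apply_eq_self hfix]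
    have hσ : σ = 1 := Equiv.ext fun x => by rw [heq x, hfix, Perm.one_apply]
    rw [Perm.parts_partition, hσ, Perm.cycleType_one, Fintype.card_eq_one_iff.mpr ⟨x₀, heq⟩]
    simp
  · have hsupport : σ.support = Finset.univ := by
      ext x
      simp only [Perm.mem_support, Finset.mem_univ, iff_true]
      exact fun hx => hfix ((h x).apply_eq_self_iff.mpr hx)
    rw [Perm.parts_partition, Perm.IsCycle.cycleType ⟨x₀, hfix, fun y _ => h y⟩, hsupport]
    simp

theorem parts_finRotate (m : ℕ) : (finRotate (m + 1)).partition.parts = {m + 1} := by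
  cases m with
  | zero =>
    rw [Perm.parts_partition, Subsingleton.elim (α := Perm (Fin 1)) (finRotate (0 + 1)) 1]
    simp
  | succ m =>
    rw [Perm.parts_partition, cycleType_finRotate, support_finRotate]
    simp

variable {A Y : Type*} [CommRing A] [Fintype Y]

theorem sum_prod_permCongr (e : X ≃ X') (σ : Perm X) (t : Y → Y → A) :
    ∑ c : X' → Y, ∏ x, t (c x) (c (e.permCongr σ x)) = ∑ c : X → Y, ∏ x, t (c x) (c (σ x)) := by
  rw [← (Equiv.arrowCongr e (Equiv.refl Y)).sum_comp]
  refine Finset.sum_congr rfl fun c _ => ?_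
  rw [← e.prod_comp]
  simp [Equiv.permCongr_apply, Equiv.arrowCongr]

theorem sum_prod_perm_eq_mul (σ : Perm X) (q : X → Prop) [DecidablePred q]
    (hq : ∀ x, q (σ x) ↔ q x) (t : Y → Y → A) :
    ∑ c : X → Y, ∏ x, t (c x) (c (σ x)) =
      (∑ c : {x // q x} → Y, ∏ x, t (c x) (c (σ.subtypePerm hq x))) *
        ∑ c : {x // ¬ q x} → Y, ∏ x, t (c x)
          (c (σ.subtypePerm (p := fun x => ¬ q x) (fun x => not_congr (hq x)) x)) := by
  rw [← (Equiv.piEquivPiSubtypeProd q fun _ => Y).symm.sum_comp, Fintype.sum_prod_type,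
    Finset.sum_mul_sum]
  refine Finset.sum_congr rfl fun c₁ _ => Finset.sum_congr rfl fun c₂ _ => ?_
  rw [← Fintype.prod_subtype_mul_prod_subtype q]
  congr 1
  · refine Finset.prod_congr rfl fun x _ => ?_
    simp only [Equiv.piEquivPiSubtypeProd, Equiv.coe_fn_symm_mk, dif_pos x.2,
      dif_pos ((hq x).mpr x.2)]
    rfl
  · refine Finset.prod_congr rfl fun x _ => ?_
    simp only [Equiv.piEquivPiSubtypeProd, Equiv.coe_fn_symm_mk, dif_neg x.2,
      dif_neg ((not_congr (hq x)).mpr x.2)]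
    rfl

variable [DecidableEq Y]

theorem sum_prod_path (t : Y → Y → A) (m : ℕ) : ∀ K : Y → Y → A,
    ∑ c : Fin (m + 1) → Y, (∏ i : Fin m, t (c i.castSucc) (c i.succ)) * K (c 0) (c (Fin.last m)) =
      ∑ a, ∑ b, (Matrix.of t ^ m) a b * K a b := by
  induction m with
  | zero =>
    intro K
    rw [← (Equiv.funUnique (Fin 1) Y).symm.sum_comp]
    simp [Matrix.one_apply, ite_mul]
  | succ m ih =>
    intro K
    rw [← (Fin.consEquiv fun _ : Fin (m + 1 + 1) => Y).sum_comp, Fintype.sum_prod_type]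
    refine Finset.sum_congr rfl fun y _ => ?_
    simp only [Fin.consEquiv, Equiv.coe_fn_mk, Fin.prod_univ_succ, Fin.castSucc_zero, Fin.cons_zero,
      ← Fin.succ_castSucc, Fin.cons_succ, ← Fin.succ_last]
    have hpath := ih fun a b => t y a * K y b
    simp only [mul_left_comm _ (t y _), ← mul_assoc (t y _)] at hpath
    rw [hpath, Finset.sum_comm]
    simp only [pow_succ', Matrix.mul_apply, Matrix.of_apply, Finset.sum_mul]

theorem sum_prod_finRotate (t : Y → Y → A) (m : ℕ) :
    ∑ c : Fin (m + 1) → Y, ∏ i, t (c i) (c (finRotate (m + 1) i)) =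
      (Matrix.of t ^ (m + 1)).trace := by
  simp only [pow_succ, Matrix.trace, Matrix.diag_apply, Matrix.mul_apply, Matrix.of_apply]
  rw [← sum_prod_path t m fun a b => t b a]
  refine Finset.sum_congr rfl fun c _ => ?_
  rw [Fin.prod_univ_castSucc]
  simp

theorem sum_prod_perm_of_sameCycle (t : Y → Y → A) (σ : Perm X) (x₀ : X)
    (h : ∀ x, σ.SameCycle x₀ x) :
    ∑ c : X → Y, ∏ x, t (c x) (c (σ x)) = (Matrix.of t ^ Fintype.card X).trace := by
  obtain ⟨m, hm⟩ := Nat.exists_eq_succ_of_ne_zero (Fintype.card_pos_iff.mpr ⟨x₀⟩).ne'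
  let e : X ≃ Fin (m + 1) := Fintype.equivFinOfCardEq hm
  have hconj : IsConj (finRotate (m + 1)) (e.permCongr σ) := by
    rw [Perm.partition_eq_of_isConj]
    ext1
    rw [parts_finRotate, parts_permCongr, parts_of_sameCycle σ x₀ h, hm]
  obtain ⟨g, hg⟩ := isConj_iff.mp hconj
  rw [hm, ← sum_prod_finRotate, ← sum_prod_permCongr e σ t, ← hg,
    ← sum_prod_permCongr g (finRotate (m + 1)) t]
  rfl

theorem sum_prod_perm (t : Y → Y → A) (σ : Perm X) :
    ∑ c : X → Y, ∏ x, t (c x) (c (σ x)) =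
      (σ.partition.parts.map fun k => (Matrix.of t ^ k).trace).prod := by
  obtain ⟨n, hn⟩ : ∃ n, Fintype.card X = n := ⟨_, rfl⟩
  induction n using Nat.strong_induction_on generalizing X with
  | _ n ih =>
  rcases isEmpty_or_nonempty X with _ | ⟨⟨x₀⟩⟩
  · rw [Perm.parts_partition, Subsingleton.elim σ 1, Perm.cycleType_one]
    simp
  by_cases htransitive : ∀ x, σ.SameCycle x₀ x
  · rw [sum_prod_perm_of_sameCycle t σ x₀ htransitive, parts_of_sameCycle σ x₀ htransitive,
      Multiset.map_singleton, Multiset.prod_singleton]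
  · push Not at htransitive
    obtain ⟨x₁, hx₁⟩ := htransitive
    have hinvariant : ∀ x, σ.SameCycle x₀ (σ x) ↔ σ.SameCycle x₀ x := fun _ =>
      Perm.sameCycle_apply_right
    have hlt : Fintype.card {x // σ.SameCycle x₀ x} < n := hn ▸ Fintype.card_subtype_lt hx₁
    have hlt' : Fintype.card {x // ¬ σ.SameCycle x₀ x} < n :=
      hn ▸ Fintype.card_subtype_lt (x := x₀) (not_not_intro (Perm.SameCycle.refl σ x₀))
    rw [sum_prod_perm_eq_mul σ _ hinvariant, parts_eq_add_subtypePerm σ _ hinvariant,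
      Multiset.map_add, Multiset.prod_add, ih _ hlt _ rfl, ih _ hlt' _ rfl]

theorem sum_fixed_colourings (σ : Perm X) (a : Y → A) :
    ∑ c : X → Y, (if ∀ x, c (σ x) = c x then ∏ x, a (c x) else 0) =
      (σ.partition.parts.map fun k => ∑ y, a y ^ k).prod := by
  have htrace := sum_prod_perm (Matrix.diagonal a) σ
  have hpow : ∀ k, (Matrix.of (Matrix.diagonal a) ^ k).trace = ∑ y, a y ^ k := fun k => by
    change (Matrix.diagonal a ^ k).trace = _
    rw [Matrix.diagonal_pow, Matrix.trace_diagonal]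
    rfl
  simp only [hpow] at htrace
  rw [← htrace]
  refine Finset.sum_congr rfl fun c _ => ?_
  split_ifs with hc
  · exact Finset.prod_congr rfl fun x _ => by rw [hc, Matrix.diagonal_apply_eq]
  · push Not at hc
    obtain ⟨x, hx⟩ := hc
    exact (Finset.prod_eq_zero (Finset.mem_univ x)
      (Matrix.diagonal_apply_ne a fun h => hx h.symm)).symm

end Trace

/-! ### Sums over the symmetric group and sums over partitions -/

section ClassSums

open Equiv

theorem parts_eq_filter_add_replicate {n : ℕ} (lam : n.Partition) :
    lam.parts = lam.parts.filter (2 ≤ ·) + Multiset.replicate (lam.parts.count 1) 1 := by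
  ext i
  rw [Multiset.count_add, Multiset.count_filter, Multiset.count_replicate]
  rcases Nat.lt_or_ge i 2 with hi | hi
  · interval_cases i
    · simp [Multiset.count_eq_zero_of_notMem fun h => absurd (lam.parts_pos h) (lt_irrefl 0)]
    · simp
  · rw [if_pos hi, if_neg (by omega), add_zero]

theorem zee_eq_mul_prod {n : ℕ} (lam : n.Partition) :
    zee lam = (lam.parts.count 1).factorial * (lam.parts.filter (2 ≤ ·)).prod *
      ∏ i ∈ (lam.parts.filter (2 ≤ ·)).toFinset,
        ((lam.parts.filter (2 ≤ ·)).count i).factorial := by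
  have hparts := parts_eq_filter_add_replicate lam
  have hprod : lam.parts.prod = (lam.parts.filter (2 ≤ ·)).prod := by
    rw [hparts, Multiset.prod_add, Multiset.prod_replicate, one_pow, mul_one, ← hparts]
  have hsubset : lam.parts.toFinset ⊆ insert 1 (lam.parts.filter (2 ≤ ·)).toFinset := by
    intro i hi
    rw [Multiset.mem_toFinset, hparts, Multiset.mem_add] at hi
    rw [Finset.mem_insert, Multiset.mem_toFinset]
    exact hi.symm.imp Multiset.eq_of_mem_replicate id
  have hfactorials : ∏ i ∈ lam.parts.toFinset, (lam.parts.count i).factorial =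
      (lam.parts.count 1).factorial * ∏ i ∈ (lam.parts.filter (2 ≤ ·)).toFinset,
        ((lam.parts.filter (2 ≤ ·)).count i).factorial := by
    rw [Finset.prod_subset hsubset fun i _ hi => by
      rw [Multiset.count_eq_zero_of_notMem (mt Multiset.mem_toFinset.mpr hi), Nat.factorial_zero],
      Finset.prod_insert (by simp)]
    congr 1
    refine Finset.prod_congr rfl fun i hi => ?_
    rw [Multiset.count_filter_of_pos (Multiset.mem_filter.mp (Multiset.mem_toFinset.mp hi)).2]
  rw [zee, Finset.prod_mul_distrib, ← Finset.prod_multiset_count, hprod, hfactorials]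
  ring

variable {X : Type*} [Fintype X] [DecidableEq X] {n : ℕ}

theorem card_filter_parts_mul_zee (hX : Fintype.card X = n) (lam : n.Partition) :
    (Finset.univ.filter fun σ : Perm X => σ.partition.parts = lam.parts).card * zee lam =
      n.factorial := by
  have hparts := parts_eq_filter_add_replicate lam
  have hsum : (lam.parts.filter (2 ≤ ·)).sum + lam.parts.count 1 = n := by
    conv_rhs => rw [← lam.parts_sum, hparts]
    simp
  have hcycleType : ∀ σ : Perm X,
      σ.partition.parts = lam.parts ↔ σ.cycleType = lam.parts.filter (2 ≤ ·) := fun σ => by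
    refine ⟨fun h => by rw [← Perm.filter_parts_partition_eq_cycleType, h], fun h => ?_⟩
    rw [Perm.parts_partition, ← Perm.sum_cycleType, h, hX, Nat.sub_eq_of_eq_add' hsum.symm,
      ← hparts]
  have hcard := Perm.card_of_cycleType_mul_eq X (lam.parts.filter (2 ≤ ·))
  rw [hX, if_pos ⟨by omega, fun a ha => (Multiset.mem_filter.mp ha).2⟩,
    Nat.sub_eq_of_eq_add' hsum.symm, ← zee_eq_mul_prod] at hcard
  rw [Finset.filter_congr fun σ _ => hcycleType σ, hcard]

/-- The cycle type of a permutation of an `n`-element set, as a partition of `n`. -/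
def cyclePartition (hX : Fintype.card X = n) (σ : Perm X) : n.Partition :=
  ⟨σ.partition.parts, σ.partition.parts_pos, σ.partition.parts_sum.trans hX⟩

theorem sum_perm_eq_sum_partition (hX : Fintype.card X = n) {M : Type*} [AddCommGroup M]
    [Module ℂ M] (F : n.Partition → M) :
    ∑ σ : Perm X, F (cyclePartition hX σ) =
      (n.factorial : ℂ) • ∑ lam : n.Partition, ((zee lam : ℂ)⁻¹) • F lam := by
  rw [← Finset.sum_fiberwise Finset.univ (cyclePartition hX), Finset.smul_sum]
  refine Finset.sum_congr rfl fun lam _ => ?_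
  have hfiber : (Finset.univ.filter fun σ : Perm X => cyclePartition hX σ = lam) =
      Finset.univ.filter fun σ : Perm X => σ.partition.parts = lam.parts :=
    Finset.filter_congr fun σ _ => Nat.Partition.ext_iff
  rw [Finset.sum_congr rfl fun σ hσ => by rw [(Finset.mem_filter.mp hσ).2], Finset.sum_const,
    hfiber, ← card_filter_parts_mul_zee hX lam, smul_smul, Nat.cast_mul, mul_assoc,
    mul_inv_cancel₀ (zee_ne_zero lam), mul_one, Nat.cast_smul_eq_nsmul]

end ClassSums

/-! ### Class functions and their Frobenius characteristic -/

section ClassFunctions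

variable {n : ℕ}

/-- The Frobenius characteristic `∑ z_λ⁻¹ χ(λ) p_λ` of a class function `χ` of the symmetric
group, given by its value on every cycle type. -/
def frob : (n.Partition → ℂ) →ₗ[ℂ] SymFn :=
  ∑ lam, (LinearMap.proj lam).smulRight ((zee lam : ℂ)⁻¹ • p lam)

/-- The bilinear form `(1 / n!) ∑_σ χ(σ) ψ(σ)` on class functions of the symmetric group. -/
def pairing : LinearMap.BilinForm ℂ (n.Partition → ℂ) :=
  ∑ lam, (zee lam : ℂ)⁻¹ • (LinearMap.mul ℂ ℂ).compl₁₂ (LinearMap.proj lam) (LinearMap.proj lam)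

theorem frob_eq_sum (χ : n.Partition → ℂ) :
    frob χ = ∑ lam, (χ lam * (zee lam : ℂ)⁻¹) • p lam := by
  simp [frob, smul_smul]

theorem frob_apply (χ : n.Partition → ℂ) (N : ℕ) :
    frob χ N = ∑ lam, (χ lam * (zee lam : ℂ)⁻¹) • p lam N := by
  simp [frob_eq_sum, Finset.sum_apply]

theorem pairing_apply (χ ψ : n.Partition → ℂ) :
    pairing χ ψ = ∑ lam, χ lam * ψ lam * (zee lam : ℂ)⁻¹ := by
  simp [pairing, mul_comm]

theorem pairing_comm (χ ψ : n.Partition → ℂ) : pairing χ ψ = pairing ψ χ := by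
  simp only [pairing_apply, mul_comm (χ _)]

/-- The permutation character of the Young subgroup `∏ S_{α_i}`: its value on the cycle type `λ` is
the coefficient of `x ^ α` in `p_λ`. -/
def contentChar (α : Fin n →₀ ℕ) (lam : n.Partition) : ℂ := (p lam n).coeff α

theorem pairing_contentChar (α : Fin n →₀ ℕ) (χ : n.Partition → ℂ) :
    pairing (contentChar α) χ = (frob χ n).coeff α := by
  rw [frob_apply, MvPolynomial.coeff_sum, pairing_apply]
  refine Finset.sum_congr rfl fun lam _ => ?_
  rw [MvPolynomial.coeff_smul, contentChar, smul_eq_mul]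
  ring

theorem prod_psum_mul_eq (lam : n.Partition) (N M : ℕ) :
    (lam.parts.map fun k => ∑ y : Fin M × Fin N,
      (MvPolynomial.C (MvPolynomial.X y.2) * MvPolynomial.X y.1 :
        MvPolynomial (Fin M) (MvPolynomial (Fin N) ℂ)) ^ k).prod =
      MvPolynomial.C (p lam N) * MvPolynomial.map MvPolynomial.C (p lam M) := by
  rw [p, p, MvPolynomial.psumPart, MvPolynomial.psumPart, map_multiset_prod, map_multiset_prod,
    Multiset.map_map, Multiset.map_map, ← Multiset.prod_map_mul]
  congr 1
  refine Multiset.map_congr rfl fun k _ => ?_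
  simp only [Function.comp_apply, MvPolynomial.psum, map_sum, map_pow, MvPolynomial.map_X]
  rw [Finset.sum_mul_sum, Finset.sum_comm, Fintype.sum_prod_type]
  simp only [mul_pow]

theorem frob_contentChar (α : Fin n →₀ ℕ) (hα : ∑ i, α i = n) :
    frob (contentChar α) = ∏ i, h (α i) := by
  funext N
  have cauchy := coeff_complete_mul (fun j : Fin N => (MvPolynomial.X j : MvPolynomial _ ℂ)) α
  rw [hα, complete_eq_completeOfPowerSums, completeOfPowerSums, MvPolynomial.coeff_sum] at cauchy
  rw [Finset.prod_apply, frob_apply]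
  simp only [h, hsymm_eq_complete]
  rw [← cauchy]
  refine Finset.sum_congr rfl fun lam _ => ?_
  rw [prod_psum_mul_eq, MvPolynomial.coeff_smul, MvPolynomial.coeff_C_mul, MvPolynomial.coeff_map,
    contentChar, mul_comm (MvPolynomial.coeff α (p lam n)), mul_comm (p lam N),
    ← MvPolynomial.smul_eq_C_mul, smul_smul]

end ClassFunctions

/-! ### Bialternants -/

section SignedElementary

open PowerSeries

variable {A Y : Type*} [CommRing A]

theorem mk_pow_mul_one_sub (a : A) : (mk fun m => a ^ m) * (1 - C a * X) = 1 := by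
  simpa [rescale_mk] using congrArg (rescale a) (mk_one_mul_one_sub_eq_one A)

theorem coeff_prod_one_sub_eq_zero (a : Y → A) (s : Finset Y) {m : ℕ} (hm : s.card < m) :
    coeff m (∏ y ∈ s, (1 - C (a y) * X)) = 0 := by
  induction s using Finset.induction_on generalizing m with
  | empty =>
    rw [Finset.card_empty] at hm
    rw [Finset.prod_empty, coeff_one, if_neg (Nat.ne_of_gt hm)]
  | insert y s hy ih =>
    rw [Finset.card_insert_of_notMem hy] at hm
    obtain ⟨m, rfl⟩ := Nat.exists_eq_succ_of_ne_zero (Nat.ne_zero_of_lt hm)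
    rw [Finset.prod_insert hy, sub_mul, one_mul, mul_assoc, map_sub, coeff_C_mul, mul_comm X,
      coeff_succ_mul_X, ih (by omega), ih (by omega), mul_zero, sub_zero]

variable [Fintype Y]

/-- The signed elementary symmetric function `(-1) ^ v e_v` of the alphabet `a` without its letter
`a k`. -/
def signedElementaryErase (a : Y → A) (k : Y) (v : ℕ) : A :=
  coeff v (∏ y ∈ Finset.univ.erase k, (1 - C (a y) * X))

theorem mk_complete_mul_prod_erase (a : Y → A) (k : Y) :
    mk (complete a) * ∏ y ∈ Finset.univ.erase k, (1 - C (a y) * X) = mk fun m => a k ^ m := by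
  rw [mk_complete, ← Finset.mul_prod_erase _ _ (Finset.mem_univ k), mul_assoc,
    ← Finset.prod_mul_distrib, Finset.prod_congr rfl fun y _ => mk_pow_mul_one_sub (a y),
    Finset.prod_const_one, mul_one]

theorem sum_complete_mul_signedElementaryErase (a : Y → A) (k : Y) (m : ℕ) :
    ∑ v ∈ Finset.range (Fintype.card Y),
      (if v ≤ m then complete a (m - v) else 0) * signedElementaryErase a k v = a k ^ m := by
  have hcoeff := congrArg (coeff m) (mk_complete_mul_prod_erase a k)
  rw [coeff_mk, coeff_mul, ← Finset.Nat.sum_antidiagonal_swap,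
    Finset.Nat.sum_antidiagonal_eq_sum_range_succ_mk] at hcoeff
  rw [← hcoeff]
  refine Finset.sum_congr_of_eq_on_inter (fun v _ hv => ?_) (fun v _ hv => ?_) fun v _ hv => ?_
  · rw [if_neg (by simpa using hv), zero_mul]
  · rw [Finset.mem_range, not_lt] at hv
    refine mul_eq_zero_of_right _ (coeff_prod_one_sub_eq_zero a _ ?_)
    rw [Finset.card_erase_of_mem (Finset.mem_univ k), Finset.card_univ]
    exact lt_of_lt_of_le (Nat.pred_lt (Fintype.card_pos_iff.mpr ⟨k⟩).ne') hv
  · rw [if_pos (Nat.lt_succ_iff.mp (Finset.mem_range.mp hv)), Prod.fst_swap, Prod.snd_swap,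
      coeff_mk, signedElementaryErase]

end SignedElementary

section Bialternant

variable {n : ℕ}

/-- The alternant `det (x_j ^ {β_i})`. -/
def alternant (β : Fin n → ℕ) : MvPolynomial (Fin n) ℂ :=
  (Matrix.of fun i j : Fin n => (MvPolynomial.X j : MvPolynomial (Fin n) ℂ) ^ β i).det

/-- The staircase `(n - 1, n - 2, …, 0)`. -/
def staircase (n : ℕ) (i : Fin n) : ℕ := n - 1 - i

/-- The matrix of the Jacobi--Trudi determinant, for `n` rows and in `n` variables. -/
def jacobiTrudi (mu : Fin n → ℕ) : Matrix (Fin n) (Fin n) (MvPolynomial (Fin n) ℂ) :=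
  Matrix.of fun i j => if (i : ℕ) ≤ mu i + j then complete MvPolynomial.X (mu i + j - i) else 0

theorem alternant_add_staircase (mu : Fin n → ℕ) :
    alternant (fun i => mu i + staircase n i) = (jacobiTrudi mu).det *
      (Matrix.of fun j k : Fin n => signedElementaryErase
        (MvPolynomial.X : Fin n → MvPolynomial (Fin n) ℂ) k (n - 1 - j)).det := by
  rw [← Matrix.det_mul, alternant]
  congr 1
  ext1 i k
  rw [Matrix.mul_apply, Matrix.of_apply, ← sum_complete_mul_signedElementaryErase _ k,
    Fintype.card_fin, Finset.sum_range, ← Equiv.sum_comp Fin.revPerm]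
  refine Finset.sum_congr rfl fun j _ => ?_
  simp only [jacobiTrudi, Matrix.of_apply, Fin.revPerm_apply, Fin.val_rev, staircase]
  have hi := i.2
  have hj := j.2
  congr 1
  · by_cases hc : (i : ℕ) ≤ mu i + j
    · rw [if_pos hc, if_pos (by omega)]
      congr 1
      omega
    · rw [if_neg hc, if_neg (by omega)]
  · congr 1
    omega

theorem det_jacobiTrudi_zero : (jacobiTrudi (n := n) 0).det = 1 := by
  rw [Matrix.det_of_isUpperTriangular]
  · exact Finset.prod_eq_one fun i _ => by simp [jacobiTrudi, complete]
  · intro i j hij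
    exact if_neg (by simpa using hij)

theorem alternant_staircase :
    alternant (staircase n) =
      (Matrix.of fun j k : Fin n => signedElementaryErase
        (MvPolynomial.X : Fin n → MvPolynomial (Fin n) ℂ) k (n - 1 - j)).det := by
  have hzero := alternant_add_staircase (n := n) 0
  rw [det_jacobiTrudi_zero, one_mul] at hzero
  rw [← hzero]
  simp

theorem schur_apply (lam : n.Partition) :
    schur lam n = (jacobiTrudi fun i => rowLength lam i).det := by
  change Pi.evalRingHom (fun N => MvPolynomial (Fin N) ℂ) n (schur lam) = _
  rw [schur, RingHom.map_det]
  congr 1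
  ext1 i j
  simp only [RingHom.mapMatrix_apply, Matrix.map_apply, Matrix.of_apply, jacobiTrudi]
  split_ifs with hc
  · rw [Pi.evalRingHom_apply, h, hsymm_eq_complete]
  · rfl

theorem alternant_staircase_mul_schur (lam : n.Partition) :
    alternant (staircase n) * schur lam n =
      alternant (fun i => rowLength lam i + staircase n i) := by
  rw [alternant_add_staircase, schur_apply, alternant_staircase, mul_comm]

end Bialternant

/-! ### Rows of a partition -/

section Rows

variable {n : ℕ}

theorem length_sort_le (lam : n.Partition) : (lam.parts.sort (fun a b => b ≤ a)).length ≤ n := by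
  have hle : lam.parts.card • 1 ≤ lam.parts.sum :=
    Multiset.card_nsmul_le_sum fun x hx => lam.parts_pos hx
  rwa [lam.parts_sum, smul_eq_mul, mul_one, ← Multiset.length_sort (fun a b => b ≤ a)] at hle

theorem rowLength_antitone (lam : n.Partition) : Antitone (rowLength lam) := by
  intro i j hij
  rcases hij.eq_or_lt with rfl | hij
  · exact le_rfl
  unfold rowLength
  by_cases hj : j < (lam.parts.sort (fun a b => b ≤ a)).length
  · rw [List.getD_eq_getElem _ _ hj, List.getD_eq_getElem _ _ (hij.trans hj)]
    exact List.pairwise_iff_getElem.mp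
      (Multiset.pairwise_sort lam.parts (fun a b => b ≤ a)) i j _ _ hij
  · rw [List.getD_eq_default _ _ (not_lt.mp hj)]
    exact Nat.zero_le _

theorem sum_range_getD (l : List ℕ) {N : ℕ} (hN : l.length ≤ N) :
    ∑ i ∈ Finset.range N, l.getD i 0 = l.sum := by
  induction l generalizing N with
  | nil => simp
  | cons a l ih =>
    obtain ⟨N, rfl⟩ := Nat.exists_eq_succ_of_ne_zero (Nat.ne_zero_of_lt hN)
    rw [Finset.sum_range_succ', List.sum_cons]
    simp only [List.getD_cons_succ, List.getD_cons_zero]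
    rw [ih (Nat.le_of_succ_le_succ hN), add_comm]

theorem sum_rowLength (lam : n.Partition) : ∑ i : Fin n, rowLength lam i = n := by
  have hsum := sum_range_getD _ (length_sort_le lam)
  rwa [Finset.sum_range, ← Multiset.sum_coe, Multiset.sort_eq, lam.parts_sum] at hsum

theorem rowLength_pos_iff (lam : n.Partition) (i : ℕ) :
    0 < rowLength lam i ↔ i < (lam.parts.sort (fun a b => b ≤ a)).length := by
  refine ⟨fun hpos => ?_, fun hi => ?_⟩
  · by_contra hi
    exact hpos.ne' (List.getD_eq_default _ _ (not_lt.mp hi))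
  · rw [rowLength, List.getD_eq_getElem _ _ hi]
    exact lam.parts_pos ((Multiset.mem_sort (fun a b => b ≤ a)).mp (List.getElem_mem hi))

theorem eq_of_rowLength_eq {lam mu : n.Partition}
    (h : ∀ i : Fin n, rowLength lam i = rowLength mu i) : lam = mu := by
  have hrow : ∀ i, rowLength lam i = rowLength mu i := by
    intro i
    by_cases hi : i < n
    · exact h ⟨i, hi⟩
    · have hzero : ∀ nu : n.Partition, rowLength nu i = 0 := fun nu =>
        List.getD_eq_default _ _ ((length_sort_le nu).trans (not_lt.mp hi))
      rw [hzero, hzero]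
  have hlength : (lam.parts.sort (fun a b => b ≤ a)).length =
      (mu.parts.sort (fun a b => b ≤ a)).length :=
    eq_of_forall_lt_iff fun i => by rw [← rowLength_pos_iff, ← rowLength_pos_iff, hrow]
  have hsort : lam.parts.sort (fun a b => b ≤ a) = mu.parts.sort (fun a b => b ≤ a) := by
    refine List.ext_getElem hlength fun i hi hi' => ?_
    rw [← List.getD_eq_getElem _ 0 hi, ← List.getD_eq_getElem _ 0 hi']
    exact hrow i
  ext1
  rw [← Multiset.sort_eq lam.parts (fun a b => b ≤ a), hsort, Multiset.sort_eq]

/-- The exponents `λ_i + n - 1 - i` of the bialternant formula. -/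
def shiftedRows (lam : n.Partition) (i : Fin n) : ℕ := rowLength lam i + staircase n i

theorem shiftedRows_strictAnti (lam : n.Partition) : StrictAnti (shiftedRows lam) := by
  intro i j hij
  have hrow := rowLength_antitone lam (show (i : ℕ) ≤ j from hij.le)
  unfold shiftedRows staircase
  grind

end Rows

/-! ### The class functions of Schur functions -/

section SchurChar

open Equiv

variable {n : ℕ}

theorem alternant_eq_sum (β : Fin n → ℕ) : alternant β =
    ∑ σ : Perm (Fin n), ((Perm.sign σ : ℤ) : ℂ) •
      MvPolynomial.monomial (Finsupp.equivFunOnFinite.symm fun i => β (σ i)) (1 : ℂ) := by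
  rw [alternant, Matrix.det_apply']
  refine Finset.sum_congr rfl fun σ _ => ?_
  rw [MvPolynomial.monomial_eq, map_one, one_mul, Finsupp.prod_fintype _ _ fun i => pow_zero _,
    MvPolynomial.smul_eq_C_mul]
  simp

theorem eq_one_of_strictAnti_comp {β γ : Fin n → ℕ} (hβ : StrictAnti β) (hγ : StrictAnti γ)
    {σ : Perm (Fin n)} (hσ : β ∘ σ = γ) : σ = 1 := by
  have hmono : StrictMono σ := fun i j hij => hβ.lt_iff_gt.mp (by
    rw [← hσ] at hγ
    exact hγ hij)
  have hrefl : hmono.orderIsoOfSurjective σ σ.surjective = OrderIso.refl _ :=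
    Subsingleton.elim _ _
  ext1 i
  exact DFunLike.congr_fun hrefl i

theorem coeff_alternant {β γ : Fin n → ℕ} (hβ : StrictAnti β) (hγ : StrictAnti γ) :
    (alternant β).coeff (Finsupp.equivFunOnFinite.symm γ) = if β = γ then 1 else 0 := by
  rw [alternant_eq_sum, MvPolynomial.coeff_sum, Finset.sum_eq_single 1]
  · rw [MvPolynomial.coeff_smul, MvPolynomial.coeff_monomial]
    simp [Finsupp.equivFunOnFinite.symm.injective.eq_iff]
  · intro σ _ hσ
    rw [MvPolynomial.coeff_smul, MvPolynomial.coeff_monomial, if_neg, smul_zero]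
    exact fun heq =>
      hσ (eq_one_of_strictAnti_comp hβ hγ (Finsupp.equivFunOnFinite.symm.injective heq))
  · exact fun hone => absurd (Finset.mem_univ _) hone

/-- The class function with Frobenius characteristic `s_λ`. -/
def schurChar (lam rho : n.Partition) : ℂ :=
  (alternant (staircase n) * p rho n).coeff (Finsupp.equivFunOnFinite.symm (shiftedRows lam))

theorem pairing_schurChar (lam : n.Partition) (χ : n.Partition → ℂ) :
    pairing (schurChar lam) χ = (alternant (staircase n) * frob χ n).coeff
      (Finsupp.equivFunOnFinite.symm (shiftedRows lam)) := by
  rw [frob_apply, Finset.mul_sum, MvPolynomial.coeff_sum, pairing_apply]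
  refine Finset.sum_congr rfl fun rho _ => ?_
  rw [mul_smul_comm, MvPolynomial.coeff_smul, schurChar, smul_eq_mul]
  ring

/-- The exponent `λ_i + σ(i) - i` in the expansion of the Jacobi--Trudi determinant. -/
def trudiExponent (lam : n.Partition) (σ : Perm (Fin n)) : Fin n →₀ ℕ :=
  Finsupp.equivFunOnFinite.symm fun i => rowLength lam i + σ i - i

theorem staircase_comp_le_shiftedRows_iff (lam : n.Partition) (σ : Perm (Fin n)) :
    (Finsupp.equivFunOnFinite.symm fun i => staircase n (σ i)) ≤
        Finsupp.equivFunOnFinite.symm (shiftedRows lam) ↔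
      ∀ i : Fin n, (i : ℕ) ≤ rowLength lam i + σ i := by
  rw [Finsupp.le_def]
  refine forall_congr' fun i => ?_
  simp only [Finsupp.equivFunOnFinite_symm_apply_apply, shiftedRows, staircase]
  omega

theorem shiftedRows_sub_staircase_comp {lam : n.Partition} {σ : Perm (Fin n)}
    (hσ : ∀ i : Fin n, (i : ℕ) ≤ rowLength lam i + σ i) :
    Finsupp.equivFunOnFinite.symm (shiftedRows lam) -
      (Finsupp.equivFunOnFinite.symm fun i => staircase n (σ i)) = trudiExponent lam σ := by
  ext i
  simp only [Finsupp.tsub_apply, Finsupp.equivFunOnFinite_symm_apply_apply, shiftedRows,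
    staircase, trudiExponent]
  have hi := hσ i
  omega

theorem coeff_alternant_staircase_mul (lam : n.Partition) (f : MvPolynomial (Fin n) ℂ) :
    (alternant (staircase n) * f).coeff (Finsupp.equivFunOnFinite.symm (shiftedRows lam)) =
      ∑ σ : Perm (Fin n), ((Perm.sign σ : ℤ) : ℂ) *
        if ∀ i : Fin n, (i : ℕ) ≤ rowLength lam i + σ i then f.coeff (trudiExponent lam σ)
        else 0 := by
  rw [alternant_eq_sum, Finset.sum_mul, MvPolynomial.coeff_sum]
  refine Finset.sum_congr rfl fun σ _ => ?_
  rw [smul_mul_assoc, MvPolynomial.coeff_smul, MvPolynomial.coeff_monomial_mul', smul_eq_mul,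
    one_mul, if_congr (staircase_comp_le_shiftedRows_iff lam σ) rfl rfl]
  split_ifs with hσ
  · rw [shiftedRows_sub_staircase_comp hσ]
  · rfl

theorem schurChar_eq_sum (lam : n.Partition) :
    schurChar lam = ∑ σ : Perm (Fin n), ((Perm.sign σ : ℤ) : ℂ) •
      if ∀ i : Fin n, (i : ℕ) ≤ rowLength lam i + σ i then contentChar (trudiExponent lam σ)
      else 0 := by
  funext rho
  rw [schurChar, coeff_alternant_staircase_mul, Finset.sum_apply]
  refine Finset.sum_congr rfl fun σ _ => ?_
  rw [Pi.smul_apply, smul_eq_mul]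
  split_ifs <;> rfl

theorem sum_trudiExponent {lam : n.Partition} {σ : Perm (Fin n)}
    (hσ : ∀ i : Fin n, (i : ℕ) ≤ rowLength lam i + σ i) : ∑ i, trudiExponent lam σ i = n := by
  have hsum : ∑ i, (trudiExponent lam σ i + (i : ℕ)) =
      ∑ i : Fin n, (rowLength lam i + (σ i : ℕ)) :=
    Finset.sum_congr rfl fun i _ => Nat.sub_add_cancel (hσ i)
  rw [Finset.sum_add_distrib, Finset.sum_add_distrib, sum_rowLength,
    Equiv.sum_comp σ fun i : Fin n => (i : ℕ)] at hsum
  omega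

theorem frob_schurChar (lam : n.Partition) : frob (schurChar lam) = schur lam := by
  rw [schurChar_eq_sum, map_sum, schur, ← Matrix.det_transpose, Matrix.det_apply]
  refine Finset.sum_congr rfl fun σ _ => ?_
  rw [map_smul, Units.smul_def, Int.cast_smul_eq_zsmul]
  congr 1
  simp only [Matrix.transpose_apply, Matrix.of_apply]
  rw [Finset.prod_ite_zero]
  simp only [Finset.mem_univ, true_implies]
  split_ifs with hσ
  · rw [frob_contentChar _ (sum_trudiExponent hσ)]
    rfl
  · exact map_zero frob

theorem shiftedRows_injective : Function.Injective (shiftedRows (n := n)) := by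
  intro lam mu heq
  refine eq_of_rowLength_eq fun i => ?_
  have hi := congrFun heq i
  simp only [shiftedRows] at hi
  omega

theorem pairing_schurChar_schurChar (lam mu : n.Partition) :
    pairing (schurChar lam) (schurChar mu) = if lam = mu then 1 else 0 := by
  rw [pairing_schurChar, frob_schurChar, alternant_staircase_mul_schur]
  refine (coeff_alternant (shiftedRows_strictAnti mu) (shiftedRows_strictAnti lam)).trans ?_
  exact if_congr (shiftedRows_injective.eq_iff.trans eq_comm) rfl rfl

theorem linearIndependent_schurChar : LinearIndependent ℂ (schurChar (n := n)) := by
  refine Fintype.linearIndependent_iff.mpr fun c hc mu => ?_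
  simpa [pairing_schurChar_schurChar] using congrArg (pairing (schurChar mu)) hc

theorem eq_sum_pairing_schurChar (χ : n.Partition → ℂ) :
    χ = ∑ mu, pairing (schurChar mu) χ • schurChar mu := by
  have hspan : χ ∈ Submodule.span ℂ (Set.range (schurChar (n := n))) := by
    rw [linearIndependent_schurChar.span_eq_top_of_card_eq_finrank' (by simp)]
    exact Submodule.mem_top
  obtain ⟨c, rfl⟩ := (Submodule.mem_span_range_iff_exists_fun ℂ).mp hspan
  simp [pairing_schurChar_schurChar]

theorem frob_eq_sum_schur (χ : n.Partition → ℂ) :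
    frob χ = ∑ mu, pairing (schurChar mu) χ • schur mu := by
  conv_lhs => rw [eq_sum_pairing_schurChar χ]
  simp only [map_sum, map_smul, frob_schurChar]

theorem frob_injective : Function.Injective (frob (n := n)) := by
  intro χ ψ heq
  rw [eq_sum_pairing_schurChar χ, eq_sum_pairing_schurChar ψ]
  simp only [pairing_schurChar, heq]

end SchurChar

/-! ### Characters of the symmetric group -/

section OrthonormalClosure

theorem exists_eq_single_of_sum_sq_eq_one {ι : Type*} {c : ι →₀ ℤ}
    (hc : (c.sum fun _ k => k ^ 2) = 1) :
    ∃ i, c = Finsupp.single i 1 ∨ c = Finsupp.single i (-1) := by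
  have hsq : ∀ i ∈ c.support, 1 ≤ c i ^ 2 := fun i hi =>
    sq_pos_iff.mpr (Finsupp.mem_support_iff.mp hi)
  have hle : c.support.card ≤ 1 := by
    have hsum := Finset.card_nsmul_le_sum _ _ _ hsq
    rw [nsmul_one] at hsum
    exact_mod_cast hsum.trans_eq hc
  have hne : c ≠ 0 := by
    rintro rfl
    exact zero_ne_one hc
  obtain ⟨i, hi⟩ := Finset.card_eq_one.mp
    (hle.antisymm (Finset.card_pos.mpr (Finsupp.support_nonempty_iff.mpr hne)))
  obtain ⟨-, hsingle⟩ := Finsupp.support_eq_singleton.mp hi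
  rw [Finsupp.sum, hi, Finset.sum_singleton, sq_eq_one_iff] at hc
  exact ⟨i, hc.imp (fun hi => by rwa [hi] at hsingle) (fun hi => by rwa [hi] at hsingle)⟩

variable {R M : Type*} [CommRing R] [CharZero R] [AddCommGroup M] [Module R M]

theorem mem_or_neg_mem_of_mem_closure_orthonormal (B : LinearMap.BilinForm R M) {s : Set M}
    (hs : ∀ x ∈ s, ∀ y ∈ s, B x y = if x = y then 1 else 0) {x : M}
    (hx : x ∈ AddSubgroup.closure s) (hnorm : B x x = 1) : x ∈ s ∨ -x ∈ s := by
  rw [← Submodule.span_int_eq_addSubgroupClosure, Submodule.mem_toAddSubgroup,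
    Finsupp.mem_span_iff_linearCombination] at hx
  obtain ⟨c, rfl⟩ := hx
  have hs' : ∀ y z : s, B y z = if y = z then 1 else 0 := fun y z => by
    rw [hs y y.2 z z.2, if_congr Subtype.ext_iff.symm rfl rfl]
  have hsq : (c.sum fun _ k => k ^ 2) = 1 := by
    simp only [Finsupp.linearCombination_apply, Finsupp.sum, map_sum, LinearMap.sum_apply,
      map_zsmul, LinearMap.smul_apply, hs'] at hnorm
    have hcast : ((c.sum fun _ k => k ^ 2 : ℤ) : R) = 1 := by
      rw [← hnorm, Finsupp.sum, Int.cast_sum]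
      refine Finset.sum_congr rfl fun y hy => ?_
      simp [hy, sq]
    exact_mod_cast hcast
  obtain ⟨y, rfl | rfl⟩ := exists_eq_single_of_sum_sq_eq_one hsq
  · left
    simp
  · right
    simp

end OrthonormalClosure

section Characters

open Equiv

variable {n : ℕ}

theorem cyclePartition_surjective {X : Type*} [Fintype X] [DecidableEq X]
    (hX : Fintype.card X = n) : Function.Surjective (cyclePartition hX) := by
  intro lam
  have hpos : 0 < (Finset.univ.filter fun σ : Perm X => σ.partition.parts = lam.parts).card :=
    Nat.pos_of_mul_pos_right (card_filter_parts_mul_zee hX lam ▸ n.factorial_pos)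
  obtain ⟨σ, hσ⟩ := Finset.card_pos.mp hpos
  exact ⟨σ, Nat.Partition.ext (Finset.mem_filter.mp hσ).2⟩

theorem cyclePartition_inv {X : Type*} [Fintype X] [DecidableEq X] (hX : Fintype.card X = n)
    (σ : Perm X) : cyclePartition hX σ⁻¹ = cyclePartition hX σ := by
  ext1
  simp only [cyclePartition]
  rw [Perm.parts_partition, Perm.parts_partition, Perm.cycleType_inv, Perm.support_inv]

/-- `χ`, viewed as a function of permutations, is the character of `ρ`. -/
def HasCharacter {V : Type} [AddCommGroup V] [Module ℂ V]
    (ρ : Representation ℂ (Perm (Fin n)) V) (χ : n.Partition → ℂ) : Prop :=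
  ∀ σ, ρ.character σ = χ (cyclePartition (Fintype.card_fin n) σ)

/-- The characters of the finite-dimensional representations of the symmetric group. -/
def IsCharacter (χ : n.Partition → ℂ) : Prop :=
  ∃ (V : Type) (_ : AddCommGroup V) (_ : Module ℂ V) (_ : FiniteDimensional ℂ V)
    (ρ : Representation ℂ (Perm (Fin n)) V), HasCharacter ρ χ

/-- The irreducible characters of the symmetric group. -/
def IsIrreducibleCharacter (χ : n.Partition → ℂ) : Prop :=
  ∃ (V : Type) (_ : AddCommGroup V) (_ : Module ℂ V) (_ : FiniteDimensional ℂ V)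
    (ρ : Representation ℂ (Perm (Fin n)) V), ρ.IsIrreducible ∧ HasCharacter ρ χ

theorem IsIrreducibleCharacter.isCharacter {χ : n.Partition → ℂ}
    (hχ : IsIrreducibleCharacter χ) : IsCharacter χ := by
  obtain ⟨V, _, _, hfin, ρ, -, hρ⟩ := hχ
  exact ⟨V, _, _, hfin, ρ, hρ⟩

section

variable {V : Type} [AddCommGroup V] [Module ℂ V] {ρ : Representation ℂ (Perm (Fin n)) V}

theorem HasCharacter.unique {χ ψ : n.Partition → ℂ} (hχ : HasCharacter ρ χ)
    (hψ : HasCharacter ρ ψ) : χ = ψ := by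
  funext lam
  obtain ⟨σ, rfl⟩ := cyclePartition_surjective (Fintype.card_fin n) lam
  rw [← hχ, ← hψ]

variable (ρ) in
theorem exists_hasCharacter : ∃ χ : n.Partition → ℂ, HasCharacter ρ χ := by
  have hfactors : Function.FactorsThrough ρ.character (cyclePartition (Fintype.card_fin n)) := by
    intro σ τ hστ
    have hconj : IsConj σ τ := Perm.partition_eq_of_isConj.mpr
      (Nat.Partition.ext (congrArg (fun lam : n.Partition => lam.parts) hστ))
    obtain ⟨g, rfl⟩ := isConj_iff.mp hconj
    rw [Representation.char_conj]
  obtain ⟨χ, hχ⟩ := (Function.factorsThrough_iff _).mp hfactors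
  exact ⟨χ, congrFun hχ⟩

theorem HasCharacter.eq_add_of_isCompl [FiniteDimensional ℂ V] {W W' : Subrepresentation ρ}
    (hcompl : IsCompl W.toSubmodule W'.toSubmodule) {χ χ₁ χ₂ : n.Partition → ℂ}
    (hχ : HasCharacter ρ χ) (hχ₁ : HasCharacter W.toRepresentation χ₁)
    (hχ₂ : HasCharacter W'.toRepresentation χ₂) : χ = χ₁ + χ₂ := by
  refine hχ.unique fun σ => ?_
  rw [Pi.add_apply, ← hχ₁, ← hχ₂]
  let N : Bool → Submodule ℂ V := fun b => cond b W.toSubmodule W'.toSubmodule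
  have hinternal : DirectSum.IsInternal N := by
    rw [DirectSum.isInternal_submodule_iff_isCompl N (i := true) (j := false) (by decide)]
    · exact hcompl
    · ext b
      cases b <;> simp
  have hmaps : ∀ b, Set.MapsTo (ρ σ) (N b) (N b) := by
    rintro (_ | _)
    · exact fun v hv => W'.apply_mem_toSubmodule σ hv
    · exact fun v hv => W.apply_mem_toSubmodule σ hv
  have htrace := LinearMap.trace_eq_sum_trace_restrict hinternal hmaps
  rwa [Fintype.sum_bool] at htrace

theorem exists_isCompl_of_not_isIrreducible [Nontrivial V] (hρ : ¬ ρ.IsIrreducible) :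
    ∃ W W' : Subrepresentation ρ, W.toSubmodule ≠ ⊥ ∧ W.toSubmodule ≠ ⊤ ∧
      IsCompl W.toSubmodule W'.toSubmodule := by
  obtain ⟨W, hbot, htop⟩ : ∃ W : Subrepresentation ρ, W ≠ ⊥ ∧ W ≠ ⊤ := by
    by_contra! htrivial
    have : Nontrivial (Subrepresentation ρ) := ⟨⊥, ⊤, fun h =>
      bot_ne_top (α := Submodule ℂ V) (congrArg Subrepresentation.toSubmodule h)⟩
    exact hρ { eq_bot_or_eq_top := fun W => or_iff_not_imp_left.mpr (htrivial W) }
  obtain ⟨W', hW'⟩ := exists_isCompl W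
  refine ⟨W, W', fun h => hbot (Subrepresentation.toSubmodule_injective h),
    fun h => htop (Subrepresentation.toSubmodule_injective h), IsCompl.of_eq ?_ ?_⟩
  · rw [← Subrepresentation.toSubmodule_inf, hW'.inf_eq_bot]
    rfl
  · rw [← Subrepresentation.toSubmodule_sup, hW'.sup_eq_top]
    rfl

end

theorem HasCharacter.mem_closure_irreducible {V : Type} [AddCommGroup V] [Module ℂ V]
    [FiniteDimensional ℂ V] {ρ : Representation ℂ (Perm (Fin n)) V} {χ : n.Partition → ℂ}
    (hχ : HasCharacter ρ χ) :
    χ ∈ AddSubmonoid.closure {ψ : n.Partition → ℂ | IsIrreducibleCharacter ψ} := by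
  induction hd : Module.finrank ℂ V using Nat.strong_induction_on generalizing V χ with
  | _ d ih =>
  by_cases hirr : ρ.IsIrreducible
  · exact AddSubmonoid.subset_closure ⟨V, _, _, inferInstance, ρ, hirr, hχ⟩
  rcases subsingleton_or_nontrivial V with hV | hV
  · have hzero : χ = 0 := hχ.unique fun σ => by
      rw [Representation.character, Subsingleton.elim (ρ σ) 0, map_zero]
      rfl
    exact hzero ▸ zero_mem _
  obtain ⟨W, W', hbot, htop, hcompl⟩ := exists_isCompl_of_not_isIrreducible hirr
  have hlt := Submodule.finrank_lt htop
  have hpos := Submodule.one_le_finrank_iff.mpr hbot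
  have hadd := Submodule.finrank_add_eq_of_isCompl hcompl
  obtain ⟨χ₁, hχ₁⟩ := exists_hasCharacter W.toRepresentation
  obtain ⟨χ₂, hχ₂⟩ := exists_hasCharacter W'.toRepresentation
  rw [hχ.eq_add_of_isCompl hcompl hχ₁ hχ₂]
  exact add_mem (ih _ (by omega) hχ₁ rfl) (ih _ (by omega) hχ₂ rfl)

theorem IsCharacter.mem_closure_irreducible {χ : n.Partition → ℂ} (hχ : IsCharacter χ) :
    χ ∈ AddSubmonoid.closure {ψ : n.Partition → ℂ | IsIrreducibleCharacter ψ} := by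
  obtain ⟨V, _, _, _, ρ, hρ⟩ := hχ
  exact hρ.mem_closure_irreducible

theorem pairing_eq_sum_perm (χ ψ : n.Partition → ℂ) :
    pairing χ ψ = (n.factorial : ℂ)⁻¹ * ∑ σ : Perm (Fin n),
      χ (cyclePartition (Fintype.card_fin n) σ) * ψ (cyclePartition (Fintype.card_fin n) σ) := by
  rw [sum_perm_eq_sum_partition (Fintype.card_fin n) fun lam => χ lam * ψ lam, smul_eq_mul,
    ← mul_assoc, inv_mul_cancel₀ (Nat.cast_ne_zero.mpr n.factorial_ne_zero), one_mul,
    pairing_apply]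
  exact Finset.sum_congr rfl fun _ _ => by rw [smul_eq_mul, mul_comm]

theorem HasCharacter.pairing_irreducible {V W : Type} [AddCommGroup V] [Module ℂ V]
    [FiniteDimensional ℂ V] [AddCommGroup W] [Module ℂ W] [FiniteDimensional ℂ W]
    {ρ : Representation ℂ (Perm (Fin n)) V} {τ : Representation ℂ (Perm (Fin n)) W}
    (hρ : ρ.IsIrreducible) (hτ : τ.IsIrreducible) {χ ψ : n.Partition → ℂ}
    (hχ : HasCharacter ρ χ) (hψ : HasCharacter τ ψ) :
    pairing χ ψ = if Nonempty (Representation.Equiv τ ρ) then 1 else 0 := by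
  have hcard : (Nat.card (Perm (Fin n)) : ℂ) = n.factorial := by
    rw [Nat.card_eq_fintype_card, Fintype.card_perm, Fintype.card_fin]
  have : Invertible (Nat.card (Perm (Fin n)) : ℂ) :=
    invertibleOfNonzero (hcard ▸ Nat.cast_ne_zero.mpr n.factorial_ne_zero)
  rw [pairing_eq_sum_perm, ← Representation.char_orthonormal ρ τ, hcard]
  congr 1
  refine Finset.sum_congr rfl fun σ _ => ?_
  rw [hχ, hψ, cyclePartition_inv]

theorem IsIrreducibleCharacter.pairing_eq {χ ψ : n.Partition → ℂ}
    (hχ : IsIrreducibleCharacter χ) (hψ : IsIrreducibleCharacter ψ) :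
    pairing χ ψ = if χ = ψ then 1 else 0 := by
  obtain ⟨V, _, _, _, ρ, hρ, hρχ⟩ := hχ
  obtain ⟨W, _, _, _, τ, hτ, hτψ⟩ := hψ
  rw [hρχ.pairing_irreducible hρ hτ hτψ]
  refine if_congr ⟨?_, ?_⟩ rfl rfl
  · rintro ⟨e⟩
    refine hρχ.unique fun σ => ?_
    rw [← hτψ, Representation.char_iso e]
  · rintro rfl
    by_contra hne
    have hzero := hρχ.pairing_irreducible hρ hτ hτψ
    have hone := hρχ.pairing_irreducible hρ hρ hρχ
    rw [if_neg hne] at hzero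
    rw [hzero, if_pos ⟨Representation.Equiv.refl ρ⟩] at hone
    exact zero_ne_one hone

theorem IsCharacter.pairing_irreducible_eq_natCast {χ ψ : n.Partition → ℂ} (hχ : IsCharacter χ)
    (hψ : IsIrreducibleCharacter ψ) : ∃ k : ℕ, pairing χ ψ = k := by
  have hmem := hχ.mem_closure_irreducible
  clear hχ
  induction hmem using AddSubmonoid.closure_induction with
  | mem φ hφ =>
    refine ⟨if φ = ψ then 1 else 0, ?_⟩
    rw [IsIrreducibleCharacter.pairing_eq hφ hψ]
    split_ifs <;> simp
  | zero => exact ⟨0, by simp⟩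
  | add φ φ' _ _ hφ hφ' =>
    obtain ⟨k, hk⟩ := hφ
    obtain ⟨l, hl⟩ := hφ'
    exact ⟨k + l, by rw [map_add, LinearMap.add_apply, hk, hl, Nat.cast_add]⟩

theorem irreducible_or_neg_of_pairing_self {χ : n.Partition → ℂ}
    (hχ : χ ∈ AddSubgroup.closure {ψ : n.Partition → ℂ | IsIrreducibleCharacter ψ})
    (hnorm : pairing χ χ = 1) : IsIrreducibleCharacter χ ∨ IsIrreducibleCharacter (-χ) :=
  mem_or_neg_mem_of_mem_closure_orthonormal pairing
    (fun _ hψ _ hφ => by convert IsIrreducibleCharacter.pairing_eq hψ hφ) hχ hnorm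

end Characters

/-! ### Schur functions are irreducible characters -/

section SchurIrreducible

open Equiv

variable {n : ℕ}

theorem p_partition_apply {X : Type*} [Fintype X] [DecidableEq X] (σ : Perm X) (N : ℕ) :
    p σ.partition N = ∑ c : X → Fin N,
      if ∀ x, c (σ x) = c x then ∏ x, (MvPolynomial.X (c x) : MvPolynomial (Fin N) ℂ) else 0 := by
  rw [sum_fixed_colourings]
  rfl

/-- The content of a colouring `c`: how often each colour is used, as the exponent of the monomial
`∏ x_{c(i)}`. -/
def content {X Y : Type*} [Fintype X] (c : X → Y) : Y →₀ ℕ := ∑ x, Finsupp.single (c x) 1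

theorem content_comp {X Y : Type*} [Fintype X] (c : X → Y) (σ : Perm X) :
    content (c ∘ σ) = content c :=
  Equiv.sum_comp σ fun x => Finsupp.single (c x) 1

theorem prod_X_eq_monomial {X Y R : Type*} [CommSemiring R] [Fintype X] (c : X → Y) :
    ∏ x, (MvPolynomial.X (c x) : MvPolynomial Y R) = MvPolynomial.monomial (content c) 1 := by
  rw [content, MvPolynomial.monomial_sum_one]
  rfl

/-- The permutation representation on functions of colourings with given content. -/
def contentRep (α : Fin n →₀ ℕ) :
    Representation ℂ (Perm (Fin n)) ({c : Fin n → Fin n // content c = α} → ℂ) where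
  toFun σ := LinearMap.funLeft ℂ ℂ fun c => ⟨c.1 ∘ σ, (content_comp _ _).trans c.2⟩
  map_one' := rfl
  map_mul' _ _ := rfl

theorem character_contentRep (α : Fin n →₀ ℕ) (σ : Perm (Fin n)) :
    (contentRep α).character σ =
      ∑ c : {c : Fin n → Fin n // content c = α}, if ∀ x, c.1 (σ x) = c.1 x then 1 else 0 := by
  rw [Representation.character, LinearMap.trace_eq_matrix_trace ℂ (Pi.basisFun ℂ _), Matrix.trace]
  refine Finset.sum_congr rfl fun c _ => ?_
  rw [Matrix.diag_apply, LinearMap.toMatrix_apply, Pi.basisFun_apply, Pi.basisFun_repr]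
  change (Pi.single c (1 : ℂ) : _ → ℂ) ⟨c.1 ∘ σ, (content_comp _ _).trans c.2⟩ = _
  rw [Pi.single_apply]
  exact if_congr (Subtype.ext_iff.trans funext_iff) rfl rfl

theorem isCharacter_contentChar (α : Fin n →₀ ℕ) : IsCharacter (contentChar α) := by
  refine ⟨_, _, _, inferInstance, contentRep α, fun σ => ?_⟩
  change _ = (p σ.partition n).coeff α
  rw [character_contentRep, p_partition_apply, MvPolynomial.coeff_sum,
    ← Finset.sum_subtype (Finset.univ.filter fun c : Fin n → Fin n => content c = α) (by simp)
      fun c => if ∀ x, c (σ x) = c x then (1 : ℂ) else 0, Finset.sum_filter]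
  refine Finset.sum_congr rfl fun c _ => ?_
  rw [prod_X_eq_monomial]
  split_ifs <;> simp [MvPolynomial.coeff_monomial, *]

theorem schurChar_mem_closure_irreducible (lam : n.Partition) :
    schurChar lam ∈ AddSubgroup.closure {ψ : n.Partition → ℂ | IsIrreducibleCharacter ψ} := by
  rw [schurChar_eq_sum]
  refine sum_mem fun σ _ => ?_
  rw [Int.cast_smul_eq_zsmul]
  refine zsmul_mem ?_ _
  split_ifs
  · exact AddSubgroup.le_closure_toAddSubmonoid _
      (isCharacter_contentChar (trudiExponent lam σ)).mem_closure_irreducible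
  · exact zero_mem _

theorem eval_alternant (β : Fin n → ℕ) :
    MvPolynomial.eval (fun j : Fin n => (2 : ℂ) ^ (j : ℕ)) (alternant β) =
      ((∏ i : Fin n, ∏ j ∈ Finset.Ioi i, ((2 : ℝ) ^ β j - 2 ^ β i) : ℝ) : ℂ) := by
  rw [alternant, RingHom.map_det]
  push_cast
  rw [← Matrix.det_vandermonde fun i : Fin n => (2 : ℂ) ^ β i]
  congr 1
  ext i j
  simp only [RingHom.mapMatrix_apply, Matrix.map_apply, Matrix.of_apply,
    Matrix.vandermonde_apply, map_pow, MvPolynomial.eval_X]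
  rw [← pow_mul, ← pow_mul, mul_comm]

theorem staircase_strictAnti : StrictAnti (staircase n) := by
  intro i j hij
  unfold staircase
  grind

-- At `x_j = 2 ^ j` the bialternant formula is a quotient of Vandermonde products with negative
-- factors only.
theorem exists_pos_eval_schur (lam : n.Partition) : ∃ r : ℝ, 0 < r ∧
    MvPolynomial.eval (fun j : Fin n => (2 : ℂ) ^ (j : ℕ)) (schur lam n) = r := by
  have hneg : ∀ {β : Fin n → ℕ} (_ : StrictAnti β) {i j : Fin n}, j ∈ Finset.Ioi i →
      (2 : ℝ) ^ β j - 2 ^ β i < 0 := fun hβ _ _ hij =>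
    sub_neg.mpr (pow_lt_pow_right₀ one_lt_two (hβ (Finset.mem_Ioi.mp hij)))
  refine ⟨∏ i : Fin n, ∏ j ∈ Finset.Ioi i, ((2 : ℝ) ^ shiftedRows lam j - 2 ^ shiftedRows lam i) /
    (2 ^ staircase n j - 2 ^ staircase n i), ?_, ?_⟩
  · exact Finset.prod_pos fun i _ => Finset.prod_pos fun j hj =>
      div_pos_of_neg_of_neg (hneg (shiftedRows_strictAnti lam) hj) (hneg staircase_strictAnti hj)
  · have hbialternant := congrArg (MvPolynomial.eval (fun j : Fin n => (2 : ℂ) ^ (j : ℕ)))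
      (alternant_staircase_mul_schur lam)
    rw [map_mul, eval_alternant, eval_alternant] at hbialternant
    simp only [Finset.prod_div_distrib]
    rw [Complex.ofReal_div, eq_div_iff, mul_comm]
    · exact hbialternant
    · exact Complex.ofReal_ne_zero.mpr (Finset.prod_ne_zero_iff.mpr fun i _ =>
        Finset.prod_ne_zero_iff.mpr fun j hj => (hneg staircase_strictAnti hj).ne)

theorem eval_ne_of_coeff_eq_neg_natCast {f : MvPolynomial (Fin n) ℂ}
    (hf : ∀ α, ∃ k : ℕ, f.coeff α = -k) {r : ℝ} (hr : 0 < r) :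
    MvPolynomial.eval (fun j : Fin n => (2 : ℂ) ^ (j : ℕ)) f ≠ r := by
  choose k hk using hf
  intro heval
  have hsum : ∑ α ∈ f.support, (k α : ℝ) * ∏ i : Fin n, ((2 : ℝ) ^ (i : ℕ)) ^ α i = -r := by
    have hcast : -((∑ α ∈ f.support, (k α : ℝ) * ∏ i : Fin n, ((2 : ℝ) ^ (i : ℕ)) ^ α i : ℝ) : ℂ)
        = r := by
      rw [← heval, MvPolynomial.eval_eq']
      push_cast
      rw [← Finset.sum_neg_distrib]
      exact Finset.sum_congr rfl fun α _ => by rw [hk, neg_mul]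
    exact neg_eq_iff_eq_neg.mp (by exact_mod_cast hcast)
  have hnonneg : 0 ≤ ∑ α ∈ f.support, (k α : ℝ) * ∏ i : Fin n, ((2 : ℝ) ^ (i : ℕ)) ^ α i :=
    Finset.sum_nonneg fun α _ => by positivity
  linarith

theorem isIrreducibleCharacter_schurChar (lam : n.Partition) :
    IsIrreducibleCharacter (schurChar lam) := by
  refine (irreducible_or_neg_of_pairing_self (schurChar_mem_closure_irreducible lam)
    (by rw [pairing_schurChar_schurChar, if_pos rfl])).resolve_right fun hneg => ?_
  obtain ⟨r, hr, heval⟩ := exists_pos_eval_schur lam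
  refine eval_ne_of_coeff_eq_neg_natCast (fun α => ?_) hr heval
  obtain ⟨k, hk⟩ := (isCharacter_contentChar α).pairing_irreducible_eq_natCast hneg
  exact ⟨k, by rw [← frob_schurChar, ← pairing_contentChar, ← hk, map_neg, neg_neg]⟩

end SchurIrreducible

/-! ### Monomial representations -/

section Monomial

open Equiv
open scoped Pointwise

variable {n : ℕ}

/-- The Frobenius characteristic of the representation induced along `ι` from the linear character
`θ`. -/
def inducedFrob {Γ X : Type} [Group Γ] [Fintype Γ] [Fintype X] [DecidableEq X] (ι : Γ →* Perm X)
    (θ : Γ →* ℂ) : SymFn :=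
  ((Fintype.card Γ : ℂ)⁻¹) • ∑ γ, θ γ • p (ι γ).partition

/-- Sums of Frobenius characteristics of monomial representations of the symmetric group `S_n`. -/
def monomialFrob (n : ℕ) : AddSubmonoid SymFn :=
  AddSubmonoid.closure {f | ∃ (Γ X : Type) (_ : Group Γ) (_ : Fintype Γ) (_ : Fintype X)
    (_ : DecidableEq X) (ι : Γ →* Perm X) (θ : Γ →* ℂ), Fintype.card X = n ∧ f = inducedFrob ι θ}

theorem inducedFrob_mem {Γ X : Type} [Group Γ] [Fintype Γ] [Fintype X] [DecidableEq X]
    (ι : Γ →* Perm X) (θ : Γ →* ℂ) (hX : Fintype.card X = n) : inducedFrob ι θ ∈ monomialFrob n :=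
  AddSubmonoid.subset_closure ⟨Γ, X, _, _, _, _, ι, θ, hX, rfl⟩

theorem p_sumCongr {X X' : Type} [Fintype X] [DecidableEq X] [Fintype X'] [DecidableEq X']
    (σ : Perm X) (τ : Perm X') :
    p (Perm.sumCongr σ τ).partition = p σ.partition * p τ.partition := by
  funext N
  rw [Pi.mul_apply, p_partition_apply, p_partition_apply, p_partition_apply,
    ← (Equiv.sumArrowEquivProdArrow X X' (Fin N)).symm.sum_comp, Fintype.sum_prod_type,
    Finset.sum_mul_sum]
  refine Finset.sum_congr rfl fun c _ => Finset.sum_congr rfl fun d _ => ?_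
  rw [Fintype.prod_sum_type, ite_zero_mul_ite_zero]
  refine if_congr ?_ rfl rfl
  rw [Sum.forall]
  rfl

theorem inducedFrob_mul {Γ Γ' X X' : Type} [Group Γ] [Fintype Γ] [Fintype X] [DecidableEq X]
    [Group Γ'] [Fintype Γ'] [Fintype X'] [DecidableEq X'] (ι : Γ →* Perm X) (θ : Γ →* ℂ)
    (ι' : Γ' →* Perm X') (θ' : Γ' →* ℂ) :
    inducedFrob ι θ * inducedFrob ι' θ' =
      inducedFrob ((Perm.sumCongrHom X X').comp (ι.prodMap ι'))
        (θ.comp (MonoidHom.fst Γ Γ') * θ'.comp (MonoidHom.snd Γ Γ')) := by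
  rw [inducedFrob, inducedFrob, inducedFrob, smul_mul_smul_comm, Finset.sum_mul_sum,
    Fintype.card_prod, Fintype.sum_prod_type, Nat.cast_mul, mul_inv]
  congr 1
  refine Finset.sum_congr rfl fun γ _ => Finset.sum_congr rfl fun γ' _ => ?_
  rw [smul_mul_smul_comm, ← p_sumCongr]
  rfl

theorem mul_mem_monomialFrob {a b : ℕ} {f g : SymFn} (hf : f ∈ monomialFrob a)
    (hg : g ∈ monomialFrob b) : f * g ∈ monomialFrob (a + b) := by
  have hmem := AddSubmonoid.mul_mem_mul hf hg
  rw [monomialFrob, monomialFrob, AddSubmonoid.closure_mul_closure] at hmem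
  refine AddSubmonoid.closure_le.mpr ?_ hmem
  rintro _ ⟨_, ⟨Γ, X, _, _, _, _, ι, θ, hX, rfl⟩, _, ⟨Γ', X', _, _, _, _, ι', θ', hX', rfl⟩, rfl⟩
  change inducedFrob ι θ * inducedFrob ι' θ' ∈ monomialFrob (a + b)
  rw [inducedFrob_mul]
  exact inducedFrob_mem _ _ (by rw [Fintype.card_sum, hX, hX'])

theorem one_mem_monomialFrob : (1 : SymFn) ∈ monomialFrob 0 := by
  have hone : (1 : SymFn) = inducedFrob (1 : Unit →* Perm (Fin 0)) 1 := by
    funext N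
    simp [inducedFrob, p_partition_apply]
  rw [hone]
  exact inducedFrob_mem _ _ (Fintype.card_fin 0)

/-- The class functions whose pairing with every character is a natural number. By orthonormality
these are the sums of irreducible characters. -/
def effectiveClassFunctions (n : ℕ) : AddSubmonoid (n.Partition → ℂ) where
  carrier := {χ | ∀ ψ, IsCharacter ψ → ∃ k : ℕ, pairing χ ψ = k}
  zero_mem' := fun _ _ => ⟨0, by simp⟩
  add_mem' := by
    intro χ χ' hχ hχ' ψ hψ
    obtain ⟨k, hk⟩ := hχ ψ hψ
    obtain ⟨l, hl⟩ := hχ' ψ hψ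
    exact ⟨k + l, by rw [map_add, LinearMap.add_apply, hk, hl, Nat.cast_add]⟩

section InducedClassFunction

variable {Γ X : Type} [Group Γ] [Fintype Γ] [Fintype X] [DecidableEq X] (hX : Fintype.card X = n)
  (ι : Γ →* Perm X) (θ : Γ →* ℂ)

/-- The character induced along `ι` from the linear character `θ`. -/
def inducedClassFunction (lam : n.Partition) : ℂ :=
  zee lam * ((Fintype.card Γ : ℂ)⁻¹ * ∑ γ, if cyclePartition hX (ι γ) = lam then θ γ else 0)

theorem sum_inducedClassFunction_smul {M : Type*} [AddCommGroup M] [Module ℂ M]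
    (F : n.Partition → M) :
    ∑ lam, (inducedClassFunction hX ι θ lam * (zee lam : ℂ)⁻¹) • F lam =
      ((Fintype.card Γ : ℂ)⁻¹) • ∑ γ, θ γ • F (cyclePartition hX (ι γ)) := by
  have hterm : ∀ lam, (inducedClassFunction hX ι θ lam * (zee lam : ℂ)⁻¹) • F lam =
      ((Fintype.card Γ : ℂ)⁻¹) •
        ∑ γ, if cyclePartition hX (ι γ) = lam then θ γ • F lam else 0 := by
    intro lam
    rw [inducedClassFunction, mul_right_comm, mul_inv_cancel₀ (zee_ne_zero lam), one_mul, mul_smul,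
      Finset.sum_smul]
    simp only [ite_smul, zero_smul]
  simp only [hterm]
  rw [← Finset.smul_sum, Finset.sum_comm]
  simp

theorem frob_inducedClassFunction : frob (inducedClassFunction hX ι θ) = inducedFrob ι θ := by
  rw [frob_eq_sum, sum_inducedClassFunction_smul]
  rfl

/-- The restriction of `ρ` to `Γ`, twisted by the linear character `θ`. -/
def twistedRestriction {V : Type} [AddCommGroup V] [Module ℂ V]
    (ρ : Representation ℂ (Perm (Fin n)) V) : Representation ℂ Γ V where
  toFun γ := θ γ • ρ ((Fintype.equivFinOfCardEq hX).permCongrHom (ι γ))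
  map_one' := by rw [map_one, map_one, map_one, map_one, one_smul]
  map_mul' γ γ' := by simp only [map_mul, smul_mul_smul_comm]

-- Frobenius reciprocity: the pairing is the dimension of an invariant subspace.
theorem inducedClassFunction_mem_effective :
    inducedClassFunction hX ι θ ∈ effectiveClassFunctions n := by
  rintro ψ ⟨V, _, _, _, ρ, hρ⟩
  have : Invertible (Nat.card Γ : ℂ) := invertibleOfNonzero (by
    rw [Nat.card_eq_fintype_card]
    exact Nat.cast_ne_zero.mpr Fintype.card_ne_zero)
  refine ⟨Module.finrank ℂ (twistedRestriction hX ι θ ρ).invariants, ?_⟩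
  have hsum := sum_inducedClassFunction_smul hX ι θ ψ
  simp only [smul_eq_mul, mul_right_comm _ _ (ψ _)] at hsum
  rw [← Representation.card_inv_mul_sum_char_eq_finrank, Nat.card_eq_fintype_card,
    pairing_apply, hsum]
  congr 1
  refine Finset.sum_congr rfl fun γ _ => ?_
  have hcycle : cyclePartition hX (ι γ) = cyclePartition (Fintype.card_fin n)
      ((Fintype.equivFinOfCardEq hX).permCongr (ι γ)) :=
    Nat.Partition.ext (parts_permCongr _ (ι γ)).symm
  rw [hcycle, ← hρ]
  exact ((LinearMap.trace ℂ V).map_smul (θ γ) _).symm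

end InducedClassFunction

theorem monomialFrob_le_map_frob :
    monomialFrob n ≤ (effectiveClassFunctions n).map (frob (n := n)) := by
  refine AddSubmonoid.closure_le.mpr ?_
  rintro _ ⟨Γ, X, _, _, _, _, ι, θ, hX, rfl⟩
  exact ⟨_, inducedClassFunction_mem_effective hX ι θ, frob_inducedClassFunction hX ι θ⟩

/-- Multiplication of a class function by the sign character. -/
def signTwist (χ : n.Partition → ℂ) (lam : n.Partition) : ℂ :=
  (-1) ^ (n - lam.parts.card) * χ lam

theorem sign_eq_pow {X : Type*} [Fintype X] [DecidableEq X] (hX : Fintype.card X = n)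
    (σ : Perm X) : (Perm.sign σ : ℤ) = (-1) ^ (n - (cyclePartition hX σ).parts.card) := by
  subst hX
  change _ = (-1) ^ (Fintype.card X - σ.partition.parts.card)
  have hsum : σ.cycleType.sum ≤ Fintype.card X := by
    rw [Perm.sum_cycleType]
    exact Finset.card_le_univ _
  have hcard : σ.cycleType.card ≤ σ.cycleType.sum := by
    simpa using Multiset.card_nsmul_le_sum (s := σ.cycleType) (a := 1)
      fun x hx => (Perm.two_le_of_mem_cycleType hx).trans' one_le_two
  rw [Perm.sign_of_cycleType, Perm.parts_partition, ← Perm.sum_cycleType, Multiset.card_add,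
    Multiset.card_replicate,
    show Fintype.card X - (σ.cycleType.card + (Fintype.card X - σ.cycleType.sum)) =
      σ.cycleType.sum - σ.cycleType.card by omega]
  push_cast
  exact neg_one_pow_congr (by rw [Nat.even_add, Nat.even_sub hcard])

theorem IsCharacter.signTwist {χ : n.Partition → ℂ} (hχ : IsCharacter χ) :
    IsCharacter (signTwist χ) := by
  obtain ⟨V, _, _, hfin, ρ, hρ⟩ := hχ
  refine ⟨V, _, _, hfin,
    { toFun := fun σ => ((Perm.sign σ : ℤ) : ℂ) • ρ σ
      map_one' := by simp
      map_mul' := fun σ τ => by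
        rw [map_mul, map_mul, smul_mul_smul_comm]
        push_cast
        rfl }, fun σ => ?_⟩
  change LinearMap.trace ℂ V (((Perm.sign σ : ℤ) : ℂ) • ρ σ) = _
  rw [map_smul, sign_eq_pow (Fintype.card_fin n), PrimeLie.signTwist, ← hρ]
  push_cast
  rfl

theorem pairing_signTwist_left (χ ψ : n.Partition → ℂ) :
    pairing (signTwist χ) ψ = pairing χ (signTwist ψ) := by
  simp only [pairing_apply, signTwist]
  exact Finset.sum_congr rfl fun lam _ => by ring

theorem schurPositive_frob {χ : n.Partition → ℂ} (hχ : χ ∈ effectiveClassFunctions n) :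
    SchurPositive n (frob χ) := by
  choose c hc using fun lam : n.Partition =>
    hχ (schurChar lam) (isIrreducibleCharacter_schurChar lam).isCharacter
  refine ⟨c, ?_⟩
  rw [frob_eq_sum_schur]
  refine Finset.sum_congr rfl fun lam _ => ?_
  rw [pairing_comm, hc, Nat.cast_smul_eq_nsmul]

theorem schurPositive_of_mem_monomialFrob {f : SymFn} (hf : f ∈ monomialFrob n) :
    SchurPositive n f := by
  obtain ⟨χ, hχ, rfl⟩ := monomialFrob_le_map_frob hf
  exact schurPositive_frob hχ

theorem schurPositive_signTwist {χ : n.Partition → ℂ} (hf : frob χ ∈ monomialFrob n) :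
    SchurPositive n (frob (signTwist χ)) := by
  obtain ⟨χ', hχ', heq⟩ := monomialFrob_le_map_frob hf
  obtain rfl := frob_injective heq
  exact schurPositive_frob fun ψ hψ => pairing_signTwist_left χ' ψ ▸ hχ' _ hψ.signTwist

end Monomial

/-! ### The character of an induced representation -/

section Induced

open Equiv Representation TensorProduct
open scoped MonoidAlgebra

theorem trace_mapDomain {R H : Type*} [CommRing R] [Fintype H] [DecidableEq H] (f : H → H) :
    LinearMap.trace R R[H] (MonoidAlgebra.mapDomainLinearMap R R f) =
      ∑ x, if f x = x then 1 else 0 := by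
  rw [LinearMap.trace_eq_matrix_trace R (MonoidAlgebra.basis H R), Matrix.trace]
  refine Finset.sum_congr rfl fun x _ => ?_
  have hbasis : MonoidAlgebra.mapDomainLinearMap R R f (MonoidAlgebra.single x 1) =
      MonoidAlgebra.basis H R (f x) := by
    rw [MonoidAlgebra.basis_apply]
    exact MonoidAlgebra.mapDomain_single
  rw [Matrix.diag_apply, LinearMap.toMatrix_apply, MonoidAlgebra.basis_apply, hbasis,
    Module.Basis.repr_self, Finsupp.single_apply]

section Coinvariants

variable {k Γ W : Type*} [Field k] [Group Γ] [Fintype Γ] [AddCommGroup W] [Module k W]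
  (T : Representation k Γ W)

/-- Averaging over the group, as a map out of the coinvariants. It splits the projection onto the
coinvariants if the order of the group is invertible. -/
def averageSection : Coinvariants T →ₗ[k] W :=
  Coinvariants.lift T ((Fintype.card Γ : k)⁻¹ • ∑ γ, T γ) fun γ => by
    change ((Fintype.card Γ : k)⁻¹ • ∑ γ, T γ) * T γ = _
    rw [smul_mul_assoc, Finset.sum_mul, ← Equiv.sum_comp (Equiv.mulRight γ) fun γ => T γ]
    simp only [Equiv.coe_mulRight, map_mul]

theorem averageSection_comp_mk :
    averageSection T ∘ₗ Coinvariants.mk T = (Fintype.card Γ : k)⁻¹ • ∑ γ, T γ :=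
  Coinvariants.lift_comp_mk T _ _

theorem mk_comp_averageSection (hΓ : (Fintype.card Γ : k) ≠ 0) :
    Coinvariants.mk T ∘ₗ averageSection T = LinearMap.id := by
  refine Coinvariants.hom_ext (LinearMap.ext fun w => ?_)
  rw [LinearMap.comp_assoc, averageSection_comp_mk]
  simp only [LinearMap.comp_apply, LinearMap.smul_apply, LinearMap.sum_apply, map_smul, map_sum,
    Coinvariants.mk_self_apply, Finset.sum_const, Finset.card_univ]
  rw [← Nat.cast_smul_eq_nsmul k, smul_smul, inv_mul_cancel₀ hΓ, one_smul]
  rfl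

theorem trace_coinvariants [FiniteDimensional k W] (hΓ : (Fintype.card Γ : k) ≠ 0)
    (f : W →ₗ[k] W) (f' : Coinvariants T →ₗ[k] Coinvariants T)
    (hf : f' ∘ₗ Coinvariants.mk T = Coinvariants.mk T ∘ₗ f) :
    LinearMap.trace k _ f' = (Fintype.card Γ : k)⁻¹ * ∑ γ, LinearMap.trace k W (f ∘ₗ T γ) := by
  have : FiniteDimensional k (Coinvariants T) :=
    Module.Finite.of_surjective (Coinvariants.mk T) (Coinvariants.mk_surjective T)
  have hf' : f' = Coinvariants.mk T ∘ₗ (f ∘ₗ averageSection T) := by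
    rw [← LinearMap.comp_assoc, ← hf, LinearMap.comp_assoc, mk_comp_averageSection T hΓ,
      LinearMap.comp_id]
  rw [hf', LinearMap.trace_comp_comm', LinearMap.comp_assoc, averageSection_comp_mk]
  change LinearMap.trace k W (f * ((Fintype.card Γ : k)⁻¹ • ∑ γ, T γ)) = _
  rw [mul_smul_comm, Finset.mul_sum, map_smul, map_sum, smul_eq_mul]
  rfl

theorem character_ind {H V : Type*} [Group H] [Fintype H] [DecidableEq H] [AddCommGroup V]
    [Module k V] [FiniteDimensional k V] (hΓ : (Fintype.card Γ : k) ≠ 0) (φ : Γ →* H)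
    (ρ : Representation k Γ V) (g : H) :
    (ind φ ρ).character g = (Fintype.card Γ : k)⁻¹ *
      ∑ γ, (∑ x : H, if φ γ * x * g⁻¹ = x then 1 else 0) * ρ.character γ := by
  rw [Representation.character, trace_coinvariants _ hΓ
    ((MonoidAlgebra.mapDomainLinearMap k k fun x => x * g⁻¹).rTensor V) (ind φ ρ g) rfl]
  congr 1
  refine Finset.sum_congr rfl fun γ _ => ?_
  have hmap : (MonoidAlgebra.mapDomainLinearMap k k fun x : H => x * g⁻¹).rTensor V ∘ₗ
      (Representation.tprod ((leftRegular k H).comp φ) ρ) γ =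
      TensorProduct.map (MonoidAlgebra.mapDomainLinearMap k k fun x : H => φ γ * x * g⁻¹)
        (ρ γ) := by
    ext x v
    simp
  rw [hmap, LinearMap.trace_tensorProduct', trace_mapDomain]
  rfl

end Coinvariants

theorem sum_fixed_smul_p {X : Type} [Fintype X] [DecidableEq X] (τ : Perm X) :
    ∑ σ : Perm X, (∑ x : Perm X, if τ * x * σ⁻¹ = x then (1 : ℂ) else 0) • p σ.partition =
      (Fintype.card X).factorial • p τ.partition := by
  have hcard : (Fintype.card X).factorial • p τ.partition = ∑ _x : Perm X, p τ.partition := by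
    rw [Finset.sum_const, Finset.card_univ, Fintype.card_perm]
  simp only [Finset.sum_smul]
  rw [Finset.sum_comm, hcard]
  refine Finset.sum_congr rfl fun x _ => ?_
  have hfixed : ∀ σ, τ * x * σ⁻¹ = x ↔ x⁻¹ * τ * x = σ := fun σ => by
    rw [mul_inv_eq_iff_eq_mul, mul_assoc, inv_mul_eq_iff_eq_mul]
  have hconj : (x⁻¹ * τ * x).partition = τ.partition :=
    Perm.partition_eq_of_isConj.mp (isConj_iff.mpr ⟨x, by group⟩)
  simp [hfixed, hconj]

theorem frobeniusChar_ind {Γ X : Type} [Group Γ] [Fintype Γ] [Fintype X] [DecidableEq X]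
    (φ : Γ →* Perm X) (ρ : Representation ℂ Γ ℂ) (θ : Γ →* ℂ) (hθ : ∀ γ, ρ.character γ = θ γ) :
    frobeniusChar (ind φ ρ) = inducedFrob φ θ := by
  have hX : ((Fintype.card X).factorial : ℂ) ≠ 0 := Nat.cast_ne_zero.mpr (Nat.factorial_ne_zero _)
  have hsum : ∑ σ : Perm X, (ind φ ρ).character σ • p σ.partition =
      (Fintype.card Γ : ℂ)⁻¹ • ∑ γ, θ γ • (Fintype.card X).factorial • p (φ γ).partition := by
    simp only [character_ind (Nat.cast_ne_zero.mpr Fintype.card_ne_zero), hθ, mul_smul,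
      ← Finset.smul_sum, ← sum_fixed_smul_p]
    congr 1
    simp only [Finset.smul_sum, Finset.sum_smul (s := Finset.univ (α := Γ))]
    rw [Finset.sum_comm]
    simp only [mul_comm _ (θ _), mul_smul]
  rw [frobeniusChar, hsum, inducedFrob, smul_comm]
  congr 1
  simp only [← Nat.cast_smul_eq_nsmul ℂ, smul_comm (θ _)]
  rw [← Finset.smul_sum, smul_smul, inv_mul_cancel₀ hX, one_smul]

/-- The linear character of the cyclic group with generator acting as `exp (2 π i r / n)`. -/
def cyclicChar (n : ℕ) [NeZero n] (r : ℕ) : Multiplicative (ZMod n) →* ℂ :=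
  ((ZMod.stdAddChar (N := n)).mulShift (r : ZMod n)).toMonoidHom

theorem L_eq_inducedFrob (S : Set ℕ) (n : ℕ) [NeZero n] :
    L S n = inducedFrob (cyclicHom n) (cyclicChar n (Qpart S n)) := by
  refine frobeniusChar_ind _ _ _ fun γ => ?_
  change LinearMap.trace ℂ ℂ (LinearMap.mulLeft ℂ (cyclicChar n (Qpart S n) γ)) = _
  have hscalar : ∀ a : ℂ, LinearMap.mulLeft ℂ a = a • LinearMap.id := fun a => by
    ext
    simp
  rw [hscalar, map_smul, LinearMap.trace_id]
  simp

end Induced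

/-! ### Exterior plethysms of monomial representations -/

section Wreath

open Equiv

variable {Γ X Y : Type} [Group Γ] [Fintype Γ] [Fintype X]

/-- The wreath product of `Γ` with the symmetric group on `m` letters. -/
abbrev Wreath (Γ : Type) [Group Γ] (m : ℕ) : Type :=
  (Fin m → Γ) ⋊[mulAutArrow (G := Perm (Fin m)) (A := Fin m) (M := Γ)] Perm (Fin m)

instance (m : ℕ) : Fintype (Wreath Γ m) := Fintype.ofEquiv _ SemidirectProduct.equivProd.symm

theorem card_wreath (m : ℕ) : Fintype.card (Wreath Γ m) = Fintype.card Γ ^ m * m.factorial := by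
  rw [Fintype.card_congr SemidirectProduct.equivProd, Fintype.card_prod, Fintype.card_fun,
    Fintype.card_perm, Fintype.card_fin]

/-- The action of the wreath product on `m` copies of `X`. -/
def wreathHom (ι : Γ →* Perm X) (m : ℕ) : Wreath Γ m →* Perm (Fin m × X) where
  toFun g :=
    { toFun := fun jx => (g.right jx.1, ι (g.left (g.right jx.1)) jx.2)
      invFun := fun jx => (g.right.symm jx.1, (ι (g.left jx.1)).symm jx.2)
      left_inv := fun jx => by simp
      right_inv := fun jx => by simp }
  map_one' := by ext jx <;> simp
  map_mul' g g' := by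
    ext jx
    · simp
    · change (ι (g.left (g.right (g'.right jx.1)) *
        g'.left (g.right.symm (g.right (g'.right jx.1))))) jx.2 = _
      rw [Equiv.symm_apply_apply, map_mul]
      rfl

/-- The linear character of the wreath product given by `θ` on the base group and by the sign on
the symmetric group. -/
def wreathChar (θ : Γ →* ℂ) (m : ℕ) : Wreath Γ m →* ℂ where
  toFun g := (∏ j, θ (g.left j)) * ((Perm.sign g.right : ℤ) : ℂ)
  map_one' := by simp
  map_mul' g g' := by
    have hbase : ∏ j, θ ((g * g').left j) = (∏ j, θ (g.left j)) * ∏ j, θ (g'.left j) := by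
      rw [← Equiv.prod_comp g.right.symm fun j => θ (g'.left j), ← Finset.prod_mul_distrib]
      refine Finset.prod_congr rfl fun j _ => ?_
      rw [← map_mul]
      rfl
    rw [hbase, SemidirectProduct.mul_right, map_mul]
    push_cast
    ring

/-- The kernel `∑ θ γ`, over the `γ` carrying the word `v` to the word `u`. -/
def wordKernel (ι : Γ →* Perm X) (θ : Γ →* ℂ) (u v : X → Y) : ℂ :=
  ∑ γ, if ∀ x, v (ι γ x) = u x then θ γ else 0

theorem content_eq_of_wordKernel_ne_zero {ι : Γ →* Perm X} {θ : Γ →* ℂ} {u v : X → Y}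
    (h : wordKernel ι θ u v ≠ 0) : content u = content v := by
  obtain ⟨γ, _, hγ⟩ := Finset.exists_ne_zero_of_sum_ne_zero h
  have hvu : v ∘ ι γ = u := funext (by_contra fun hne => hγ (if_neg hne))
  rw [← hvu, content_comp]

/-- The monomial of a word. -/
def wordMonomial (u : X → Y) : MvPolynomial Y ℂ := ∏ x, MvPolynomial.X (u x)

theorem wordMonomial_eq_of_wordKernel_ne_zero {ι : Γ →* Perm X} {θ : Γ →* ℂ} {u v : X → Y}
    (h : wordKernel ι θ u v ≠ 0) : wordMonomial u = wordMonomial v := by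
  rw [wordMonomial, wordMonomial, prod_X_eq_monomial, prod_X_eq_monomial,
    content_eq_of_wordKernel_ne_zero h]

theorem expand_wordMonomial (k : ℕ) (u : X → Y) :
    MvPolynomial.expand k (wordMonomial u) = wordMonomial u ^ k := by
  simp only [wordMonomial, map_prod, MvPolynomial.expand_X, Finset.prod_pow]

/-- The matrix, indexed by the words in the alphabet `Y`, of the operator
`∑ γ, θ γ • ι γ` on tensors followed by multiplication with the monomial of a word. Traces of its
powers are plethysms of the Frobenius characteristic of `θ` with power sums. -/
def wordMatrix (Y : Type) (ι : Γ →* Perm X) (θ : Γ →* ℂ) :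
    Matrix (X → Y) (X → Y) (MvPolynomial Y ℂ) :=
  Matrix.of fun u v => wordMonomial u * MvPolynomial.C (wordKernel ι θ u v)

variable [DecidableEq X]

theorem sum_wordKernel_mul [Fintype Y] (ι : Γ →* Perm X) (θ : Γ →* ℂ) (u w : X → Y) :
    ∑ v, wordKernel ι θ u v * wordKernel ι θ v w = Fintype.card Γ * wordKernel ι θ u w := by
  have hcomp (γ γ' : Γ) : ∑ v : X → Y, (if ∀ x, v (ι γ x) = u x then θ γ else 0) *
      (if ∀ x, w (ι γ' x) = v x then θ γ' else 0) =
      if ∀ x, w (ι (γ' * γ) x) = u x then θ (γ' * γ) else 0 := by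
    rw [Finset.sum_eq_single (fun x => w (ι γ' x))]
    · simp only [implies_true, if_true, ite_mul, zero_mul, map_mul, mul_comm (θ γ),
        Perm.mul_apply]
    · intro v _ hv
      rw [if_neg (c := ∀ x, w (ι γ' x) = v x) fun h => hv (funext fun x => (h x).symm), mul_zero]
    · simp
  simp only [wordKernel, Finset.sum_mul_sum]
  rw [Finset.sum_comm, ← nsmul_eq_mul, ← Finset.card_univ, ← Finset.sum_const]
  refine Finset.sum_congr rfl fun γ _ => ?_
  rw [Finset.sum_comm, Finset.sum_congr rfl fun γ' _ => hcomp γ γ']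
  exact Equiv.sum_comp (Equiv.mulRight γ) fun γ' => if ∀ x, w (ι γ' x) = u x then θ γ' else 0

theorem pow_wordMatrix [Fintype Y] [DecidableEq Y] (ι : Γ →* Perm X) (θ : Γ →* ℂ) (k : ℕ)
    (u w : X → Y) :
    (wordMatrix Y ι θ ^ (k + 1)) u w =
      wordMonomial u ^ (k + 1) * MvPolynomial.C (Fintype.card Γ ^ k * wordKernel ι θ u w) := by
  induction k generalizing w with
  | zero => simp [wordMatrix]
  | succ k ih =>
    have hterm (v : X → Y) : (wordMatrix Y ι θ ^ (k + 1)) u v * wordMatrix Y ι θ v w =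
        wordMonomial u ^ (k + 1 + 1) *
          MvPolynomial.C (Fintype.card Γ ^ k * (wordKernel ι θ u v * wordKernel ι θ v w)) := by
      rw [ih v, wordMatrix, Matrix.of_apply]
      by_cases hzero : wordKernel ι θ u v = 0
      · simp [hzero]
      · rw [← wordMonomial_eq_of_wordKernel_ne_zero hzero, map_mul, map_mul, map_mul]
        ring
    rw [pow_succ, Matrix.mul_apply, Finset.sum_congr rfl fun v _ => hterm v, ← Finset.mul_sum,
      ← map_sum, ← Finset.mul_sum, sum_wordKernel_mul, pow_succ (Fintype.card Γ : ℂ) k, mul_assoc]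

theorem inducedFrob_apply (ι : Γ →* Perm X) (θ : Γ →* ℂ) (N : ℕ) :
    inducedFrob ι θ N = (Fintype.card Γ : ℂ)⁻¹ •
      ∑ u : X → Fin N, wordMonomial u * MvPolynomial.C (wordKernel ι θ u u) := by
  rw [inducedFrob, Pi.smul_apply, Finset.sum_apply]
  congr 1
  simp only [wordKernel, map_sum, Finset.mul_sum]
  rw [Finset.sum_comm]
  refine Finset.sum_congr rfl fun γ _ => ?_
  rw [Pi.smul_apply, p_partition_apply, Finset.smul_sum]
  refine Finset.sum_congr rfl fun u _ => ?_
  split_ifs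
  · rw [MvPolynomial.smul_eq_C_mul, mul_comm]; rfl
  · simp

theorem trace_pow_wordMatrix (ι : Γ →* Perm X) (θ : Γ →* ℂ) (N : ℕ) {k : ℕ} (hk : k ≠ 0) :
    (wordMatrix (Fin N) ι θ ^ k).trace =
      (Fintype.card Γ : ℂ) ^ k • adams k (inducedFrob ι θ) N := by
  obtain ⟨k, rfl⟩ := Nat.exists_eq_add_one_of_ne_zero hk
  have hcard : (Fintype.card Γ : ℂ) ≠ 0 := Nat.cast_ne_zero.mpr Fintype.card_ne_zero
  rw [Matrix.trace, adams, inducedFrob_apply, map_smul, map_sum, smul_smul,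
    pow_succ (Fintype.card Γ : ℂ), mul_inv_cancel_right₀ hcard, Finset.smul_sum]
  refine Finset.sum_congr rfl fun u _ => ?_
  rw [Matrix.diag_apply, pow_wordMatrix, map_mul (MvPolynomial.expand _), MvPolynomial.expand_C,
    expand_wordMonomial, map_mul, MvPolynomial.smul_eq_C_mul]
  ring

/-- The plethysm `e_m[f]`. -/
def exteriorPleth (m : ℕ) (f : SymFn) : SymFn :=
  ∑ lam : m.Partition, ((-1 : ℂ) ^ (m - lam.parts.card) * (zee lam : ℂ)⁻¹) •
    (lam.parts.map fun k => adams k f).prod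

omit [Fintype Γ] in
theorem p_wreathHom_apply (ι : Γ →* Perm X) {m : ℕ} (τ : Perm (Fin m)) (c : Fin m → Γ) (N : ℕ) :
    p (wreathHom ι m ⟨c, τ⟩).partition N = ∑ w : Fin m → X → Fin N,
      if ∀ j x, w (τ j) (ι (c (τ j)) x) = w j x then ∏ j, wordMonomial (w j) else 0 := by
  rw [p_partition_apply, ← (Equiv.curry (Fin m) X (Fin N)).symm.sum_comp]
  simp only [Prod.forall, Fintype.prod_prod_type]
  rfl

theorem sum_smul_p_wreathHom (ι : Γ →* Perm X) (θ : Γ →* ℂ) {m : ℕ} (τ : Perm (Fin m)) (N : ℕ) :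
    ∑ c : Fin m → Γ, (∏ j, θ (c j)) • p (wreathHom ι m ⟨c, τ⟩).partition N =
      ∑ w : Fin m → X → Fin N, ∏ j, wordMatrix (Fin N) ι θ (w j) (w (τ j)) := by
  have hterm (c : Fin m → Γ) : (∏ j, θ (c j)) • p (wreathHom ι m ⟨c, τ⟩).partition N =
      ∑ w : Fin m → X → Fin N, (∏ j, wordMonomial (w j)) * MvPolynomial.C
        (∏ j, if ∀ x, w (τ j) (ι (c (τ j)) x) = w j x then θ (c (τ j)) else 0) := by
    rw [p_wreathHom_apply, Finset.smul_sum]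
    refine Finset.sum_congr rfl fun w _ => ?_
    simp only [Finset.prod_ite_zero, Finset.mem_univ, true_implies,
      Equiv.prod_comp τ fun j => θ (c j)]
    split_ifs
    · rw [MvPolynomial.smul_eq_C_mul, mul_comm]
    · rw [smul_zero, map_zero, mul_zero]
  rw [Finset.sum_congr rfl fun c _ => hterm c, Finset.sum_comm]
  refine Finset.sum_congr rfl fun w _ => ?_
  simp only [wordMatrix, Matrix.of_apply]
  rw [← Finset.mul_sum, Finset.prod_mul_distrib, ← map_sum, ← map_prod]
  congr 2
  rw [← (Equiv.arrowCongr τ (Equiv.refl Γ)).sum_comp]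
  simp only [wordKernel]
  rw [Finset.prod_univ_sum, Fintype.piFinset_univ]
  refine Finset.sum_congr rfl fun c _ => Finset.prod_congr rfl fun j _ => ?_
  simp [Equiv.arrowCongr]

theorem sum_smul_p_wreathHom_eq_prod (ι : Γ →* Perm X) (θ : Γ →* ℂ) {m : ℕ} (τ : Perm (Fin m))
    (N : ℕ) :
    ∑ c : Fin m → Γ, (∏ j, θ (c j)) • p (wreathHom ι m ⟨c, τ⟩).partition N =
      (Fintype.card Γ : ℂ) ^ m •
        (τ.partition.parts.map fun k => adams k (inducedFrob ι θ)).prod N := by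
  have hparts (s : Multiset ℕ) (hs : ∀ k ∈ s, 0 < k) :
      (s.map fun k => (wordMatrix (Fin N) ι θ ^ k).trace).prod =
        (Fintype.card Γ : ℂ) ^ s.sum • (s.map fun k => adams k (inducedFrob ι θ)).prod N := by
    induction s using Multiset.induction_on with
    | empty => simp
    | cons k s ih =>
      rw [Multiset.forall_mem_cons] at hs
      simp [ih hs.2, trace_pow_wordMatrix ι θ N hs.1.ne', pow_add, smul_smul,
        mul_comm]
  rw [sum_smul_p_wreathHom, sum_prod_perm (wordMatrix (Fin N) ι θ) τ]
  refine (hparts _ fun k => τ.partition.parts_pos).trans ?_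
  rw [τ.partition.parts_sum.trans (Fintype.card_fin m)]

theorem exteriorPleth_inducedFrob (ι : Γ →* Perm X) (θ : Γ →* ℂ) (m : ℕ) :
    exteriorPleth m (inducedFrob ι θ) = inducedFrob (wreathHom ι m) (wreathChar θ m) := by
  have hm : (m.factorial : ℂ) ≠ 0 := Nat.cast_ne_zero.mpr m.factorial_ne_zero
  have hcard : (Fintype.card Γ : ℂ) ≠ 0 := Nat.cast_ne_zero.mpr Fintype.card_ne_zero
  have hwreath (N : ℕ) : (∑ g, wreathChar θ m g • p (wreathHom ι m g).partition) N =
      (Fintype.card Γ : ℂ) ^ m • ∑ τ : Perm (Fin m), ((Perm.sign τ : ℤ) : ℂ) •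
        (τ.partition.parts.map fun k => adams k (inducedFrob ι θ)).prod N := by
    rw [Finset.sum_apply, ← SemidirectProduct.equivProd.symm.sum_comp,
      Fintype.sum_prod_type_right, Finset.smul_sum]
    refine Finset.sum_congr rfl fun τ _ => ?_
    rw [smul_comm, ← sum_smul_p_wreathHom_eq_prod, Finset.smul_sum]
    refine Finset.sum_congr rfl fun c _ => ?_
    rw [smul_smul, mul_comm]
    rfl
  have hcycle := sum_perm_eq_sum_partition (Fintype.card_fin m) fun lam : m.Partition =>
    (-1 : ℂ) ^ (m - lam.parts.card) • (lam.parts.map fun k => adams k (inducedFrob ι θ)).prod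
  symm
  funext N
  rw [inducedFrob, Pi.smul_apply, hwreath, card_wreath]
  have hsign (τ : Perm (Fin m)) : ((Perm.sign τ : ℤ) : ℂ) •
      (τ.partition.parts.map fun k => adams k (inducedFrob ι θ)).prod N =
      ((-1 : ℂ) ^ (m - (cyclePartition (Fintype.card_fin m) τ).parts.card) •
        ((cyclePartition (Fintype.card_fin m) τ).parts.map fun k =>
          adams k (inducedFrob ι θ)).prod) N := by
    rw [sign_eq_pow (Fintype.card_fin m)]
    push_cast
    rfl
  rw [Finset.sum_congr rfl fun τ _ => hsign τ, ← Finset.sum_apply, hcycle, exteriorPleth]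
  simp only [Pi.smul_apply, smul_smul, mul_comm ((-1 : ℂ) ^ _)]
  push_cast
  rw [mul_inv_rev, mul_assoc, inv_mul_cancel_left₀ (pow_ne_zero m hcard),
    inv_mul_cancel₀ hm, one_smul]

theorem exteriorPleth_mem_monomialFrob (ι : Γ →* Perm X) (θ : Γ →* ℂ) (m : ℕ) :
    exteriorPleth m (inducedFrob ι θ) ∈ monomialFrob (m * Fintype.card X) := by
  rw [exteriorPleth_inducedFrob]
  exact inducedFrob_mem _ _ (by rw [Fintype.card_prod, Fintype.card_fin])

end Wreath

/-! ### Plethystic exponentials -/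

section Exponential

open PowerSeries

variable {F G : PowerSeries SymFn}

/-- The substitution `p_k[·]` as an algebra homomorphism. -/
def adamsHom (k : ℕ) : SymFn →ₐ[ℂ] SymFn where
  toFun := adams k
  map_zero' := funext fun _ => map_zero _
  map_one' := funext fun _ => map_one _
  map_add' _ _ := funext fun _ => map_add _ _ _
  map_mul' _ _ := funext fun _ => map_mul _ _ _
  commutes' c := funext fun _ => (MvPolynomial.expand k).commutes c

theorem adams_zero (k : ℕ) : adams k 0 = 0 := (adamsHom k).map_zero

theorem adams_add (k : ℕ) (f g : SymFn) : adams k (f + g) = adams k f + adams k g :=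
  map_add (adamsHom k) f g

theorem adams_smul (k : ℕ) (c : ℂ) (f : SymFn) : adams k (c • f) = c • adams k f :=
  map_smul (adamsHom k) c f

theorem coeff_adamsSeries (k n : ℕ) (F : PowerSeries SymFn) :
    coeff n (adamsSeries k F) = if k ∣ n then adams k (coeff (n / k) F) else 0 := coeff_mk _ _

theorem coeff_adamsSeries_eq_zero (hF : coeff 0 F = 0) {k j : ℕ} (hj : j < k) :
    coeff j (adamsSeries k F) = 0 := by
  rw [coeff_adamsSeries]
  split_ifs with hdvd
  · rw [Nat.eq_zero_of_dvd_of_lt hdvd hj, Nat.zero_div, hF, adams_zero]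
  · rfl

theorem neg_one_pow_sub_card_eq_prod {r : ℕ} (lam : r.Partition) :
    (-1 : ℂ) ^ (r - lam.parts.card) = (lam.parts.map fun k => (-1 : ℂ) ^ (k - 1)).prod := by
  have hmultiset (s : Multiset ℕ) (hs : ∀ k ∈ s, 0 < k) : s.card ≤ s.sum ∧
      (-1 : ℂ) ^ (s.sum - s.card) = (s.map fun k => (-1 : ℂ) ^ (k - 1)).prod := by
    induction s using Multiset.induction_on with
    | empty => simp
    | cons k s ih =>
      rw [Multiset.forall_mem_cons] at hs
      obtain ⟨hle, hprod⟩ := ih hs.2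
      rw [Multiset.sum_cons, Multiset.card_cons, Multiset.map_cons, Multiset.prod_cons, ← hprod,
        ← pow_add]
      exact ⟨by grind, by congr 1; grind⟩
  have hparts := (hmultiset lam.parts fun k => lam.parts_pos).2
  rwa [lam.parts_sum] at hparts

theorem prod_map_smul {K R : Type*} [CommSemiring K] [CommSemiring R] [Algebra K R] (c : ℕ → K)
    (a : ℕ → R) (s : Multiset ℕ) :
    (s.map fun k => c k • a k).prod = (s.map c).prod • (s.map a).prod := by
  induction s using Multiset.induction_on with
  | empty => simp
  | cons k s ih => simp only [Multiset.map_cons, Multiset.prod_cons, ih, smul_mul_smul_comm]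

theorem HPleth_eq_completeSeries (F : PowerSeries SymFn) :
    HPleth F = completeSeries fun k => (1 : ℂ) • adamsSeries k F := by
  simp only [one_smul]
  rfl

theorem EPleth_eq_completeSeries (F : PowerSeries SymFn) :
    EPleth F = completeSeries fun k => (-1 : ℂ) ^ (k - 1) • adamsSeries k F := by
  have hterm (r : ℕ) :
      ePleth r F = completeOfPowerSums (fun k => (-1 : ℂ) ^ (k - 1) • adamsSeries k F) r := by
    refine Finset.sum_congr rfl fun lam _ => ?_
    rw [prod_map_smul, smul_smul, ← neg_one_pow_sub_card_eq_prod, mul_comm]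
  simp only [EPleth, hterm]
  rfl

theorem filter_dvd_Icc_one (n : ℕ) : (Finset.Icc 1 n).filter (· ∣ n) = n.divisors := rfl

/-- The logarithmic derivative `t d/dt` of the plethystic exponential of `F` in which `p_k` is
replaced by `c k p_k`: `H[F]` is the case `c k = 1` and `E[F]` the case `c k = (-1) ^ (k - 1)`. -/
def logDerivSeries (c : ℕ → ℂ) (F : PowerSeries SymFn) : PowerSeries SymFn :=
  mk fun n => ∑ k ∈ n.divisors, c k • adams k (((n / k : ℕ) : ℂ) • coeff (n / k) F)

theorem coeff_zero_logDerivSeries (c : ℕ → ℂ) (F : PowerSeries SymFn) :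
    coeff 0 (logDerivSeries c F) = 0 := by
  rw [logDerivSeries, coeff_mk, Nat.divisors_zero, Finset.sum_empty]

theorem logDerivSeries_add (c : ℕ → ℂ) (F G : PowerSeries SymFn) :
    logDerivSeries c (F + G) = logDerivSeries c F + logDerivSeries c G := by
  ext1 n
  simp only [logDerivSeries, map_add, coeff_mk, smul_add, adams_add, Finset.sum_add_distrib]

theorem eulerDerivation_completeSeries_adamsSeries (c : ℕ → ℂ) (hF : coeff 0 F = 0) :
    eulerDerivation SymFn (completeSeries fun k => c k • adamsSeries k F) =
      logDerivSeries c F * completeSeries fun k => c k • adamsSeries k F := by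
  rw [eulerDerivation_completeSeries fun k j hj => by
    rw [coeff_smul, coeff_adamsSeries_eq_zero hF hj, smul_zero], logDerivSeries]
  congr 2
  funext n
  rw [← filter_dvd_Icc_one, Finset.sum_filter]
  refine Finset.sum_congr rfl fun k hk => ?_
  rw [coeff_smul, coeff_adamsSeries]
  split_ifs with hdvd
  · have hk0 : (k : ℂ) ≠ 0 :=
      Nat.cast_ne_zero.mpr (Nat.one_le_iff_ne_zero.mp (Finset.mem_Icc.mp hk).1)
    rw [adams_smul, Nat.cast_div hdvd hk0, smul_comm]
  · rw [smul_zero, smul_zero]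

theorem eulerDerivation_HPleth (hF : coeff 0 F = 0) :
    eulerDerivation SymFn (HPleth F) = logDerivSeries (fun _ => 1) F * HPleth F := by
  rw [HPleth_eq_completeSeries]
  exact eulerDerivation_completeSeries_adamsSeries _ hF

theorem eulerDerivation_EPleth (hF : coeff 0 F = 0) :
    eulerDerivation SymFn (EPleth F) =
      logDerivSeries (fun k => (-1) ^ (k - 1)) F * EPleth F := by
  rw [EPleth_eq_completeSeries]
  exact eulerDerivation_completeSeries_adamsSeries _ hF

theorem coeff_zero_HPleth (F : PowerSeries SymFn) : coeff 0 (HPleth F) = 1 := by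
  rw [HPleth_eq_completeSeries, coeff_zero_completeSeries]

theorem coeff_zero_EPleth (F : PowerSeries SymFn) : coeff 0 (EPleth F) = 1 := by
  rw [EPleth_eq_completeSeries, coeff_zero_completeSeries]

theorem coeff_EPleth_congr (hF : coeff 0 F = 0) {n : ℕ} (h : ∀ i ≤ n, coeff i F = coeff i G) :
    coeff n (EPleth F) = coeff n (EPleth G) := by
  refine coeff_eq_of_eulerDerivation_eq_mul (eulerDerivation_EPleth hF)
    (eulerDerivation_EPleth ((h 0 n.zero_le).symm.trans hF))
    ((coeff_zero_EPleth F).trans (coeff_zero_EPleth G).symm) (fun i hi => ?_)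
    (coeff_zero_logDerivSeries _ _) n le_rfl
  rw [logDerivSeries, logDerivSeries, coeff_mk, coeff_mk]
  exact Finset.sum_congr rfl fun k _ => by rw [h (i / k) ((Nat.div_le_self i k).trans hi)]

theorem EPleth_add (hF : coeff 0 F = 0) (hG : coeff 0 G = 0) :
    EPleth (F + G) = EPleth F * EPleth G := by
  have hsum := eulerDerivation_EPleth (F := F + G) (by rw [map_add, hF, hG, add_zero])
  have hmul : eulerDerivation SymFn (EPleth F * EPleth G) =
      logDerivSeries (fun k => (-1) ^ (k - 1)) (F + G) * (EPleth F * EPleth G) := by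
    rw [Derivation.leibniz, smul_eq_mul, smul_eq_mul, eulerDerivation_EPleth hF,
      eulerDerivation_EPleth hG, logDerivSeries_add]
    ring
  refine eq_of_eulerDerivation_eq_mul hsum hmul ?_ (coeff_zero_logDerivSeries _ _)
  simp only [coeff_zero_eq_constantCoeff, map_mul]
  simp only [← coeff_zero_eq_constantCoeff_apply, coeff_zero_EPleth, mul_one]

theorem EPleth_zero : EPleth 0 = 1 := by
  have hsq : EPleth 0 * EPleth 0 = EPleth 0 * 1 := by
    rw [← EPleth_add (map_zero _) (map_zero _), add_zero, mul_one]
  refine IsUnit.mul_left_cancel ?_ hsq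
  rw [isUnit_iff_constantCoeff, ← coeff_zero_eq_constantCoeff_apply, coeff_zero_EPleth]
  exact isUnit_one

theorem adamsSeries_monomial {k : ℕ} (hk : k ≠ 0) (i : ℕ) (f : SymFn) :
    adamsSeries k (monomial i f) = monomial (k * i) (adams k f) := by
  ext1 n
  rw [coeff_adamsSeries, coeff_monomial, coeff_monomial]
  by_cases hdvd : k ∣ n
  · obtain ⟨m, rfl⟩ := hdvd
    simp only [dvd_mul_right, if_true, Nat.mul_div_cancel_left m (Nat.pos_of_ne_zero hk),
      Nat.mul_right_inj hk, apply_ite (adams k), adams_zero]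
  · rw [if_neg hdvd, if_neg fun h : n = k * i => hdvd (h ▸ dvd_mul_right k i)]

theorem ePleth_monomial (r i : ℕ) (f : SymFn) :
    ePleth r (monomial i f) = monomial (r * i) (exteriorPleth r f) := by
  have hprod (s : Multiset ℕ) (hs : ∀ k ∈ s, k ≠ 0) :
      (s.map fun k => adamsSeries k (monomial i f)).prod =
        monomial (s.sum * i) (s.map fun k => adams k f).prod := by
    induction s using Multiset.induction_on with
    | empty => simp
    | cons k s ih =>
      rw [Multiset.forall_mem_cons] at hs
      rw [Multiset.map_cons, Multiset.prod_cons, ih hs.2, adamsSeries_monomial hs.1,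
        monomial_mul_monomial, Multiset.sum_cons, Multiset.map_cons, Multiset.prod_cons, add_mul]
  rw [ePleth, exteriorPleth, map_sum]
  refine Finset.sum_congr rfl fun lam _ => ?_
  rw [hprod _ fun k hk => (lam.parts_pos hk).ne', lam.parts_sum]
  ext1 n
  rw [coeff_smul, coeff_monomial, coeff_monomial, smul_ite, smul_zero]

theorem coeff_EPleth_monomial_mem_monomialFrob {i : ℕ} {f : SymFn}
    (hf : ∀ r, exteriorPleth r f ∈ monomialFrob (r * i)) (n : ℕ) :
    coeff n (EPleth (monomial i f)) ∈ monomialFrob n := by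
  rw [EPleth, coeff_mk]
  refine sum_mem fun r _ => ?_
  rw [ePleth_monomial, coeff_monomial]
  split_ifs with hn
  · exact hn ▸ hf r
  · exact zero_mem _

theorem coeff_EPleth_add_mem_monomialFrob (hF : coeff 0 F = 0) (hG : coeff 0 G = 0)
    (hEF : ∀ n, coeff n (EPleth F) ∈ monomialFrob n)
    (hEG : ∀ n, coeff n (EPleth G) ∈ monomialFrob n) (n : ℕ) :
    coeff n (EPleth (F + G)) ∈ monomialFrob n := by
  rw [EPleth_add hF hG, coeff_mul]
  refine sum_mem fun x hx => ?_
  rw [← Finset.HasAntidiagonal.mem_antidiagonal.mp hx]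
  exact mul_mem_monomialFrob (hEF _) (hEG _)

theorem coeff_EPleth_mem_monomialFrob (hF : coeff 0 F = 0)
    (h : ∀ i ≠ 0, ∀ r, exteriorPleth r (coeff i F) ∈ monomialFrob (r * i)) (n : ℕ) :
    coeff n (EPleth F) ∈ monomialFrob n := by
  have htrunc (N : ℕ) : coeff 0 (trunc N F : PowerSeries SymFn) = 0 ∧
      ∀ m, coeff m (EPleth (trunc N F : PowerSeries SymFn)) ∈ monomialFrob m := by
    induction N with
    | zero =>
      refine ⟨by simp, fun m => ?_⟩
      rw [trunc_zero', Polynomial.coe_zero, EPleth_zero, coeff_one]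
      split_ifs with hm
      · exact hm ▸ one_mem_monomialFrob
      · exact zero_mem _
    | succ N ih =>
      rw [trunc_succ, Polynomial.coe_add, Polynomial.coe_monomial]
      rcases eq_or_ne N 0 with rfl | hN
      · simpa [hF] using ih
      · have hconst : coeff 0 (monomial N (coeff N F)) = 0 := by
          rw [coeff_monomial, if_neg hN.symm]
        exact ⟨by rw [map_add, ih.1, hconst, add_zero],
          coeff_EPleth_add_mem_monomialFrob ih.1 hconst ih.2
            (coeff_EPleth_monomial_mem_monomialFrob (h N hN))⟩
  rw [coeff_EPleth_congr hF fun i hi => (coeff_coe_trunc_of_lt (Nat.lt_succ_of_le hi)).symm]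
  exact (htrunc (n + 1)).2 n

end Exponential

/-! ### Signed sums of power sums -/

section SignedSums

open PowerSeries

variable {R : Type*} [CommRing R]

/-- The weight of a part `i` of multiplicity `m`, when the parts in `A` may be repeated, those in
`B` may not and come with a sign, and there are no other parts. -/
def partWeight (A B : Set ℕ) (w : ℕ → R) (i m : ℕ) : R :=
  if i ∈ A then w i ^ m else
    if m = 0 then 1 else if i ∈ B ∧ m = 1 then -w i else 0

/-- The integer `1` on `A`, `-1` on `B` and `0` elsewhere; it records how a part `i` enters the
logarithmic derivative of `Nat.Partition.genFun (partWeight A B w)`. -/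
def partSign (A B : Set ℕ) (i : ℕ) : ℤ := if i ∈ A then 1 else if i ∈ B then -1 else 0

theorem eulerDerivation_one_sub_C_mul_X (c : R) : eulerDerivation R (1 - C c * X) =
    (mk fun m => if m = 0 then 0 else -c ^ m) * (1 - C c * X) := by
  ext m
  rw [coeff_eulerDerivation, mul_sub, mul_one, mul_comm, mul_left_comm, map_sub, map_sub,
    coeff_C_mul, coeff_C_mul, coeff_X, coeff_one, coeff_mk]
  rcases m with _ | _ | m
  · simp
  · simp
  · rw [mul_comm _ X, coeff_succ_X_mul, coeff_mk]
    simp [pow_succ']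

theorem eulerDerivation_mk_partWeight (A B : Set ℕ) (w : ℕ → R) (i : ℕ) :
    eulerDerivation R (mk (partWeight A B w i)) =
      (mk fun m => if m = 0 then 0 else (partSign A B i : R) * w i ^ m) *
        mk (partWeight A B w i) := by
  by_cases hA : i ∈ A
  · have hgeom : partWeight A B w i = fun m => w i ^ m := funext fun m => if_pos hA
    rw [hgeom, eulerDerivation_mk_pow]
    simp [partSign, hA]
  by_cases hB : i ∈ B
  · have hlinear : mk (partWeight A B w i) = 1 - C (w i) * X := by
      ext m
      rw [coeff_mk, map_sub, coeff_one, coeff_C_mul, coeff_X, partWeight, if_neg hA]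
      rcases m with _ | _ | m <;> simp [hB]
    rw [hlinear, eulerDerivation_one_sub_C_mul_X]
    simp [partSign, hA, hB]
  · have hone : mk (partWeight A B w i) = 1 := by
      ext m
      rw [coeff_mk, coeff_one, partWeight, if_neg hA]
      simp [hB]
    rw [hone, Derivation.map_one_eq_zero]
    ext m
    simp [partSign, hA, hB]

theorem eulerDerivation_expand_mk_partWeight (A B : Set ℕ) (w : ℕ → R) {i : ℕ} (hi : i ≠ 0) :
    eulerDerivation R (expand i hi (mk (partWeight A B w i))) =
      (mk fun n => if i ∣ n ∧ n ≠ 0 then ((i * partSign A B i : ℤ) : R) * w i ^ (n / i) else 0) *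
        expand i hi (mk (partWeight A B w i)) := by
  rw [eulerDerivation_expand, eulerDerivation_mk_partWeight, map_mul, ← mul_assoc]
  congr 1
  ext n
  rw [← map_natCast (C (R := R)), coeff_C_mul, coeff_expand, coeff_mk, coeff_mk]
  by_cases hdvd : i ∣ n
  · obtain ⟨m, rfl⟩ := hdvd
    rcases eq_or_ne m 0 with rfl | hm
    · simp
    · simp [hi, hm, Nat.mul_div_cancel_left m (Nat.pos_of_ne_zero hi), mul_assoc]
  · simp [hdvd]

theorem eulerDerivation_genFun_partWeight (A B : Set ℕ) (w : ℕ → R) :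
    eulerDerivation R (Nat.Partition.genFun (partWeight A B w)) =
      (mk fun n => ∑ e ∈ n.divisors, ((e * partSign A B e : ℤ) : R) * w e ^ (n / e)) *
        Nat.Partition.genFun (partWeight A B w) := by
  rw [derivation_genFun (eulerDerivation R)
    (fun n f g h => by rw [coeff_eulerDerivation, coeff_eulerDerivation, h n le_rfl])
    (fun i => by simp [partWeight])
    (b := fun i => mk fun n =>
      if i ∣ n ∧ n ≠ 0 then ((i * partSign A B i : ℤ) : R) * w i ^ (n / i) else 0)
    (fun i => eulerDerivation_expand_mk_partWeight A B w i.succ_ne_zero) fun i a ha => ?_]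
  · congr 2
    funext n
    rw [← filter_dvd_Icc_one, Finset.sum_filter]
    refine Finset.sum_congr rfl fun i hi => ?_
    have hn : n ≠ 0 := Nat.one_le_iff_ne_zero.mp (Finset.nonempty_Icc.mp ⟨i, hi⟩)
    simp only [coeff_mk, hn, ne_eq, not_false_iff, and_true]
  · rw [coeff_mk, if_neg fun h => h.2 (Nat.eq_zero_of_dvd_of_lt h.1 ha)]

/-- The power sum `p_k`. -/
def powerSum (k : ℕ) : SymFn := fun N => MvPolynomial.psum (Fin N) ℂ k

theorem p_eq_prod_powerSum {n : ℕ} (lam : n.Partition) : p lam = (lam.parts.map powerSum).prod := by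
  funext N
  rw [Pi.multiset_prod_apply, Multiset.map_map]
  rfl

/-- The partitions of `n` with parts in `A ∪ B`, those in `B` being distinct. -/
def partsInDistinct (A B : Set ℕ) (n : ℕ) : Set n.Partition :=
  {lam | (∀ i ∈ lam.parts, i ∈ A ∨ i ∈ B) ∧ ∀ i ∈ B, lam.parts.count i ≤ 1}

theorem prod_partWeight_of_mem {A B : Set ℕ} (hA : ∀ i ∈ A, Odd i) (hB : ∀ i ∈ B, Even i) {n : ℕ}
    {lam : n.Partition} (hlam : lam ∈ partsInDistinct A B n) :
    ∏ i ∈ lam.parts.toFinset, partWeight A B powerSum i (lam.parts.count i) =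
      (-1 : ℂ) ^ (n - lam.parts.card) • p lam := by
  rw [p_eq_prod_powerSum, neg_one_pow_sub_card_eq_prod, ← prod_map_smul,
    Finset.prod_multiset_map_count]
  refine Finset.prod_congr rfl fun i hi => ?_
  rw [Multiset.mem_toFinset] at hi
  rw [partWeight]
  split_ifs with hiA hcount hiB
  · rw [(Nat.Odd.sub_odd (hA i hiA) odd_one).neg_one_pow, one_smul]
  · exact absurd hcount (Multiset.count_ne_zero.mpr hi)
  · rw [(Nat.Even.sub_odd (lam.parts_pos hi) (hB i hiB.1) odd_one).neg_one_pow, hiB.2,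
      neg_one_smul, pow_one]
  · have hi' := (hlam.1 i hi).resolve_left hiA
    exact absurd ⟨hi', le_antisymm (hlam.2 i hi') (Multiset.one_le_count_iff_mem.mpr hi)⟩ hiB

theorem prod_partWeight_of_notMem {A B : Set ℕ} (hAB : Disjoint A B) (w : ℕ → R) {n : ℕ}
    {lam : n.Partition} (hlam : lam ∉ partsInDistinct A B n) :
    ∏ i ∈ lam.parts.toFinset, partWeight A B w i (lam.parts.count i) = 0 := by
  contrapose! hlam
  have hpart : ∀ i ∈ lam.parts, i ∈ A ∨ i ∈ B ∧ lam.parts.count i = 1 := by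
    intro i hi
    by_contra! hc
    refine hlam (Finset.prod_eq_zero (Multiset.mem_toFinset.mpr hi) ?_)
    rw [partWeight, if_neg hc.1, if_neg (Multiset.count_ne_zero.mpr hi),
      if_neg fun h => hc.2 h.1 h.2]
  refine ⟨fun i hi => (hpart i hi).imp_right And.left, fun i hiB => ?_⟩
  by_cases hi : i ∈ lam.parts
  · exact ((hpart i hi).resolve_left (hAB.notMem_of_mem_right hiB)).2.le
  · exact (Multiset.count_eq_zero_of_notMem hi).trans_le zero_le_one

theorem coeff_genFun_partWeight {A B : Set ℕ} (hA : ∀ i ∈ A, Odd i) (hB : ∀ i ∈ B, Even i) (n : ℕ) :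
    coeff n (Nat.Partition.genFun (partWeight A B powerSum)) =
      ∑ lam : n.Partition with lam ∈ partsInDistinct A B n,
        (-1 : ℂ) ^ (n - lam.parts.card) • p lam := by
  have hAB : Disjoint A B := Set.disjoint_left.mpr fun i hiA hiB =>
    Nat.not_even_iff_odd.mpr (hA i hiA) (hB i hiB)
  rw [Nat.Partition.coeff_genFun, Finset.sum_filter]
  refine Finset.sum_congr rfl fun lam _ => ?_
  rw [Finsupp.prod, Multiset.toFinsupp_support]
  simp only [Multiset.toFinsupp_apply]
  split_ifs with hlam
  · exact prod_partWeight_of_mem hA hB hlam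
  · exact prod_partWeight_of_notMem hAB _ hlam

theorem coeff_genFun_partWeight_empty (A : Set ℕ) (n : ℕ) :
    coeff n (Nat.Partition.genFun (partWeight A ∅ powerSum)) =
      powerSumOver {lam : n.Partition | ∀ i ∈ lam.parts, i ∈ A} := by
  rw [Nat.Partition.coeff_genFun, powerSumOver, Finset.sum_filter]
  refine Finset.sum_congr rfl fun lam _ => ?_
  rw [Finsupp.prod, Multiset.toFinsupp_support]
  simp only [Multiset.toFinsupp_apply]
  split_ifs with hlam
  · rw [p_eq_prod_powerSum, Finset.prod_multiset_map_count]
    exact Finset.prod_congr rfl fun i hi => if_pos (hlam i (Multiset.mem_toFinset.mp hi))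
  · exact prod_partWeight_of_notMem (Set.disjoint_empty A) _ fun h =>
      hlam fun i hi => (h.1 i hi).resolve_right (Set.notMem_empty i)

end SignedSums

/-! ### The representations `L_n^S` in terms of power sums -/

section FreePowers

open Equiv

variable {X : Type*} [Fintype X] [DecidableEq X] {σ : Perm X} {m : ℕ}

theorem dvd_orderOf_of_mem_parts (hm : m ∈ σ.partition.parts) : m ∣ orderOf σ := by
  rw [Perm.parts_partition, Multiset.mem_add] at hm
  rcases hm with hm | hm
  · exact Perm.dvd_of_mem_cycleType hm
  · exact Multiset.eq_of_mem_replicate hm ▸ one_dvd _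

theorem exists_pow_apply_eq_self_of_mem_parts (hm : m ∈ σ.partition.parts) :
    ∃ x, (σ ^ m) x = x := by
  rw [Perm.parts_partition, Multiset.mem_add] at hm
  rcases hm with hm | hm
  · obtain ⟨c, τ, hσ, hdisjoint, hc, rfl⟩ := Perm.mem_cycleType_iff.mp hm
    obtain ⟨x, hx⟩ := hc.nonempty_support
    refine ⟨x, ?_⟩
    rw [hσ, hdisjoint.commute.mul_pow, ← hc.orderOf, pow_orderOf_eq_one, one_mul]
    exact Perm.pow_apply_eq_self_of_apply_eq_self
      ((hdisjoint x).resolve_left (Perm.mem_support.mp hx)) _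
  · obtain ⟨hcard, rfl⟩ := Multiset.mem_replicate.mp hm
    have hsupport : σ.support ≠ Finset.univ := fun h =>
      hcard (by rw [h, Finset.card_univ, Nat.sub_self])
    obtain ⟨x, -, hx⟩ := Finset.exists_of_ssubset (Finset.ssubset_univ_iff.mpr hsupport)
    exact ⟨x, by rwa [pow_one, ← Perm.notMem_support]⟩

theorem parts_eq_replicate_of_pow_apply_eq_self_iff {d : ℕ}
    (hd : ∀ x m, (σ ^ m) x = x ↔ d ∣ m) :
    σ.partition.parts = Multiset.replicate (Fintype.card X / d) d := by
  have horder : orderOf σ ∣ d := orderOf_dvd_of_pow_eq_one (Equiv.ext fun x => (hd x d).mpr dvd_rfl)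
  have hparts : ∀ m ∈ σ.partition.parts, m = d := fun m hm => by
    obtain ⟨x, hx⟩ := exists_pow_apply_eq_self_of_mem_parts hm
    exact Nat.dvd_antisymm ((dvd_orderOf_of_mem_parts hm).trans horder) ((hd x m).mp hx)
  rcases Nat.eq_zero_or_pos d with rfl | hd0
  · rw [Nat.div_zero, Multiset.replicate_zero]
    exact Multiset.eq_zero_of_forall_notMem fun m hm =>
      (σ.partition.parts_pos hm).ne' (hparts m hm)
  · have hreplicate := Multiset.eq_replicate_card.mpr hparts
    have hsum := σ.partition.parts_sum
    rw [hreplicate, Multiset.sum_replicate, smul_eq_mul] at hsum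
    rwa [Nat.div_eq_of_eq_mul_left hd0 hsum.symm]

end FreePowers

section CyclicGroup

variable {n : ℕ} [NeZero n]

theorem parts_cyclicHom (k : ZMod n) :
    (cyclicHom n (Multiplicative.ofAdd k)).partition.parts =
      Multiset.replicate (n / addOrderOf k) (addOrderOf k) := by
  rw [parts_eq_replicate_of_pow_apply_eq_self_iff (d := addOrderOf k), ZMod.card]
  intro x m
  have hpow : (cyclicHom n (Multiplicative.ofAdd k) ^ m) x = m • k + x := by
    rw [← map_pow, ← ofAdd_nsmul]
    rfl
  rw [hpow, add_eq_right, addOrderOf_dvd_iff_nsmul_eq_zero]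

/-- The sum of the values of the character `x ↦ exp (2 π i Q x / n)` of `ℤ/n` over the elements of
order `d`; for `d = n` this is the Ramanujan sum `c_n(Q)`. -/
def ramanujanSum (n : ℕ) [NeZero n] (Q d : ℕ) : ℂ :=
  ∑ k : ZMod n with addOrderOf k = d, ZMod.stdAddChar ((Q : ZMod n) * k)

theorem natCast_smul_L (S : Set ℕ) : (n : ℂ) • L S n =
    ∑ d ∈ n.divisors, ramanujanSum n (Qpart S n) d • powerSum d ^ (n / d) := by
  have hn : (n : ℂ) ≠ 0 := Nat.cast_ne_zero.mpr (NeZero.ne n)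
  have hcard : Fintype.card (Multiplicative (ZMod n)) = n :=
    (Fintype.card_multiplicative _).trans (ZMod.card n)
  have horder : ∀ k ∈ (Finset.univ : Finset (ZMod n)), addOrderOf k ∈ n.divisors := fun k _ =>
    Nat.mem_divisors.mpr ⟨addOrderOf_dvd_card.trans (ZMod.card n).dvd, NeZero.ne n⟩
  rw [L_eq_inducedFrob, inducedFrob, hcard, smul_smul, mul_inv_cancel₀ hn, one_smul,
    ← Multiplicative.ofAdd.sum_comp, ← Finset.sum_fiberwise_of_maps_to horder]
  refine Finset.sum_congr rfl fun d _ => ?_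
  rw [ramanujanSum, Finset.sum_smul]
  refine Finset.sum_congr rfl fun k hk => ?_
  rw [p_eq_prod_powerSum, parts_cyclicHom, (Finset.mem_filter.mp hk).2, Multiset.map_replicate,
    Multiset.prod_replicate]
  rfl

theorem sum_divisors_ramanujanSum {e : ℕ} (he : e ≠ 0) (Q : ℕ) :
    ∑ d ∈ e.divisors, ramanujanSum n Q d =
      ∑ k : ZMod n with e • k = 0, ZMod.stdAddChar ((Q : ZMod n) * k) := by
  have horder (k : ZMod n) : e • k = 0 ↔ addOrderOf k ∈ e.divisors := by
    rw [Nat.mem_divisors, addOrderOf_dvd_iff_nsmul_eq_zero, and_iff_left he]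
  rw [← Finset.sum_fiberwise_of_maps_to fun k hk => (horder k).mp (Finset.mem_filter.mp hk).2]
  refine Finset.sum_congr rfl fun d hd => Finset.sum_congr ?_ fun _ _ => rfl
  ext k
  simp only [Finset.mem_filter, Finset.mem_univ, true_and, horder]
  exact ⟨fun hk => ⟨hk ▸ hd, hk⟩, And.right⟩

theorem stdAddChar_natCast_mul_natCast (e m : ℕ) [NeZero e] [NeZero (e * m)] (a : ℕ) :
    ZMod.stdAddChar ((a * m : ℕ) : ZMod (e * m)) = ZMod.stdAddChar (a : ZMod e) := by
  have hm : (m : ℂ) ≠ 0 := Nat.cast_ne_zero.mpr (right_ne_zero_of_mul (NeZero.ne (e * m)))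
  have hleft := ZMod.stdAddChar_coe (N := e * m) (a * m : ℕ)
  have hright := ZMod.stdAddChar_coe (N := e) (a : ℕ)
  rw [Int.cast_natCast] at hleft hright
  rw [hleft, hright]
  congr 1
  push_cast
  field_simp

/-- The `e`-torsion of `ℤ/em` is a copy of `ℤ/e`. -/
theorem sum_torsion_stdAddChar (e m : ℕ) [NeZero e] [NeZero (e * m)] (Q : ℕ) :
    ∑ k : ZMod (e * m) with e • k = 0, ZMod.stdAddChar ((Q : ZMod (e * m)) * k) =
      ∑ j : ZMod e, ZMod.stdAddChar ((Q : ZMod e) * j) := by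
  have he : 0 < e := Nat.pos_of_ne_zero (NeZero.ne e)
  have hm : 0 < m := Nat.pos_of_ne_zero (right_ne_zero_of_mul (NeZero.ne (e * m)))
  refine (Finset.sum_nbij (fun j : ZMod e => ((j.val * m : ℕ) : ZMod (e * m))) ?_ ?_ ?_ ?_).symm
  · intro j _
    rw [Finset.mem_filter, nsmul_eq_mul, ← Nat.cast_mul, ZMod.natCast_eq_zero_iff]
    exact ⟨Finset.mem_univ _, j.val, by ring⟩
  · intro i _ j _ hij
    have hlt (j : ZMod e) : j.val * m < e * m := Nat.mul_lt_mul_of_pos_right j.val_lt hm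
    rw [ZMod.natCast_eq_natCast_iff', Nat.mod_eq_of_lt (hlt i), Nat.mod_eq_of_lt (hlt j)] at hij
    exact ZMod.val_injective e (Nat.eq_of_mul_eq_mul_right hm hij)
  · intro k hk
    have htorsion : e • k = 0 := (Finset.mem_filter.mp hk).2
    rw [← ZMod.natCast_zmod_val k, nsmul_eq_mul, ← Nat.cast_mul, ZMod.natCast_eq_zero_iff,
      Nat.mul_dvd_mul_iff_left he] at htorsion
    obtain ⟨j, hj⟩ := htorsion
    have hje : j < e := Nat.lt_of_mul_lt_mul_left (a := m) (by linarith [k.val_lt])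
    refine ⟨j, Finset.mem_coe.mpr (Finset.mem_univ _), ?_⟩
    beta_reduce
    rw [← ZMod.natCast_zmod_val k, hj, ZMod.val_cast_of_lt hje, mul_comm j m]
  · intro j _
    rw [← Nat.cast_mul, ← mul_assoc, stdAddChar_natCast_mul_natCast, Nat.cast_mul,
      ZMod.natCast_zmod_val]

theorem sum_divisors_ramanujanSum_of_dvd {e : ℕ} (he : e ∣ n) (Q : ℕ) :
    ∑ d ∈ e.divisors, ramanujanSum n Q d = if e ∣ Q then (e : ℂ) else 0 := by
  obtain ⟨m, rfl⟩ := he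
  have : NeZero e := ⟨left_ne_zero_of_mul (NeZero.ne (e * m))⟩
  have hsum := AddChar.sum_mulShift (Q : ZMod e) (ZMod.isPrimitive_stdAddChar e)
  simp only [ZMod.natCast_eq_zero_iff, ZMod.card, Nat.cast_ite, Nat.cast_zero,
    mul_comm _ (Q : ZMod e)] at hsum
  rw [sum_divisors_ramanujanSum (NeZero.ne e), sum_torsion_stdAddChar, hsum]

end CyclicGroup

section PrimeWeight

theorem dvd_Qpart_iff (S : Set ℕ) {e n : ℕ} (hn : n ≠ 0) (he : e ∣ n) :
    e ∣ Qpart S n ↔ e ∈ P S := by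
  have he0 : e ≠ 0 := ne_zero_of_dvd_ne_zero hn he
  constructor
  · refine fun h => ⟨Nat.one_le_iff_ne_zero.mpr he0, fun q hq hqe => ?_⟩
    obtain ⟨r, hr, hqr⟩ := (hq.prime.dvd_finsetProd_iff _).mp (hqe.trans h)
    obtain ⟨hrn, hrS⟩ := Finset.mem_filter.mp hr
    rwa [(Nat.prime_dvd_prime_iff_eq hq (Nat.prime_of_mem_primeFactors hrn)).mp
      (hq.dvd_of_dvd_pow hqr)]
  · intro h
    rw [← Nat.prod_factorization_pow_eq_self he0, Qpart]
    have hsubset : e.primeFactors ⊆ n.primeFactors.filter (· ∈ S) := fun q hq =>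
      Finset.mem_filter.mpr ⟨Nat.primeFactors_mono he hn hq,
        h.2 q (Nat.prime_of_mem_primeFactors hq) (Nat.dvd_of_mem_primeFactors hq)⟩
    refine dvd_trans ?_ (Finset.prod_dvd_prod_of_subset _ _ _ hsubset)
    exact Finset.prod_dvd_prod_of_dvd _ _ fun q _ =>
      pow_dvd_pow q ((Nat.factorization_le_iff_dvd he0 hn).mpr he q)

/-- The function `e ↦ e` on `P(S)`, extended by zero. -/
def weightOn (S : Set ℕ) (e : ℕ) : ℂ := if e ∈ P S then (e : ℂ) else 0

/-- The Möbius transform of `weightOn S`; it gives the coefficients of `n L_n^S` in terms of the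
power sums `p_d ^ (n / d)`, independently of `n`. -/
def primeWeight (S : Set ℕ) (d : ℕ) : ℂ :=
  ∑ x ∈ d.divisorsAntidiagonal, (ArithmeticFunction.moebius x.1 : ℂ) * weightOn S x.2

theorem sum_primeWeight (S : Set ℕ) {e : ℕ} (he : e ≠ 0) :
    ∑ d ∈ e.divisors, primeWeight S d = weightOn S e :=
  (ArithmeticFunction.sum_eq_iff_sum_mul_moebius_eq (f := primeWeight S) (g := weightOn S)).mpr
    (fun _ _ => rfl) e (Nat.pos_of_ne_zero he)

theorem ramanujanSum_Qpart (S : Set ℕ) {n : ℕ} [NeZero n] {d : ℕ} (hd : d ∣ n) :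
    ramanujanSum n (Qpart S n) d = primeWeight S d := by
  have hsum : ∀ e > 0, e ∣ n →
      ∑ i ∈ e.divisors, ramanujanSum n (Qpart S n) i = weightOn S e := fun e _ he => by
    rw [sum_divisors_ramanujanSum_of_dvd he]
    exact if_congr (dvd_Qpart_iff S (NeZero.ne n) he) rfl rfl
  have hmoebius := (ArithmeticFunction.sum_eq_iff_sum_mul_moebius_eq_on {e | e ∣ n}
    fun a b hab hb => hab.trans hb).mp hsum
  exact (hmoebius d (Nat.pos_of_dvd_of_pos hd (Nat.pos_of_neZero n)) hd).symm

theorem natCast_smul_coeff_LSeries (S : Set ℕ) (n : ℕ) :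
    (n : ℂ) • PowerSeries.coeff n (LSeries S) =
      ∑ d ∈ n.divisors, primeWeight S d • powerSum d ^ (n / d) := by
  rcases eq_or_ne n 0 with rfl | hn
  · simp
  have : NeZero n := ⟨hn⟩
  rw [LSeries, PowerSeries.coeff_mk, dif_neg hn, natCast_smul_L]
  exact Finset.sum_congr rfl fun d hd => by rw [ramanujanSum_Qpart S (Nat.dvd_of_mem_divisors hd)]

theorem adams_powerSum (k d : ℕ) : adams k (powerSum d) = powerSum (k * d) := by
  funext N
  simp only [adams, powerSum, MvPolynomial.psum, map_sum, map_pow, MvPolynomial.expand_X, pow_mul]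

theorem sum_divisors_sum_divisors_div {M : Type*} [AddCommMonoid M] (n : ℕ) (F : ℕ → ℕ → M) :
    ∑ k ∈ n.divisors, ∑ d ∈ (n / k).divisors, F k d =
      ∑ e ∈ n.divisors, ∑ d ∈ e.divisors, F (e / d) d := by
  have hcofactor (k : ℕ) : ∑ d ∈ (n / k).divisors, F k d =
      ∑ y ∈ (n / k).divisorsAntidiagonal, F k y.1 :=
    (Nat.sum_divisorsAntidiagonal fun d _ => F k d).symm
  simp only [hcofactor, ← Nat.sum_divisorsAntidiagonal' F]
  rw [← Nat.sum_divisorsAntidiagonal fun k m => ∑ y ∈ m.divisorsAntidiagonal, F k y.1,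
    ← Nat.sum_divisorsAntidiagonal fun e _ => ∑ y ∈ e.divisorsAntidiagonal, F y.1 y.2,
    Finset.sum_sigma', Finset.sum_sigma']
  refine Finset.sum_nbij' (fun x => ⟨(x.1.1 * x.2.1, x.2.2), (x.1.1, x.2.1)⟩)
    (fun x => ⟨(x.2.1, x.2.2 * x.1.2), (x.2.2, x.1.2)⟩) ?_ ?_ ?_ ?_ ?_ <;>
  grind [Nat.mem_divisorsAntidiagonal]

theorem logDerivSeries_LSeries (S : Set ℕ) (c : ℕ → ℂ) :
    logDerivSeries c (LSeries S) = PowerSeries.mk fun n =>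
      ∑ e ∈ n.divisors, (∑ d ∈ e.divisors, c (e / d) * primeWeight S d) •
        powerSum e ^ (n / e) := by
  have hadams (k m : ℕ) : adams k (∑ d ∈ m.divisors, primeWeight S d • powerSum d ^ (m / d)) =
      ∑ d ∈ m.divisors, primeWeight S d • powerSum (k * d) ^ (m / d) := by
    simp only [← adams_powerSum]
    exact (map_sum (adamsHom k) _ _).trans (Finset.sum_congr rfl fun d _ =>
      (map_smul (adamsHom k) _ _).trans (congrArg _ (map_pow (adamsHom k) _ _)))
  rw [logDerivSeries]
  congr 1
  funext n
  simp only [natCast_smul_coeff_LSeries, hadams, Finset.smul_sum, smul_smul]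
  simp only [Nat.div_div_eq_div_mul]
  rw [sum_divisors_sum_divisors_div]
  refine Finset.sum_congr rfl fun e _ => ?_
  rw [Finset.sum_smul]
  refine Finset.sum_congr rfl fun d hd => ?_
  rw [Nat.div_mul_cancel (Nat.dvd_of_mem_divisors hd)]

theorem neg_one_pow_pred {m : ℕ} (hm : 0 < m) :
    (-1 : ℂ) ^ (m - 1) = 1 - if Even m then 2 else 0 := by
  split_ifs with heven
  · rw [(Nat.Even.sub_odd hm heven odd_one).neg_one_pow]
    norm_num
  · rw [(Nat.Odd.sub_odd (Nat.not_even_iff_odd.mp heven) odd_one).neg_one_pow, sub_zero]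

theorem filter_even_div_divisors_two_mul {f : ℕ} (hf : f ≠ 0) :
    (2 * f).divisors.filter (fun d => Even (2 * f / d)) = f.divisors := by
  ext d
  simp only [Finset.mem_filter, Nat.mem_divisors]
  constructor
  · rintro ⟨⟨hdvd, -⟩, heven⟩
    obtain ⟨g, hg⟩ := heven.two_dvd
    have hmul := Nat.mul_div_cancel' hdvd
    rw [hg] at hmul
    exact ⟨⟨g, by linarith⟩, hf⟩
  · rintro ⟨⟨g, rfl⟩, -⟩
    have hd : 0 < d := Nat.pos_of_ne_zero (left_ne_zero_of_mul hf)
    refine ⟨⟨⟨2 * g, by ring⟩, mul_ne_zero two_ne_zero hf⟩, ?_⟩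
    rw [mul_left_comm, Nat.mul_div_cancel_left _ hd]
    exact even_two_mul g

theorem sum_neg_one_pow_mul_primeWeight (S : Set ℕ) {e : ℕ} (he : e ≠ 0) :
    ∑ d ∈ e.divisors, (-1 : ℂ) ^ (e / d - 1) * primeWeight S d =
      weightOn S e - if Even e then 2 * weightOn S (e / 2) else 0 := by
  have hterm : ∀ d ∈ e.divisors, (-1 : ℂ) ^ (e / d - 1) * primeWeight S d =
      primeWeight S d - if Even (e / d) then 2 * primeWeight S d else 0 := fun d hd => by
    rw [neg_one_pow_pred (Nat.div_pos (Nat.divisor_le hd) (Nat.pos_of_mem_divisors hd)), sub_mul,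
      one_mul, ite_mul, zero_mul]
  rw [Finset.sum_congr rfl hterm, Finset.sum_sub_distrib, sum_primeWeight S he,
    ← Finset.sum_filter]
  congr 1
  split_ifs with heven
  · obtain ⟨f, rfl⟩ := heven.two_dvd
    have hf : f ≠ 0 := right_ne_zero_of_mul he
    rw [filter_even_div_divisors_two_mul hf, Nat.mul_div_cancel_left f two_pos,
      ← sum_primeWeight S hf, Finset.mul_sum]
  · refine Finset.sum_eq_zero fun d hd => absurd ?_ heven
    obtain ⟨hdvd, hquot⟩ := Finset.mem_filter.mp hd
    rw [← Nat.div_mul_cancel (Nat.dvd_of_mem_divisors hdvd)]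
    exact hquot.mul_right d

end PrimeWeight

/-! ### The plethystic exponentials of `L^S` -/

section Main

open PowerSeries

theorem coeff_zero_LSeries (S : Set ℕ) : coeff 0 (LSeries S) = 0 := by
  rw [LSeries, coeff_mk, dif_pos rfl]

theorem coeff_EPleth_LSeries_mem_monomialFrob (S : Set ℕ) (n : ℕ) :
    coeff n (EPleth (LSeries S)) ∈ monomialFrob n := by
  refine coeff_EPleth_mem_monomialFrob (coeff_zero_LSeries S) (fun i hi r => ?_) n
  have : NeZero i := ⟨hi⟩
  rw [LSeries, coeff_mk, dif_neg hi, L_eq_inducedFrob]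
  simpa only [ZMod.card] using exteriorPleth_mem_monomialFrob (cyclicHom i) _ r

theorem eq_genFun_partWeight {A B : Set ℕ} {y : PowerSeries SymFn} {c : ℕ → ℂ}
    (hy : eulerDerivation SymFn y = (mk fun n => ∑ e ∈ n.divisors, c e • powerSum e ^ (n / e)) * y)
    (hconst : coeff 0 y = 1) (hc : ∀ e, e ≠ 0 → c e = e * partSign A B e) :
    y = Nat.Partition.genFun (partWeight A B powerSum) := by
  have hsum (n : ℕ) : ∑ e ∈ n.divisors, c e • powerSum e ^ (n / e) =
      ∑ e ∈ n.divisors, ((e * partSign A B e : ℤ) : SymFn) * powerSum e ^ (n / e) := by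
    refine Finset.sum_congr rfl fun e he => ?_
    rw [hc e (Nat.pos_of_mem_divisors he).ne', ← zsmul_eq_mul, ← Int.cast_smul_eq_zsmul ℂ]
    push_cast
    rfl
  simp only [hsum] at hy
  refine eq_of_eulerDerivation_eq_mul hy (eulerDerivation_genFun_partWeight A B powerSum) ?_ ?_
  · rw [hconst, Nat.Partition.coeff_genFun]
    simp
  · rw [coeff_mk, Nat.divisors_zero, Finset.sum_empty]

theorem HPleth_LSeries_eq_genFun (S : Set ℕ) :
    HPleth (LSeries S) = Nat.Partition.genFun (partWeight (P S) ∅ powerSum) := by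
  refine eq_genFun_partWeight (c := fun e => ∑ d ∈ e.divisors, 1 * primeWeight S d) ?_
    (coeff_zero_HPleth _) fun e he => ?_
  · rw [eulerDerivation_HPleth (coeff_zero_LSeries S), logDerivSeries_LSeries]
  · simp only [one_mul, sum_primeWeight S he]
    simp [weightOn, partSign]

theorem EPleth_LSeries_eq_genFun (S : Set ℕ) {A B : Set ℕ}
    (h : ∀ e, e ≠ 0 → weightOn S e - (if Even e then 2 * weightOn S (e / 2) else 0) =
      e * partSign A B e) :
    EPleth (LSeries S) = Nat.Partition.genFun (partWeight A B powerSum) := by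
  refine eq_genFun_partWeight
    (c := fun e => ∑ d ∈ e.divisors, (-1) ^ (e / d - 1) * primeWeight S d) ?_
    (coeff_zero_EPleth _) fun e he => (sum_neg_one_pow_mul_primeWeight S he).trans (h e he)
  rw [eulerDerivation_EPleth (coeff_zero_LSeries S), logDerivSeries_LSeries]

theorem two_mul_mem_P {S : Set ℕ} (h2 : 2 ∈ S) {m : ℕ} : 2 * m ∈ P S ↔ m ∈ P S := by
  constructor
  · rintro ⟨hpos, hprimes⟩
    exact ⟨by omega, fun q hq hqm => hprimes q hq (hqm.mul_left 2)⟩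
  · rintro ⟨hpos, hprimes⟩
    refine ⟨by omega, fun q hq hqm => ?_⟩
    rcases hq.dvd_mul.mp hqm with hq2 | hqm
    · rwa [(Nat.prime_dvd_prime_iff_eq hq Nat.prime_two).mp hq2]
    · exact hprimes q hq hqm

theorem odd_of_mem_P {S : Set ℕ} (h2 : 2 ∉ S) {m : ℕ} (hm : m ∈ P S) : Odd m := by
  rw [← Nat.not_even_iff_odd]
  exact fun h => h2 (hm.2 2 Nat.prime_two h.two_dvd)

theorem mem_P_diff_two {S : Set ℕ} {m : ℕ} : m ∈ P (S \ {2}) ↔ Odd m ∧ m ∈ P S := by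
  constructor
  · exact fun h => ⟨odd_of_mem_P (fun h2 => h2.2 rfl) h, h.1, fun q hq hqm => (h.2 q hq hqm).1⟩
  · rintro ⟨hodd, hpos, hprimes⟩
    refine ⟨hpos, fun q hq hqm => ⟨hprimes q hq hqm, ?_⟩⟩
    rintro rfl
    exact Nat.not_even_iff_odd.mpr hodd (even_iff_two_dvd.mpr hqm)

theorem oddParts_eq_partsIn (S : Set ℕ) (n : ℕ) : oddParts S n = partsIn (S \ {2}) n := by
  ext lam
  exact forall₂_congr fun i _ => mem_P_diff_two.symm

theorem HPleth_LSeries (S : Set ℕ) :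
    HPleth (LSeries S) = mk fun n => powerSumOver (partsIn S n) := by
  ext1 n
  rw [HPleth_LSeries_eq_genFun, coeff_genFun_partWeight_empty, coeff_mk]
  rfl

theorem EPleth_LSeries_eq_HPleth_LSeries {S : Set ℕ} (h2 : 2 ∈ S) :
    EPleth (LSeries S) = HPleth (LSeries (S \ {2})) := by
  rw [HPleth_LSeries_eq_genFun]
  refine EPleth_LSeries_eq_genFun S fun e _ => ?_
  simp only [partSign, weightOn, mem_P_diff_two, Set.mem_empty_iff_false, if_false]
  rcases Nat.even_or_odd e with heven | hodd
  · obtain ⟨f, rfl⟩ := heven.two_dvd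
    rw [Nat.mul_div_cancel_left f two_pos, if_pos heven, two_mul_mem_P h2,
      if_neg (c := Odd (2 * f) ∧ f ∈ P S) fun h => Nat.not_even_iff_odd.mpr h.1 heven]
    split_ifs <;> simp
  · rw [if_neg (Nat.not_even_iff_odd.mpr hodd)]
    simp [hodd]

/-- The doubles of the odd elements of `P(S)`: the even parts allowed in `partsInOrTwice`. -/
def twiceOdd (S : Set ℕ) : Set ℕ := {i | ∃ m, Odd m ∧ m ∈ P S ∧ i = 2 * m}

theorem even_of_mem_twiceOdd {S : Set ℕ} {i : ℕ} (hi : i ∈ twiceOdd S) : Even i := by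
  obtain ⟨m, -, -, rfl⟩ := hi
  exact even_two_mul m

theorem two_mul_mem_twiceOdd {S : Set ℕ} (h2 : 2 ∉ S) {m : ℕ} :
    2 * m ∈ twiceOdd S ↔ m ∈ P S := by
  constructor
  · rintro ⟨m', -, hm', heq⟩
    rwa [Nat.eq_of_mul_eq_mul_left two_pos heq]
  · exact fun hm => ⟨m, odd_of_mem_P h2 hm, hm, rfl⟩

theorem EPleth_LSeries_of_two_notMem {S : Set ℕ} (h2 : 2 ∉ S) : EPleth (LSeries S) =
    Nat.Partition.genFun (partWeight (P S) (twiceOdd S) powerSum) := by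
  refine EPleth_LSeries_eq_genFun S fun e _ => ?_
  simp only [partSign, weightOn]
  rcases Nat.even_or_odd e with heven | hodd
  · obtain ⟨f, rfl⟩ := heven.two_dvd
    have hf : 2 * f ∉ P S := fun h => Nat.not_even_iff_odd.mpr (odd_of_mem_P h2 h) heven
    rw [Nat.mul_div_cancel_left f two_pos, if_pos heven, if_neg hf, if_neg hf]
    simp only [two_mul_mem_twiceOdd h2]
    split_ifs <;> simp
  · have he : e ∉ twiceOdd S := fun h => Nat.not_even_iff_odd.mpr hodd (even_of_mem_twiceOdd h)
    rw [if_neg (Nat.not_even_iff_odd.mpr hodd), if_neg he]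
    simp

theorem partsInOrTwice_eq_partsInDistinct {S : Set ℕ} (h2 : 2 ∉ S) (n : ℕ) :
    partsInOrTwice S n = partsInDistinct (P S) (twiceOdd S) n := by
  ext lam
  refine and_congr_right fun hparts =>
    ⟨fun h i hi => h i (even_of_mem_twiceOdd hi), fun h i heven => ?_⟩
  by_cases hi : i ∈ lam.parts
  · exact h i ((hparts i hi).resolve_left fun hP =>
      Nat.not_even_iff_odd.mpr (odd_of_mem_P h2 hP) heven)
  · exact (Multiset.count_eq_zero_of_notMem hi).trans_le zero_le_one

theorem schurPositive_powerSumOver_of_signed_mem {n : ℕ} {T : Set n.Partition}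
    (hT : ∑ lam : n.Partition with lam ∈ T, (-1 : ℂ) ^ (n - lam.parts.card) • p lam ∈
      monomialFrob n) : SchurPositive n (powerSumOver T) := by
  let χ : n.Partition → ℂ := fun lam =>
    if lam ∈ T then (-1) ^ (n - lam.parts.card) * zee lam else 0
  have hfrob :
      frob χ = ∑ lam : n.Partition with lam ∈ T, (-1 : ℂ) ^ (n - lam.parts.card) • p lam := by
    rw [frob_eq_sum, Finset.sum_filter]
    refine Finset.sum_congr rfl fun lam _ => ?_
    have hzee := zee_ne_zero lam
    simp only [χ]
    split_ifs
    · congr 1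
      field_simp
    · simp
  have htwist : frob (signTwist χ) = powerSumOver T := by
    rw [frob_eq_sum, powerSumOver, Finset.sum_filter]
    refine Finset.sum_congr rfl fun lam _ => ?_
    have hzee := zee_ne_zero lam
    simp only [χ, signTwist]
    split_ifs
    · rw [← mul_assoc, ← mul_pow, neg_one_mul, neg_neg, one_pow, one_mul, mul_inv_cancel₀ hzee,
        one_smul]
    · simp
  rw [← htwist]
  exact schurPositive_signTwist (hfrob ▸ hT)

theorem schurPositive_powerSumOver_oddParts {S : Set ℕ} (h2 : 2 ∈ S) (n : ℕ) :
    SchurPositive n (powerSumOver (oddParts S n)) := by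
  have hmem := coeff_EPleth_LSeries_mem_monomialFrob S n
  rw [EPleth_LSeries_eq_HPleth_LSeries h2, HPleth_LSeries, coeff_mk, ← oddParts_eq_partsIn] at hmem
  exact schurPositive_of_mem_monomialFrob hmem

theorem schurPositive_powerSumOver_partsInOrTwice {S : Set ℕ} (h2 : 2 ∉ S) (n : ℕ) :
    SchurPositive n (powerSumOver (partsInOrTwice S n)) := by
  have hmem := coeff_EPleth_LSeries_mem_monomialFrob S n
  rw [EPleth_LSeries_of_two_notMem h2, coeff_genFun_partWeight (fun i => odd_of_mem_P h2)
    (fun i => even_of_mem_twiceOdd), ← partsInOrTwice_eq_partsInDistinct h2] at hmem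
  exact schurPositive_powerSumOver_of_signed_mem hmem

end Main

end PrimeLie

end

theorem mainTheorem9 (S : Set ℕ) (hS : ∀ q ∈ S, q.Prime) :
    (2 ∈ S →
      (∀ n : ℕ, PrimeLie.SchurPositive n (PrimeLie.powerSumOver (PrimeLie.oddParts S n))) ∧
      PrimeLie.HPleth (PrimeLie.LSeries (S \ {2})) =
        PowerSeries.mk (fun n => PrimeLie.powerSumOver (PrimeLie.oddParts S n)) ∧
      PrimeLie.EPleth (PrimeLie.LSeries S) =
        PowerSeries.mk (fun n => PrimeLie.powerSumOver (PrimeLie.oddParts S n)) ∧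
      PowerSeries.mk (fun n => PrimeLie.powerSumOver (PrimeLie.oddParts S n)) =
        PowerSeries.mk (fun n => PrimeLie.powerSumOver (PrimeLie.partsIn (S \ {2}) n))) ∧
    (2 ∉ S →
      (∀ m ∈ PrimeLie.P S, Odd m) ∧
      ∀ n : ℕ, PrimeLie.SchurPositive n
        (PrimeLie.powerSumOver (PrimeLie.partsInOrTwice S n))) := by
  have hH : PrimeLie.HPleth (PrimeLie.LSeries (S \ {2})) =
      PowerSeries.mk fun n => PrimeLie.powerSumOver (PrimeLie.oddParts S n) := by
    simp only [PrimeLie.HPleth_LSeries, PrimeLie.oddParts_eq_partsIn]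
  refine ⟨fun h2 => ⟨PrimeLie.schurPositive_powerSumOver_oddParts h2, hH,
    (PrimeLie.EPleth_LSeries_eq_HPleth_LSeries h2).trans hH, ?_⟩, fun h2 =>
    ⟨fun m => PrimeLie.odd_of_mem_P h2, PrimeLie.schurPositive_powerSumOver_partsInOrTwice h2⟩⟩
  simp only [PrimeLie.oddParts_eq_partsIn]
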